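/- **Theorem (Rellich).** Let $H_0,H_1$ be complex Hilbert spaces and $\mathcal X\subset\mathbb R$ open. For every $\chi\in\mathcal X$ let $\langle\cdot,\cdot\rangle_{0,\chi}$ and $\langle\cdot,\cdot\rangle_{1,\chi}$ be scalar products on $H_0$ and $H_1$ (linear in the first, antilinear in the second argument) whose norms are equivalent to the given ones; write $H_{0,\chi},H_{1,\chi}$ for the resulting Hilbert spaces. Let $A_\chi:V\subset H_{0,\chi}\to H_{1,\chi}$ be densely defined closed linear operators whose domain $V$ does not depend on $\chi$ and whose graph norms are equivalent to each other; endow $V$ with one of these graph norms, and let $V'_\sharp$ be the space of continuous antilinear functionals on $V$. Assume that for every $\chi\in\mathcal X$ the embedding into $H_0$ of the domain $V\cap N(A_\chi)^{\perp}$ of the reduced operator (orthogonality in $H_{0,\chi}$, graph norm of $A_\chi$) is compact. Let $T_\chi=A_\chi^*A_\chi$, where $A_\chi^*$ is the adjoint of $A_\chi:H_{0,\chi}\to H_{1,\chi}$, and let $0<\lambda_{\chi,1}\le\lambda_{\chi,2}\le\cdots$ be the positive eigenvalues of $T_\chi$, repeated according to multiplicity. Let $r=1$ or $r=\omega$ (real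 analytic), and assume that the maps $\chi\mapsto\mathcal T_\chi\in\mathcal L(V,V'_\sharp)$, $\langle\mathcal T_\chi u,v\rangle=\langle A_\chi u,A_\chi v\rangle_{1,\chi}$, and $\chi\mapsto\mathcal J_\chi\in\mathcal L(H_0,V'_\sharp)$, $\langle\mathcal J_\chi u,v\rangle=\langle u,v\rangle_{0,\chi}$, are of class $C^r$ on $\mathcal X$. Let $\bar\chi\in\mathcal X$ and let $\bar\lambda>0$ be an eigenvalue of $T_{\bar\chi}$ of multiplicity $m\ge 1$, with $\bar\lambda=\lambda_{\bar\chi,k}=\dots=\lambda_{\bar\chi,k+m-1}$, $k\ge1$. Then there are an open neighbourhood $U\subset\mathcal X$ of $\bar\chi$, a number $\varepsilon>0$ and functions $\zeta_1,\dots,\zeta_m:U\to(\bar\lambda-\varepsilon,\bar\lambda+\varepsilon)$ of class $C^r$ with $\zeta_i(\bar\chi)=\bar\lambda$ such that the following hold. 1. For every $\chi\in U$, the eigenvalues of $T_\chi$ in $(\bar\lambda-\varepsilon,\bar\lambda+\varepsilon)$, repeated according to multiplicity, are $\zeta_1(\chi),\dots,\zeta_m(\chi)$. 2. If $\delta(N(A_{\bar\chi}),N(A_\chi))\to0$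 as $\chi\to\bar\chi$, where $\delta(M,N)=\sup\{\operatorname{dist}(u,N):u\in M,\ \|u\|=1\}$ (for instance, if $N(A_\chi)$ does not depend on $\chi$), then for all $\chi$ sufficiently close to $\bar\chi$ the numbers $\zeta_1(\chi),\dots,\zeta_m(\chi)$ are, up to order, $\lambda_{\chi,k},\dots,\lambda_{\chi,k+m-1}$. 3. For every basis $u_1,\dots,u_m$ of the eigenspace of $T_{\bar\chi}$ for $\bar\lambda$ that is orthonormal in $H_{0,\bar\chi}$, the derivatives below exist and $\zeta_1'(\bar\chi),\dots,\zeta_m'(\bar\chi)$ are the eigenvalues, repeated according to multiplicity, of the matrix $$\left(\frac{d}{d\chi}\langle A_\chi u_h,A_\chi u_l\rangle_{1,\chi}\Big|_{\chi=\bar\chi}-\bar\lambda\,\frac{d}{d\chi}\langle u_h,u_l\rangle_{0,\chi}\Big|_{\chi=\bar\chi}\right)_{h,l=1,\dots,m}.$$ -/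

import Mathlib

open Set Filter Topology
open scoped ContDiff ComplexConjugate

noncomputable section

namespace HilbertPerturbation

/-! ### Graph norms -/

section GraphSpace

variable {H₀ H₁ : Type*} [NormedAddCommGroup H₀] [InnerProductSpace ℂ H₀]
  [NormedAddCommGroup H₁] [InnerProductSpace ℂ H₁]

/-- The domain `V` of an operator `B : V ⊆ H₀ → H₁`, as a normed space with the graph norm
`(‖x‖² + ‖B x‖²)^(1/2)` of `B` (and not with the norm of `H₀`). -/
def GraphSpace (V : Submodule ℂ H₀) (_B : V →ₗ[ℂ] H₁) : Type _ := V

variable {V : Submodule ℂ H₀} {B : V →ₗ[ℂ] H₁}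

instance : AddCommGroup (GraphSpace V B) := inferInstanceAs (AddCommGroup V)

instance : Module ℂ (GraphSpace V B) := inferInstanceAs (Module ℂ V)

variable (V B) in
/-- The identity, forgetting the graph norm. -/
def GraphSpace.toDomain : GraphSpace V B ≃ₗ[ℂ] V := LinearEquiv.refl ℂ V

variable (V B) in
/-- The map `x ↦ (x, B x)` into the Hilbert space `H₀ ⊕ H₁`; it induces the graph norm. -/
def GraphSpace.toGraph : GraphSpace V B →ₗ[ℂ] WithLp 2 (H₀ × H₁) :=
  (WithLp.linearEquiv 2 ℂ (H₀ × H₁)).symm.toLinearMap ∘ₗ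
    (V.subtype.prod B) ∘ₗ (GraphSpace.toDomain V B).toLinearMap

theorem GraphSpace.toGraph_injective : Function.Injective (GraphSpace.toGraph V B) := by
  intro x y h
  have h2 := congrArg (fun p : WithLp 2 (H₀ × H₁) => p.fst) h
  exact (GraphSpace.toDomain V B).injective (Subtype.ext h2)

instance : NormedAddCommGroup (GraphSpace V B) :=
  NormedAddCommGroup.induced _ _ (GraphSpace.toGraph V B) GraphSpace.toGraph_injective

instance : NormedSpace ℂ (GraphSpace V B) :=
  NormedSpace.induced ℂ _ _ (GraphSpace.toGraph V B)

/-- The domain `D(B) ∩ N(B)^⊥` of the reduced operator of `B`, the orthogonal complement being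
taken with respect to the scalar product `ip` on `H₀`. It carries the graph norm of `B`. -/
def reducedDomain (ip : InnerProductSpace.Core ℂ H₀) (V : Submodule ℂ H₀) (B : V →ₗ[ℂ] H₁) :
    Submodule ℂ (GraphSpace V B) where
  carrier := {x | ∀ y : V, B y = 0 → ip.inner (y : H₀) (GraphSpace.toDomain V B x : H₀) = 0}
  add_mem' := by
    intro a b ha hb y hy
    have h1 := ha y hy
    have h2 := hb y hy
    rw [← ip.conj_inner_symm] at h1 h2 ⊢
    simp only [map_add, Submodule.coe_add, ip.add_left] at h1 h2 ⊢
    rw [h1, h2, add_zero]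
  zero_mem' := by
    intro y _
    rw [← ip.conj_inner_symm]
    have h := ip.smul_left (0 : H₀) (y : H₀) 0
    simp only [zero_smul, map_zero, zero_mul] at h
    simp [h]
  smul_mem' := by
    intro c a ha y hy
    have h1 := ha y hy
    rw [← ip.conj_inner_symm] at h1 ⊢
    simp only [map_smul, Submodule.coe_smul, ip.smul_left, map_mul] at h1 ⊢
    rw [h1, mul_zero]

end GraphSpace

/-- The one-sided gap `δ(M, N) = sup {dist(u, N) : u ∈ M, ‖u‖ = 1}` between two subspaces. -/
def gapDelta {Z : Type*} [NormedAddCommGroup Z] [NormedSpace ℂ Z] (M N : Submodule ℂ Z) : ℝ :=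
  sSup {d : ℝ | ∃ u ∈ M, ‖u‖ = 1 ∧ d = Metric.infDist u (N : Set Z)}

/-! ### Families of closed operators and scalar products -/

/-- Families `⟨·,·⟩_{0,χ}`, `⟨·,·⟩_{1,χ}` of scalar products on two Hilbert spaces `H₀`, `H₁` and a
family of densely defined closed operators `A_χ : V ⊆ H₀ → H₁` with a common domain `V`, for
parameters `χ` in an open set `params` of a real normed space `X`. Values at `χ ∉ params` are
irrelevant and unconstrained. -/
structure OperatorFamily (X H₀ H₁ : Type*) [NormedAddCommGroup X] [NormedSpace ℝ X]
    [NormedAddCommGroup H₀] [InnerProductSpace ℂ H₀]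
    [NormedAddCommGroup H₁] [InnerProductSpace ℂ H₁] where
  /-- the open set of parameters -/
  params : Set X
  isOpen_params : IsOpen params
  /-- the scalar products on `H₀` -/
  ip₀ : X → InnerProductSpace.Core ℂ H₀
  /-- the scalar products on `H₁` -/
  ip₁ : X → InnerProductSpace.Core ℂ H₁
  /-- their norms are equivalent to the norm of `H₀` -/
  ip₀_equiv : ∀ χ ∈ params, ∃ c > 0, ∃ C > 0, ∀ u : H₀,
    c * ‖u‖ ^ 2 ≤ ((ip₀ χ).inner u u).re ∧ ((ip₀ χ).inner u u).re ≤ C * ‖u‖ ^ 2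
  /-- their norms are equivalent to the norm of `H₁` -/
  ip₁_equiv : ∀ χ ∈ params, ∃ c > 0, ∃ C > 0, ∀ u : H₁,
    c * ‖u‖ ^ 2 ≤ ((ip₁ χ).inner u u).re ∧ ((ip₁ χ).inner u u).re ≤ C * ‖u‖ ^ 2
  /-- the common domain of the operators -/
  V : Submodule ℂ H₀
  dense_V : Dense (V : Set H₀)
  /-- the operators -/
  A : X → V →ₗ[ℂ] H₁
  closed_A : ∀ χ ∈ params, LinearPMap.IsClosed (LinearPMap.mk V (A χ))
  /-- the parameter whose graph norm is used as the norm of `V` -/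
  ref : X
  ref_mem : ref ∈ params
  /-- the graph norms are equivalent to each other -/
  graph_equiv : ∀ χ ∈ params, ∃ c > 0, ∃ C > 0, ∀ x : V,
    c * (‖(x : H₀)‖ + ‖A ref x‖) ≤ ‖(x : H₀)‖ + ‖A χ x‖ ∧
      ‖(x : H₀)‖ + ‖A χ x‖ ≤ C * (‖(x : H₀)‖ + ‖A ref x‖)
  /-- the domain of the reduced operator is compactly embedded in `H₀` -/
  compact_embedding : ∀ χ ∈ params, IsCompactOperator
    (fun x : reducedDomain (ip₀ χ) V (A χ) => (GraphSpace.toDomain V (A χ) x : H₀))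

namespace OperatorFamily

variable {X H₀ H₁ : Type*} [NormedAddCommGroup X] [NormedSpace ℝ X]
  [NormedAddCommGroup H₀] [InnerProductSpace ℂ H₀]
  [NormedAddCommGroup H₁] [InnerProductSpace ℂ H₁] (F : OperatorFamily X H₀ H₁)

/-- The scalar product `⟨u, v⟩_{0,χ}`, linear in `u` and antilinear in `v`. -/
def sp₀ (χ : X) (u v : H₀) : ℂ := (F.ip₀ χ).inner v u

/-- The scalar product `⟨y, z⟩_{1,χ}`, linear in `y` and antilinear in `z`. -/
def sp₁ (χ : X) (y z : H₁) : ℂ := (F.ip₁ χ).inner z y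

theorem sp₀_conj (χ : X) (u v : H₀) : conj (F.sp₀ χ u v) = F.sp₀ χ v u :=
  (F.ip₀ χ).conj_inner_symm u v

theorem sp₁_conj (χ : X) (u v : H₁) : conj (F.sp₁ χ u v) = F.sp₁ χ v u :=
  (F.ip₁ χ).conj_inner_symm u v

theorem sp₀_add_right (χ : X) (u v w : H₀) :
    F.sp₀ χ u (v + w) = F.sp₀ χ u v + F.sp₀ χ u w := (F.ip₀ χ).add_left v w u

theorem sp₁_add_right (χ : X) (u v w : H₁) :
    F.sp₁ χ u (v + w) = F.sp₁ χ u v + F.sp₁ χ u w := (F.ip₁ χ).add_left v w u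

theorem sp₀_smul_right (χ : X) (c : ℂ) (u v : H₀) :
    F.sp₀ χ u (c • v) = conj c * F.sp₀ χ u v := (F.ip₀ χ).smul_left v u c

theorem sp₁_smul_right (χ : X) (c : ℂ) (u v : H₁) :
    F.sp₁ χ u (c • v) = conj c * F.sp₁ χ u v := (F.ip₁ χ).smul_left v u c

theorem sp₀_zero_right (χ : X) (u : H₀) : F.sp₀ χ u 0 = 0 := by
  simpa using F.sp₀_smul_right χ 0 u 0

theorem sp₁_zero_right (χ : X) (u : H₁) : F.sp₁ χ u 0 = 0 := by
  simpa using F.sp₁_smul_right χ 0 u 0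

/-- The domain `V` with one fixed graph norm. -/
abbrev VSpace : Type _ := GraphSpace F.V (F.A F.ref)

/-- The space of continuous antilinear functionals on `V`. -/
abbrev VAntidual : Type _ := F.VSpace →L⋆[ℂ] ℂ

/-- An element of `V` as a vector of `H₀`. -/
def incl (x : F.VSpace) : H₀ := (GraphSpace.toDomain F.V (F.A F.ref) x : H₀)

/-- The value `A_χ x` at an element of `V`. -/
def app (χ : X) (x : F.VSpace) : H₁ := F.A χ (GraphSpace.toDomain F.V (F.A F.ref) x)

/-- The family of operators and scalar products is of class `C^r`: the operators
`𝒯_χ : V → V'♯`, `⟨𝒯_χ u, v⟩ = ⟨A_χ u, A_χ v⟩_{1,χ}`, and `𝒥_χ : H₀ → V'♯`,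
`⟨𝒥_χ u, v⟩ = ⟨u, v⟩_{0,χ}`, depend on `χ` in a `C^r` way for the operator norms and the real
structures of these spaces. (The identities determine `𝒯_χ` and `𝒥_χ` for all `χ ∈ params`;
`r = ω` means real analytic.) -/
def IsOfClass (r : WithTop ℕ∞) : Prop :=
  (∃ 𝒯 : X → F.VSpace →L[ℂ] F.VAntidual,
    (∀ χ ∈ F.params, ∀ u v, 𝒯 χ u v = F.sp₁ χ (F.app χ u) (F.app χ v)) ∧
    ContDiffOn ℝ r 𝒯 F.params) ∧
  (∃ 𝒥 : X → H₀ →L[ℂ] F.VAntidual,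
    (∀ χ ∈ F.params, ∀ u v, 𝒥 χ u v = F.sp₀ χ u (F.incl v)) ∧
    ContDiffOn ℝ r 𝒥 F.params)

/-- The kernel of `A_χ`, as a subspace of `H₀`. -/
def kerA (χ : X) : Submodule ℂ H₀ := (LinearMap.ker (F.A χ)).map F.V.subtype

/-- The graph of the Hilbert space adjoint `A_χ^* : D(A_χ^*) ⊆ H_{1,χ} → H_{0,χ}`: the pairs
`(y, w)` with `⟨A_χ x, y⟩_{1,χ} = ⟨x, w⟩_{0,χ}` for all `x ∈ V`. -/
def adjointGraph (χ : X) : Submodule ℂ (H₁ × H₀) where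
  carrier := {p | ∀ x : F.V, F.sp₁ χ (F.A χ x) p.1 = F.sp₀ χ (x : H₀) p.2}
  add_mem' := by
    intro a b ha hb x
    simp only [Prod.fst_add, Prod.snd_add, sp₁_add_right, sp₀_add_right, ha x, hb x]
  zero_mem' := by
    intro x
    simp only [Prod.fst_zero, Prod.snd_zero, sp₁_zero_right, sp₀_zero_right]
  smul_mem' := by
    intro c a ha x
    simp only [Prod.smul_fst, Prod.smul_snd, sp₁_smul_right, sp₀_smul_right, ha x]

/-- The graph of `T_χ = A_χ^* A_χ`: the pairs `(u, w)` with `u ∈ V`, `A_χ u ∈ D(A_χ^*)` and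
`A_χ^* A_χ u = w`. -/
def graphT (χ : X) : Submodule ℂ (H₀ × H₀) where
  carrier := {p | ∃ x : F.V, (x : H₀) = p.1 ∧ (F.A χ x, p.2) ∈ F.adjointGraph χ}
  add_mem' := by
    rintro a b ⟨x, hx, hx2⟩ ⟨y, hy, hy2⟩
    refine ⟨x + y, by simp [hx, hy], ?_⟩
    simpa using (F.adjointGraph χ).add_mem hx2 hy2
  zero_mem' := ⟨0, by simp, by
    rw [map_zero]; exact (F.adjointGraph χ).zero_mem⟩
  smul_mem' := by
    rintro c a ⟨x, hx, hx2⟩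
    refine ⟨c • x, by simp [hx], ?_⟩
    simpa using (F.adjointGraph χ).smul_mem c hx2

/-- The eigenspace `{u ∈ D(T_χ) : T_χ u = μ u}` (it is `0` if `μ` is not an eigenvalue). -/
def eigenspace (χ : X) (μ : ℝ) : Submodule ℂ H₀ :=
  (F.graphT χ).comap (LinearMap.prod LinearMap.id ((μ : ℂ) • LinearMap.id))

/-- The `n`-th positive eigenvalue `λ_{χ,n}` of `T_χ` (`n = 1, 2, …`), the positive eigenvalues being
listed in nondecreasing order and repeated according to multiplicity: the least `t > 0` such that
`T_χ` has at least `n` eigenvalues, counted with multiplicity, in `(0, t]`. -/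
def eigenvalue (χ : X) (n : ℕ) : ℝ :=
  sInf {t : ℝ | 0 < t ∧
    (n : Cardinal) ≤ Module.rank ℂ (⨆ μ ∈ Set.Ioc (0 : ℝ) t, F.eigenspace χ μ : Submodule ℂ H₀)}

end OperatorFamily

end HilbertPerturbation

end

/-!
The theorem concerns an operator pencil. By the Riesz representation, the forms
`⟨A_χ u, A_χ v⟩_{1,χ}` and `⟨u, v⟩_{0,χ}` on the Hilbert space `V` (with its graph norm) are given
by bounded self-adjoint operators `T χ` and `J χ` of class `C^r` in `χ`, and the eigenvalue problem
for `A_χ^* A_χ` becomes `T χ v = μ J χ v` (`OperatorFamily.exists_isPencil`,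
`IsPencil.mem_eigenspace`).

At a fixed parameter let `P` be the projection onto the kernel of `T`, orthogonal for the form of
`J`. The operator `T + J (1 - P) - μ J P` is invertible for `μ > 0`, being a positive definite form
followed by a reflection, and compactness of the reduced domain makes `T - μ J` a compact
perturbation of it (`IsReducedCompact`). So the pencil is Fredholm at every `μ > 0`, although the
kernel of `A_χ` may be infinite-dimensional and need not vary continuously.

Near an eigenvalue `κ > 0` the implicit function theorem, applied to the equations
`T e = J e M`, `e† J e = 1` for a frame `e` of an invariant subspace, continues the eigenspace and
reduces the pencil to a family of self-adjoint matrices `M χ` with `M x₀ = κ` (`exists_reduction`).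
It remains to choose the eigenvalues of a one-parameter family of self-adjoint matrices in a `C^r`
way.
* If the family is real analytic, one subtracts a diagonal entry, divides by the largest possible
  power of the parameter and applies the same reduction at the eigenvalues of the quotient, whose
  multiplicities are smaller (`exists_analytic_eigenvalues`).
* If the family is of class `C¹`, limits of eigenbases diagonalize the derivative on the
  eigenspaces. Hence the unordered tuple of pairs (eigenvalue, slope) is continuous, and a
  continuous numbering of it (`exists_continuous_selection`) consists of `C¹` functions with the
  slopes as derivatives
  (`exists_differentiable_eigenvalues`).

Since `M x₀` is scalar, the derivatives of the branches at `x₀` are the eigenvalues of `M'(x₀)`,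
which is the compression of `T' - κ J'` to the eigenspace (`charpoly_deriv_eq_prod`).

For the numbering, eigenvalues in `(0, b]` are counted. The branches show that the count over an
interval away from `0` is locally constant if the end points are not eigenvalues. Eigenvalues could
only appear near `0`; but an eigenvector is orthogonal to the kernel of `A_χ`, so if this kernel is
close to that of `A_{x₀}`, its component in the latter is small, and the lower bound for
`T x₀ + J x₀ P` excludes small eigenvalues (`IsPencil.exists_forall_eigenspace_eq_bot`).
-/

namespace HilbertPerturbation

/-! ### Continuous selections of unordered tuples -/

section Selection

variable {ι E : Type*} [Fintype ι] [MetricSpace E]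

/-- Among all bijections between two finite families of points there is one that minimizes the
largest displacement. -/
theorem exists_perm_bottleneck (a b : ι → E) :
    ∃ π : Equiv.Perm ι, ∀ (τ : Equiv.Perm ι) (δ : ℝ), (∀ i, dist (a i) (b (τ i)) < δ) →
      ∀ i, dist (a i) (b (π i)) < δ := by
  classical
  obtain ⟨π, hπ⟩ := Finite.exists_min
    (fun τ : Equiv.Perm ι => Finset.univ.sup fun i => nndist (a i) (b (τ i)))
  refine ⟨π, fun τ δ h i => ?_⟩
  obtain ⟨j, -, hj⟩ := Finset.exists_mem_eq_sup Finset.univ ⟨i, Finset.mem_univ i⟩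
    fun i => nndist (a i) (b (τ i))
  have h1 : nndist (a i) (b (π i)) ≤ Finset.univ.sup fun i => nndist (a i) (b (π i)) :=
    Finset.le_sup (f := fun i => nndist (a i) (b (π i))) (Finset.mem_univ i)
  have h2 := h1.trans ((hπ τ).trans hj.le)
  exact lt_of_le_of_lt (by exact_mod_cast h2) (h j)

/-- Prescribed transitions between neighbouring points of a finite set of reals can be realized. -/
theorem exists_chain {ι : Type*} (m : ℝ → ℝ → Equiv.Perm ι) (F : Finset ℝ) :
    ∃ σ : ℝ → Equiv.Perm ι, ∀ y ∈ F, ∀ z ∈ F, y < z → (∀ w ∈ F, y < w → z ≤ w) →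
      σ z = m y z * σ y := by
  classical
  induction F using Finset.induction_on_max with
  | empty => exact ⟨fun _ => 1, by simp⟩
  | insert a s hs ih =>
    obtain ⟨σ, hσ⟩ := ih
    rcases s.eq_empty_or_nonempty with rfl | hne
    · refine ⟨σ, ?_⟩
      intro y hy z hz hyz
      simp only [insert_empty_eq, Finset.mem_singleton] at hy hz
      exact absurd hyz (by rw [hy, hz]; exact lt_irrefl a)
    set b := s.max' hne with hb
    refine ⟨Function.update σ a (m b a * σ b), ?_⟩
    intro y hy z hz hyz hcons
    rcases Finset.mem_insert.1 hy with rfl | hy'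
    · rcases Finset.mem_insert.1 hz with rfl | hz'
      · exact absurd hyz (lt_irrefl _)
      · exact absurd hyz (not_lt.2 (hs z hz').le)
    · rw [Function.update_of_ne (hs y hy').ne]
      rcases Finset.mem_insert.1 hz with rfl | hz'
      · have hyb : y = b := by
          rcases (s.le_max' y hy').lt_or_eq with h | h
          · exact absurd (hcons b (Finset.mem_insert_of_mem (s.max'_mem hne)) h)
              (not_le.2 (hs b (s.max'_mem hne)))
          · exact h
        rw [Function.update_self, hyb]
      · rw [Function.update_of_ne (hs z hz').ne]
        exact hσ y hy' z hz' hyz fun w hw => hcons w (Finset.mem_insert_of_mem hw)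

/-- An unordered tuple of points that depends continuously on a real parameter can be numbered in
such a way that every single point depends continuously on the parameter. For a finite set of
parameters, the numbering is transported along bottleneck-optimal matchings between neighbouring
parameters; such matchings cannot leave a cluster of points. Rado's selection lemma passes to all
parameters. -/
theorem exists_continuous_selection (f : ι → ℝ → E) (I : Set ℝ)
    (hf : ∀ x ∈ I, ∀ δ > 0, ∀ᶠ y in 𝓝 x, ∃ τ : Equiv.Perm ι, ∀ i, dist (f (τ i) y) (f i x) < δ) :
    ∃ σ : ℝ → Equiv.Perm ι, ∀ x ∈ I, ∀ i, ContinuousAt (fun y => f (σ y i) y) x := by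
  classical
  choose m hm using fun y z : ℝ => exists_perm_bottleneck (fun i => f i y) (fun i => f i z)
  choose g hg using exists_chain m
  obtain ⟨σ, hσ⟩ := Finset.rado_selection g
  refine ⟨σ, fun x hx i => ?_⟩
  obtain ⟨η, hη, hη0⟩ : ∃ η : ℝ, (∀ i j, f i x ≠ f j x → η ≤ dist (f i x) (f j x)) ∧ 0 < η := by
    have h : ∀ᶠ η in 𝓝[>] (0 : ℝ), ∀ i j, f i x ≠ f j x → η ≤ dist (f i x) (f j x) := by
      refine eventually_all.2 fun i => eventually_all.2 fun j => ?_
      by_cases hij : f i x = f j x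
      · simp [hij]
      · filter_upwards [nhdsWithin_le_nhds (Iic_mem_nhds (dist_pos.2 hij))] with η h _ using h
    exact (h.and self_mem_nhdsWithin).exists
  rw [ContinuousAt, Metric.tendsto_nhds]
  intro δ₀ hδ₀
  set δ := min δ₀ (η / 4) with hδ
  have hδ0 : 0 < δ := lt_min hδ₀ (by linarith)
  have hδη : 4 * δ ≤ η := by linarith [min_le_right δ₀ (η / 4)]
  obtain ⟨ρ, hρ, hball⟩ := Metric.eventually_nhds_iff_ball.1 (hf x hx δ hδ0)
  choose! τ hτ using hball
  -- Along neighbouring parameters close to `x`, labels stay in their cluster.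
  have key : ∀ F : Finset ℝ, ∀ y ∈ F, y ∈ Metric.ball x ρ → ∀ z ∈ F, z ∈ Metric.ball x ρ →
      y ≤ z → ∀ k p, dist (f (g F y k) y) (f p x) < δ → dist (f (g F z k) z) (f p x) < δ := by
    intro F y hy hyρ z hz hzρ hyz k p hp
    induction hn : (F.filter fun w => y < w ∧ w ≤ z).card using Nat.strong_induction_on
      generalizing z with
    | _ n ih =>
      rcases hyz.lt_or_eq with hlt | rfl
      swap
      · exact hp
      have hne : (F.filter fun w => y ≤ w ∧ w < z).Nonempty := ⟨y, by simp [hy, hlt]⟩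
      have hw := Finset.max'_mem _ hne
      have hwmax := fun w => Finset.le_max' (F.filter fun w => y ≤ w ∧ w < z) w
      set w := (F.filter fun w => y ≤ w ∧ w < z).max' hne
      obtain ⟨hw1, hw2, hw3⟩ := Finset.mem_filter.1 hw
      have hwρ : w ∈ Metric.ball x ρ := by
        rw [Real.ball_eq_Ioo] at hyρ hzρ ⊢
        exact ⟨hyρ.1.trans_le hw2, hw3.trans hzρ.2⟩
      have hcard : (F.filter fun v => y < v ∧ v ≤ w).card < n := by
        rw [← hn]
        refine Finset.card_lt_card (Finset.ssubset_iff.2 ⟨z, by simp [hw3], ?_⟩)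
        intro v hv
        rcases Finset.mem_insert.1 hv with rfl | hv
        · simp [hz, hlt]
        · simp only [Finset.mem_filter] at hv ⊢
          exact ⟨hv.1, hv.2.1, hv.2.2.trans hw3.le⟩
      have h1 := ih _ hcard w hw1 hwρ hw2 rfl
      have hstep : g F z = m w z * g F w := by
        refine hg F w hw1 z hz hw3 fun v hv hwv => ?_
        by_contra hvz
        exact absurd (hwmax v (by simp [hv, hw2.trans hwv.le, not_le.1 hvz])) (not_le.2 hwv)
      -- the matching through `x` moves points by less than `2 δ`, hence so does the optimal one
      have h2 : ∀ j, dist (f j w) (f (m w z j) z) < 2 * δ := by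
        refine hm w z ((τ w).symm.trans (τ z)) (2 * δ) fun j => ?_
        have e1 := hτ w hwρ ((τ w).symm j)
        have e2 := hτ z hzρ ((τ w).symm j)
        rw [Equiv.apply_symm_apply] at e1
        rw [Equiv.trans_apply]
        linarith [dist_triangle_right (f j w) (f (τ z ((τ w).symm j)) z) (f ((τ w).symm j) x)]
      have h3 := h2 (g F w k)
      have e4 := hτ z hzρ ((τ z).symm (g F z k))
      rw [Equiv.apply_symm_apply] at e4
      rw [← Equiv.Perm.mul_apply, ← hstep] at h3
      have h5 : f ((τ z).symm (g F z k)) x = f p x := by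
        by_contra hne'
        have h6 := hη _ _ hne'
        have h7 := dist_triangle4 (f ((τ z).symm (g F z k)) x) (f (g F z k) z) (f (g F w k) w)
          (f p x)
        rw [dist_comm _ (f (g F z k) z), dist_comm (f (g F z k) z) (f (g F w k) w)] at h7
        linarith
      rwa [h5] at e4
  filter_upwards [Metric.ball_mem_nhds x hρ] with y hy
  obtain ⟨F, hF, hFσ⟩ := hσ {x, y}
  have hxF : x ∈ F := hF (by simp)
  have hyF : y ∈ F := hF (by simp)
  rw [hFσ x (by simp), hFσ y (by simp)]
  refine lt_of_lt_of_le ?_ (min_le_left δ₀ (η / 4))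
  rcases le_total x y with hxy | hxy
  · exact key F x hxF (Metric.mem_ball_self hρ) y hyF hy hxy i (g F x i) (by simpa using hδ0)
  · have e1 := hτ y hy ((τ y).symm (g F y i))
    rw [Equiv.apply_symm_apply] at e1
    have e2 := key F y hyF hy x hxF (Metric.mem_ball_self hρ) hxy i _ e1
    have e3 : f (g F x i) x = f ((τ y).symm (g F y i)) x := by
      by_contra hne
      linarith [hη _ _ hne]
    rwa [e3]

end Selection

/-! ### Reduction of a pencil of operators to an invariant subspace -/

section Reduction

open ContinuousLinearMap

/-- Composition of complex linear maps, as a bilinear map over the reals. -/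
theorem isBoundedBilinearMap_comp_real (E F G : Type*) [NormedAddCommGroup E] [NormedSpace ℂ E]
    [NormedAddCommGroup F] [NormedSpace ℂ F] [NormedAddCommGroup G] [NormedSpace ℂ G] :
    IsBoundedBilinearMap ℝ fun p : (F →L[ℂ] G) × (E →L[ℂ] F) => p.1 ∘L p.2 where
  add_left := by intros; ext; simp
  smul_left := by intros; ext; simp
  add_right := by intros; ext; simp
  smul_right := by intro c x y; ext; simp
  bound := ⟨1, one_pos, fun x y => by simpa using x.opNorm_comp_le y⟩

variable {W V : Type*} [NormedAddCommGroup W] [InnerProductSpace ℂ W] [CompleteSpace W]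
  [NormedAddCommGroup V] [InnerProductSpace ℂ V] [CompleteSpace V]

variable (W V) in
/-- The adjoint, as a continuous linear map over the reals. -/
noncomputable def adjointReal : (W →L[ℂ] V) →L[ℝ] (V →L[ℂ] W) :=
  AddMonoidHom.toRealLinearMap (adjoint : (W →L[ℂ] V) ≃ₗᵢ⋆[ℂ] (V →L[ℂ] W))
    (adjoint : (W →L[ℂ] V) ≃ₗᵢ⋆[ℂ] (V →L[ℂ] W)).continuous

@[simp] theorem adjointReal_apply (e : W →L[ℂ] V) : adjointReal W V e = adjoint e := rfl

/-- The system of equations `T e = J e M`, `e† J e = 1` for a frame `e` of an invariant subspace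
and the matrix `M` of the pencil in it. The skew-adjoint summand of the second component fixes the
choice of the frame in the subspace. -/
noncomputable def frameEquation (T J : ℝ → V →L[ℂ] V) (x₀ : ℝ) (e₀ : W →L[ℂ] V)
    (p : ℝ × ((W →L[ℂ] V) × (W →L[ℂ] W))) : (W →L[ℂ] V) × (W →L[ℂ] W) :=
  (T p.1 ∘L p.2.1 - J p.1 ∘L (p.2.1 ∘L p.2.2),
    adjoint p.2.1 ∘L (J p.1 ∘L p.2.1) - 1 +
      (adjoint e₀ ∘L (J x₀ ∘L p.2.1) - adjoint p.2.1 ∘L (J x₀ ∘L e₀)))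

theorem contDiffAt_frameEquation {r : WithTop ℕ∞} {T J : ℝ → V →L[ℂ] V} {x₀ : ℝ}
    (hT : ContDiffAt ℝ r T x₀) (hJ : ContDiffAt ℝ r J x₀) (e₀ : W →L[ℂ] V)
    (z : (W →L[ℂ] V) × (W →L[ℂ] W)) :
    ContDiffAt ℝ r (frameEquation T J x₀ e₀) (x₀, z) := by
  have hT' : ContDiffAt ℝ r (fun p : ℝ × ((W →L[ℂ] V) × (W →L[ℂ] W)) => T p.1) (x₀, z) :=
    ContDiffAt.comp (x₀, z) hT contDiffAt_fst
  have hJ' : ContDiffAt ℝ r (fun p : ℝ × ((W →L[ℂ] V) × (W →L[ℂ] W)) => J p.1) (x₀, z) :=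
    ContDiffAt.comp (x₀, z) hJ contDiffAt_fst
  have he : ContDiffAt ℝ r (fun p : ℝ × ((W →L[ℂ] V) × (W →L[ℂ] W)) => p.2.1) (x₀, z) := by
    fun_prop
  have hM : ContDiffAt ℝ r (fun p : ℝ × ((W →L[ℂ] V) × (W →L[ℂ] W)) => p.2.2) (x₀, z) := by
    fun_prop
  have ha : ContDiffAt ℝ r (fun p : ℝ × ((W →L[ℂ] V) × (W →L[ℂ] W)) => adjointReal W V p.2.1)
      (x₀, z) := by fun_prop
  refine ContDiffAt.prodMk (ContDiffAt.sub ?_ ?_) (ContDiffAt.add (ContDiffAt.sub ?_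
    contDiffAt_const) (ContDiffAt.sub ?_ ?_))
  · exact (isBoundedBilinearMap_comp_real W V V).contDiff.contDiffAt.comp _ (hT'.prodMk he)
  · exact (isBoundedBilinearMap_comp_real W V V).contDiff.contDiffAt.comp _ (hJ'.prodMk
      ((isBoundedBilinearMap_comp_real W W V).contDiff.contDiffAt.comp _ (he.prodMk hM)))
  · exact (isBoundedBilinearMap_comp_real W V W).contDiff.contDiffAt.comp _ (ha.prodMk
      ((isBoundedBilinearMap_comp_real W V V).contDiff.contDiffAt.comp _ (hJ'.prodMk he)))
  · exact (isBoundedBilinearMap_comp_real W V W).contDiff.contDiffAt.comp _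
      (contDiffAt_const.prodMk ((isBoundedBilinearMap_comp_real W V V).contDiff.contDiffAt.comp _
        (contDiffAt_const.prodMk he)))
  · exact (isBoundedBilinearMap_comp_real W V W).contDiff.contDiffAt.comp _
      (ha.prodMk contDiffAt_const)

/-- The partial derivative of the frame equation with respect to the unknowns, at the base point. -/
theorem fderiv_frameEquation {T J : ℝ → V →L[ℂ] V} {x₀ κ : ℝ}
    (hT : ContDiffAt ℝ 1 T x₀) (hJ : ContDiffAt ℝ 1 J x₀) (e₀ : W →L[ℂ] V)
    (z : (W →L[ℂ] V) × (W →L[ℂ] W)) :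
    fderiv ℝ (frameEquation T J x₀ e₀) (x₀, (e₀, κ • (1 : W →L[ℂ] W))) (0, z) =
      (T x₀ ∘L z.1 - κ • (J x₀ ∘L z.1) - J x₀ ∘L (e₀ ∘L z.2),
        adjoint e₀ ∘L (J x₀ ∘L z.1) + adjoint e₀ ∘L (J x₀ ∘L z.1)) := by
  set u : (W →L[ℂ] V) × (W →L[ℂ] W) := (e₀, κ • (1 : W →L[ℂ] W)) with hu
  have hd := ((contDiffAt_frameEquation hT hJ e₀ u).differentiableAt one_ne_zero).hasFDerivAt
  have hline : HasDerivAt (fun t : ℝ => (x₀, u + t • z)) ((0 : ℝ), z) 0 := by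
    refine (hasDerivAt_const _ _).prodMk ?_
    simpa using ((hasDerivAt_id (0 : ℝ)).smul_const z).const_add u
  have h1 := HasFDerivAt.comp_hasDerivAt_of_eq (0 : ℝ) hd hline (by simp)
  set a : (W →L[ℂ] V) × (W →L[ℂ] W) := (T x₀ ∘L z.1 - κ • (J x₀ ∘L z.1) - J x₀ ∘L (e₀ ∘L z.2),
        adjoint e₀ ∘L (J x₀ ∘L z.1) + adjoint e₀ ∘L (J x₀ ∘L z.1)) with ha
  set b : (W →L[ℂ] V) × (W →L[ℂ] W) :=
    (- (J x₀ ∘L (z.1 ∘L z.2)), adjoint z.1 ∘L (J x₀ ∘L z.1)) with hb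
  -- The frame equation along the line is a quadratic polynomial in `t`.
  have h2 : HasDerivAt (fun t : ℝ => frameEquation T J x₀ e₀ (x₀, u) + t • a + (t ^ 2) • b) a 0 :=
    ((((hasDerivAt_id (0 : ℝ)).smul_const a).const_add (frameEquation T J x₀ e₀ (x₀, u))).add
      ((hasDerivAt_pow 2 (0 : ℝ)).smul_const b)).congr_deriv (by simp)
  have h4 : (frameEquation T J x₀ e₀ ∘ fun t : ℝ => (x₀, u + t • z)) = fun t : ℝ =>
      frameEquation T J x₀ e₀ (x₀, u) + t • a + (t ^ 2) • b := by
    funext t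
    have hadj : adjoint (e₀ + t • z.1) = adjoint e₀ + t • adjoint z.1 := by
      have := (adjointReal W V).map_add e₀ (t • z.1)
      rwa [(adjointReal W V).map_smul] at this
    refine Prod.ext ?_ ?_
    · ext w
      simp only [frameEquation, hu, ha, hb, Function.comp_apply, Prod.fst_add, Prod.smul_fst,
        Prod.snd_add, Prod.smul_snd, add_apply, sub_apply, comp_apply, smul_apply, map_add,
        one_apply_eq_self, map_smul_of_tower, neg_apply]
      module
    · ext w
      simp only [frameEquation, hu, ha, hb, hadj, Function.comp_apply, Prod.fst_add, Prod.smul_fst,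
        Prod.snd_add, Prod.smul_snd, add_apply, sub_apply, comp_apply, smul_apply, map_add,
        map_smul_of_tower]
      module
  rw [h4] at h1
  exact h1.unique h2

/-- Let `κ` be an eigenvalue of the pencil `T - μ J` at `x₀` with an orthonormal frame `e₀` of the
eigenspace. If the pencil is Fredholm there, the eigenspace is continued by a family of invariant
subspaces with frames `e x`, and the pencil is reduced to the self-adjoint matrices `M x` as far as
eigenvalues close to `κ` are concerned. -/
theorem exists_reduction {r : WithTop ℕ∞} (hr : 1 ≤ r) {T J : ℝ → V →L[ℂ] V} {x₀ κ : ℝ}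
    (hT : ContDiffAt ℝ r T x₀) (hJ : ContDiffAt ℝ r J x₀)
    (hTs : ∀ᶠ x in 𝓝 x₀, IsSelfAdjoint (T x)) (hJs : ∀ᶠ x in 𝓝 x₀, IsSelfAdjoint (J x))
    (e₀ : W →L[ℂ] V) (he₀ : ∀ w, T x₀ (e₀ w) = κ • J x₀ (e₀ w))
    (hortho : adjoint e₀ ∘L (J x₀ ∘L e₀) = 1)
    (hunit : IsUnit (T x₀ - κ • J x₀ + J x₀ ∘L (e₀ ∘L (adjoint e₀ ∘L J x₀)))) :
    ∃ (e : ℝ → W →L[ℂ] V) (M : ℝ → W →L[ℂ] W), ContDiffAt ℝ r e x₀ ∧ ContDiffAt ℝ r M x₀ ∧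
      e x₀ = e₀ ∧ M x₀ = κ • 1 ∧
      (∀ᶠ x in 𝓝 x₀, (∀ w, T x (e x w) = J x (e x (M x w))) ∧
        adjoint (e x) ∘L (J x ∘L e x) = 1 ∧ M x = adjoint (e x) ∘L (T x ∘L e x) ∧
        IsSelfAdjoint (M x)) ∧
      ∃ ε > 0, ∀ᶠ x in 𝓝 x₀, ∀ μ : ℝ, |μ - κ| < ε → ∀ v, T x v = μ • J x v →
        ∃ w, v = e x w ∧ M x w = μ • w := by
  have hr0 : r ≠ 0 := by
    rintro rfl
    exact absurd hr (by simp)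
  set u : (W →L[ℂ] V) × (W →L[ℂ] W) := (e₀, κ • (1 : W →L[ℂ] W)) with hu
  have hΨ := contDiffAt_frameEquation hT hJ e₀ u
  have hT0 : ∀ v v', inner ℂ (T x₀ v) v' = inner ℂ v (T x₀ v') := hTs.self_of_nhds.isSymmetric
  have hJ0 : ∀ v v', inner ℂ (J x₀ v) v' = inner ℂ v (J x₀ v') := hJs.self_of_nhds.isSymmetric
  have hA1 : ∀ w, adjoint e₀ (J x₀ (e₀ w)) = w := fun w => by
    simpa using congrArg (fun B => B w) hortho
  have hA2 : ∀ v, adjoint e₀ (T x₀ v) = κ • adjoint e₀ (J x₀ v) := fun v => by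
    refine ext_inner_left ℂ fun w => ?_
    rw [adjoint_inner_right, ← hT0, he₀, inner_smul_right_eq_smul, adjoint_inner_right, ← hJ0,
      inner_smul_left_eq_smul]
  obtain ⟨Q, hQ⟩ := hunit
  have hQ1 : ∀ v, T x₀ v - κ • J x₀ v + J x₀ (e₀ (adjoint e₀ (J x₀ v))) = (Q : V →L[ℂ] V) v := by
    intro v
    rw [hQ]
    simp
  have hQinj : ∀ v, (Q : V →L[ℂ] V) v = 0 → v = 0 := fun v hv =>
    (DFunLike.congr_fun Q.inv_mul v).symm.trans
      ((congrArg (↑Q⁻¹ : V →L[ℂ] V) hv).trans (map_zero _))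
  have hQinv : ∀ v, (Q : V →L[ℂ] V) ((↑Q⁻¹ : V →L[ℂ] V) v) = v := fun v =>
    DFunLike.congr_fun Q.mul_inv v
  have hAQ : ∀ v, adjoint e₀ ((Q : V →L[ℂ] V) v) = adjoint e₀ (J x₀ v) := fun v => by
    rw [← hQ1, map_add, map_sub, hA2, hA1, map_smul_of_tower, sub_self, zero_add]
  have hinv : (fderiv ℝ (frameEquation T J x₀ e₀) (x₀, u) ∘L .inr ℝ ℝ _).IsInvertible := by
    refine ⟨ContinuousLinearEquiv.ofBijective _ (LinearMap.ker_eq_bot'.2 ?_)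
      (LinearMap.range_eq_top.2 ?_), ContinuousLinearEquiv.coe_ofBijective _ _ _⟩
    · intro z hz
      have hz' := (fderiv_frameEquation (hT.of_le hr) (hJ.of_le hr) e₀ z).symm.trans hz
      obtain ⟨h1, h2⟩ := Prod.mk_eq_zero.1 hz'
      have h1' : ∀ w, T x₀ (z.1 w) - κ • J x₀ (z.1 w) - J x₀ (e₀ (z.2 w)) = 0 := fun w => by
        simpa using congrArg (fun B => B w) h1
      have h2' : ∀ w, adjoint e₀ (J x₀ (z.1 w)) = 0 := fun w => by
        have := congrArg (fun B => B w) h2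
        rw [add_apply, ← two_smul ℂ] at this
        simpa using this
      have h3 : ∀ w, z.2 w = 0 := fun w => by
        have := congrArg (adjoint e₀) (h1' w)
        rwa [map_sub, map_sub, hA2, hA1, map_smul_of_tower, sub_self, zero_sub, map_zero,
          neg_eq_zero] at this
      refine Prod.ext (ContinuousLinearMap.ext fun w => hQinj _ ?_) (ContinuousLinearMap.ext h3)
      have := h1' w
      rw [h3, map_zero, map_zero, sub_zero] at this
      rw [← hQ1, h2', map_zero, map_zero, this, add_zero]
    · -- applying `e₀†` to the first component determines `z.2`; the modified pencil gives `z.1`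
      rintro ⟨φ, c⟩
      set z : (W →L[ℂ] V) × (W →L[ℂ] W) :=
        ((↑Q⁻¹ : V →L[ℂ] V) ∘L (φ - J x₀ ∘L (e₀ ∘L (adjoint e₀ ∘L φ)) +
          J x₀ ∘L (e₀ ∘L ((1 / 2 : ℝ) • c))), -(adjoint e₀ ∘L φ)) with hz
      refine ⟨z, (fderiv_frameEquation (hT.of_le hr) (hJ.of_le hr) e₀ z).trans ?_⟩
      have h2 : ∀ w, adjoint e₀ (J x₀ ((↑Q⁻¹ : V →L[ℂ] V) (φ w - J x₀ (e₀ (adjoint e₀ (φ w))) +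
          J x₀ (e₀ ((1 / 2 : ℝ) • c w))))) = (1 / 2 : ℝ) • c w := fun w => by
        rw [← hAQ, hQinv, map_add, map_sub, hA1, hA1, sub_self, zero_add]
      refine Prod.ext (ContinuousLinearMap.ext fun w => ?_) (ContinuousLinearMap.ext fun w => ?_)
      · have h3 := hQ1 ((↑Q⁻¹ : V →L[ℂ] V) (φ w - J x₀ (e₀ (adjoint e₀ (φ w))) +
          J x₀ (e₀ ((1 / 2 : ℝ) • c w))))
        rw [h2, hQinv] at h3
        simp only [hz, sub_apply, comp_apply, smul_apply, add_apply, neg_apply, map_neg] at h3 ⊢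
        rw [eq_sub_of_add_eq h3]
        abel
      · simp only [hz, sub_apply, comp_apply, smul_apply, add_apply]
        rw [h2]
        module
  set ψ := hΨ.implicitFunction hr0 hinv
  have hψ0 : ψ x₀ = u := hΨ.implicitFunction_apply_self hr0 hinv
  have hψ : ContDiffAt ℝ r ψ x₀ := hΨ.contDiffAt_implicitFunction hr0 hinv
  have hψeq : ∀ᶠ x in 𝓝 x₀, frameEquation T J x₀ e₀ (x, ψ x) = frameEquation T J x₀ e₀ (x₀, u) :=
    hΨ.eventually_apply_implicitFunction hr0 hinv
  have hbase : frameEquation T J x₀ e₀ (x₀, u) = 0 := by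
    refine Prod.ext (ContinuousLinearMap.ext fun w => ?_) (ContinuousLinearMap.ext fun w => ?_)
    · simp [frameEquation, hu, he₀]
    · simp [frameEquation, hu, hA1]
  have hgood : ∀ᶠ x in 𝓝 x₀, (∀ w, T x ((ψ x).1 w) = J x ((ψ x).1 ((ψ x).2 w))) ∧
      adjoint (ψ x).1 ∘L (J x ∘L (ψ x).1) = 1 ∧
      (ψ x).2 = adjoint (ψ x).1 ∘L (T x ∘L (ψ x).1) ∧ IsSelfAdjoint (ψ x).2 := by
    filter_upwards [hψeq, hTs, hJs] with x hx hTx hJx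
    rw [hbase] at hx
    obtain ⟨h1, h2⟩ := Prod.mk_eq_zero.1 hx
    have h1' : ∀ w, T x ((ψ x).1 w) = J x ((ψ x).1 ((ψ x).2 w)) := fun w => by
      simpa [sub_eq_zero] using congrArg (fun B => B w) h1
    have h3 : adjoint (ψ x).1 ∘L (J x ∘L (ψ x).1) = 1 := by
      -- the two brackets are the self-adjoint and the skew-adjoint part
      have h4 := congrArg adjoint h2
      simp only [map_add, map_sub, adjoint_comp, adjoint_adjoint, hJx.adjoint_eq,
        hJs.self_of_nhds.adjoint_eq, map_zero, comp_assoc] at h4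
      have h5 : adjoint (1 : W →L[ℂ] W) = 1 := by
        ext w
        exact ext_inner_left ℂ fun w' => by simp [adjoint_inner_right]
      rw [h5] at h4
      have h6 : (2 : ℝ) • (adjoint (ψ x).1 ∘L (J x ∘L (ψ x).1) - 1) = 0 := by
        simp only at h2
        rw [two_smul]
        have h7 := congrArg₂ (· + ·) h2 h4
        simp only [add_zero] at h7
        rw [← h7]
        abel
      exact sub_eq_zero.1 ((smul_eq_zero.1 h6).resolve_left two_ne_zero)
    have h4 : (ψ x).2 = adjoint (ψ x).1 ∘L (T x ∘L (ψ x).1) := by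
      ext w
      simp only [comp_apply, h1']
      exact (congrArg (fun B => B ((ψ x).2 w)) h3).symm
    refine ⟨h1', h3, h4, ?_⟩
    rw [isSelfAdjoint_iff', h4]
    simp only [adjoint_comp, adjoint_adjoint, hTx.adjoint_eq, comp_assoc]
  have hce : ContDiffAt ℝ r (fun x => (ψ x).1) x₀ := contDiffAt_fst.comp x₀ hψ
  have hcM : ContDiffAt ℝ r (fun x => (ψ x).2) x₀ := contDiffAt_snd.comp x₀ hψ
  refine ⟨fun x => (ψ x).1, fun x => (ψ x).2, hce, hcM, by simp [hψ0, hu], by simp [hψ0, hu],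
    hgood, ?_⟩
  -- the modified pencil stays invertible
  have hLcont : ContinuousAt (fun p : ℝ × ℝ => T p.1 - p.2 • J p.1 +
      J p.1 ∘L ((ψ p.1).1 ∘L (adjointReal W V (ψ p.1).1 ∘L J p.1))) (x₀, κ) := by
    have hTc : ContinuousAt (fun p : ℝ × ℝ => T p.1) (x₀, κ) :=
      ContinuousAt.comp (f := Prod.fst) (x := (x₀, κ)) hT.continuousAt continuousAt_fst
    have hJc : ContinuousAt (fun p : ℝ × ℝ => J p.1) (x₀, κ) :=
      ContinuousAt.comp (f := Prod.fst) (x := (x₀, κ)) hJ.continuousAt continuousAt_fst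
    have hec : ContinuousAt (fun p : ℝ × ℝ => (ψ p.1).1) (x₀, κ) :=
      ContinuousAt.comp (f := Prod.fst) (x := (x₀, κ)) hce.continuousAt continuousAt_fst
    have hac : ContinuousAt (fun p : ℝ × ℝ => adjointReal W V (ψ p.1).1) (x₀, κ) :=
      ((adjointReal W V).continuous.continuousAt).comp hec
    exact (hTc.sub (continuousAt_snd.smul hJc)).add (hJc.clm_comp (hec.clm_comp (hac.clm_comp hJc)))
  have hLu : ∀ᶠ p : ℝ × ℝ in 𝓝 (x₀, κ), IsUnit (T p.1 - p.2 • J p.1 +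
      J p.1 ∘L ((ψ p.1).1 ∘L (adjointReal W V (ψ p.1).1 ∘L J p.1))) := by
    refine hLcont.eventually (Units.isOpen.mem_nhds ?_)
    refine ⟨Q, ?_⟩
    rw [hQ]
    simp [hψ0, hu]
  rw [nhds_prod_eq] at hLu
  obtain ⟨p, hp, q, hq, hpq⟩ := Filter.eventually_prod_iff.1 hLu
  obtain ⟨ε, hε, hεq⟩ := Metric.eventually_nhds_iff.1 hq
  refine ⟨ε, hε, ?_⟩
  filter_upwards [hp, hgood, hTs, hJs] with x hx ⟨h1, h2, h3, h4⟩ hTx hJx μ hμ v hv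
  obtain ⟨R, hR⟩ := hpq hx (hεq (by rwa [Real.dist_eq]))
  set E := (ψ x).1
  set M := (ψ x).2
  have hA1' : ∀ w, adjoint E (J x (E w)) = w := fun w => by
    simpa using congrArg (fun B => B w) h2
  have hA2' : ∀ v, adjoint E (T x v) = M (adjoint E (J x v)) := fun v => by
    refine ext_inner_left ℂ fun w => ?_
    rw [adjoint_inner_right, ← hTx.isSymmetric.apply_clm, h1, ← h4.isSymmetric.apply_clm,
      adjoint_inner_right, ← hJx.isSymmetric.apply_clm]
  set a := adjoint E (J x v) with ha
  have hMa : M a = μ • a := by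
    have := hA2' v
    rw [hv, map_smul_of_tower] at this
    exact this.symm
  -- `v - E a` is annihilated by the modified pencil
  refine ⟨a, ?_, hMa⟩
  rw [← sub_eq_zero]
  have hRinj : ∀ v, (R : V →L[ℂ] V) v = 0 → v = 0 := fun v hv =>
    (DFunLike.congr_fun R.inv_mul v).symm.trans
      ((congrArg (↑R⁻¹ : V →L[ℂ] V) hv).trans (map_zero _))
  refine hRinj _ ?_
  rw [hR]
  simp only [add_apply, sub_apply, smul_apply, comp_apply, adjointReal_apply, map_sub]
  change T x v - μ • J x v + J x (E (adjoint E (J x v))) - (T x (E a) - μ • J x (E a) +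
    J x (E (adjoint E (J x (E a))))) = 0
  rw [hA1', ← ha, h1, hMa, hv, map_smul_of_tower, map_smul_of_tower, sub_self, sub_self, sub_self]

end Reduction

/-! ### Frames and eigenbases -/

section Frames

open ContinuousLinearMap

variable {ι V : Type*} [Fintype ι] [NormedAddCommGroup V] [InnerProductSpace ℂ V]

/-- The map `w ↦ ∑ i, w i • v i` from coordinates to linear combinations of a finite family. -/
noncomputable def frame (v : ι → V) : EuclideanSpace ℂ ι →L[ℂ] V :=
  ∑ i, (EuclideanSpace.proj i : EuclideanSpace ℂ ι →L[ℂ] ℂ).smulRight (v i)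

theorem frame_apply (v : ι → V) (w : EuclideanSpace ℂ ι) : frame v w = ∑ i, w i • v i := by
  simp [frame]

theorem adjoint_frame_apply [CompleteSpace V] (v : ι → V) (u : V) (i : ι) :
    adjoint (frame v) u i = inner ℂ (v i) u := by
  classical
  have h : adjoint (frame v) u i =
      inner ℂ (EuclideanSpace.single i (1 : ℂ)) (adjoint (frame v) u) := by
    rw [EuclideanSpace.inner_single_left, map_one, one_mul]
  rw [h, adjoint_inner_right, frame_apply]
  congr 1
  simp

theorem adjoint_frame_comp_frame [CompleteSpace V] [DecidableEq ι] (v : ι → V) (J : V →L[ℂ] V)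
    (h : ∀ i j, inner ℂ (v i) (J (v j)) = if i = j then 1 else 0) :
    adjoint (frame v) ∘L (J ∘L frame v) = 1 := by
  ext w i
  simp only [comp_apply, one_apply_eq_self]
  rw [adjoint_frame_apply, frame_apply, map_sum, inner_sum]
  simp [inner_smul_right, h]

/-- If the frame `e₀` spans the kernel of `T - κ J`, the finite rank modification of `T - κ J` used
in the reduction is injective. -/
theorem modified_pencil_injective {W : Type*} [NormedAddCommGroup W] [InnerProductSpace ℂ W]
    [CompleteSpace V] [CompleteSpace W] {T J : V →L[ℂ] V} (hT : IsSelfAdjoint T)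
    (hJ : IsSelfAdjoint J) {κ : ℝ}
    {e₀ : W →L[ℂ] V} (he₀ : ∀ w, T (e₀ w) = κ • J (e₀ w))
    (hortho : adjoint e₀ ∘L (J ∘L e₀) = 1) (hker : ∀ v, T v = κ • J v → ∃ w, v = e₀ w) {v : V}
    (hv : (T - κ • J + J ∘L (e₀ ∘L (adjoint e₀ ∘L J))) v = 0) : v = 0 := by
  have hT0 : ∀ v v', inner ℂ (T v) v' = inner ℂ v (T v') := hT.isSymmetric
  have hJ0 : ∀ v v', inner ℂ (J v) v' = inner ℂ v (J v') := hJ.isSymmetric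
  have hA1 : ∀ w, adjoint e₀ (J (e₀ w)) = w := fun w => by
    simpa using congrArg (fun B => B w) hortho
  have hA2 : ∀ v, adjoint e₀ (T v) = κ • adjoint e₀ (J v) := fun v => by
    refine ext_inner_left ℂ fun w => ?_
    rw [adjoint_inner_right, ← hT0, he₀, inner_smul_right_eq_smul, adjoint_inner_right, ← hJ0,
      inner_smul_left_eq_smul]
  simp only [add_apply, sub_apply, smul_apply, comp_apply] at hv
  have h1 : adjoint e₀ (J v) = 0 := by
    have := congrArg (adjoint e₀) hv
    rwa [map_add, map_sub, hA2, hA1, map_smul_of_tower, sub_self, zero_add, map_zero] at this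
  rw [h1, map_zero, map_zero, add_zero, sub_eq_zero] at hv
  obtain ⟨w, rfl⟩ := hker v hv
  rw [hA1] at h1
  rw [h1, map_zero]

variable {ι : Type} [Fintype ι]

theorem exists_eigenbasis (M : EuclideanSpace ℂ ι →L[ℂ] EuclideanSpace ℂ ι)
    (hM : IsSelfAdjoint M) :
    ∃ (b : OrthonormalBasis ι ℂ (EuclideanSpace ℂ ι)) (f : ι → ℝ), ∀ i, M (b i) = f i • b i := by
  have hn : Module.finrank ℂ (EuclideanSpace ℂ ι) = Fintype.card ι := finrank_euclideanSpace
  refine ⟨(hM.isSymmetric.eigenvectorBasis hn).reindex (Fintype.equivFin ι).symm,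
    fun i => hM.isSymmetric.eigenvalues hn (Fintype.equivFin ι i), fun i => ?_⟩
  have := hM.isSymmetric.apply_eigenvectorBasis hn (Fintype.equivFin ι i)
  simp only [OrthonormalBasis.reindex_apply, Equiv.symm_symm]
  rw [← Complex.coe_smul]
  exact this

theorem exists_orthonormalBasis_of_orthonormal {v : ι → EuclideanSpace ℂ ι}
    (hv : Orthonormal ℂ v) : ∃ b : OrthonormalBasis ι ℂ (EuclideanSpace ℂ ι), ∀ i, b i = v i := by
  rcases isEmpty_or_nonempty ι with h | h
  · exact ⟨EuclideanSpace.basisFun ι ℂ, fun i => isEmptyElim i⟩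
  · have hb := coe_basisOfOrthonormalOfCardEqFinrank hv finrank_euclideanSpace.symm
    refine ⟨(basisOfOrthonormalOfCardEqFinrank hv
      finrank_euclideanSpace.symm).toOrthonormalBasis (by rwa [hb]), fun i => ?_⟩
    rw [Module.Basis.coe_toOrthonormalBasis, hb]

end Frames

/-! ### Real analytic families of self-adjoint matrices -/

section Analytic

open ContinuousLinearMap

theorem isSelfAdjoint_of_tendsto {α E : Type*} [NormedAddCommGroup E] [InnerProductSpace ℂ E]
    [CompleteSpace E] {l : Filter α} [NeBot l] {K : α → E →L[ℂ] E} {K₀ : E →L[ℂ] E}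
    (hK : Tendsto K l (𝓝 K₀)) (h : ∀ᶠ x in l, IsSelfAdjoint (K x)) : IsSelfAdjoint K₀ := by
  refine tendsto_nhds_unique (hK.star.congr' ?_) hK
  filter_upwards [h] with x hx using hx

theorem eventually_isSelfAdjoint_of_punctured {E : Type*} [NormedAddCommGroup E]
    [InnerProductSpace ℂ E] [CompleteSpace E] {K : ℝ → E →L[ℂ] E} {x₀ : ℝ}
    (hK : ContinuousAt K x₀) (h : ∀ᶠ x in 𝓝[≠] x₀, IsSelfAdjoint (K x)) :
    ∀ᶠ x in 𝓝 x₀, IsSelfAdjoint (K x) := by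
  have h0 : IsSelfAdjoint (K x₀) :=
    isSelfAdjoint_of_tendsto (hK.tendsto.mono_left nhdsWithin_le_nhds) h
  filter_upwards [eventually_nhdsWithin_iff.1 h] with x hx
  rcases eq_or_ne x x₀ with rfl | hne
  · exact h0
  · exact hx hne

/-- **Rellich's theorem** for a real analytic family of self-adjoint matrices, near a parameter
where the matrix is scalar. After subtraction of a diagonal entry `τ`, the family is divisible by a
power of the parameter, the quotient not being scalar at the base point; its eigenspaces there have
smaller dimension, so that the reduction to invariant subspaces allows for induction. -/
theorem exists_analytic_eigenvalues (n : ℕ) : ∀ (ι : Type) [Fintype ι], Fintype.card ι = n →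
    ∀ (M : ℝ → EuclideanSpace ℂ ι →L[ℂ] EuclideanSpace ℂ ι) (x₀ κ : ℝ), ContDiffAt ℝ ω M x₀ →
    (∀ᶠ x in 𝓝 x₀, IsSelfAdjoint (M x)) → M x₀ = κ • 1 →
    ∃ ζ : ι → ℝ → ℝ, (∀ i, ContDiffAt ℝ ω (ζ i) x₀) ∧ (∀ i, ζ i x₀ = κ) ∧
      ∀ᶠ x in 𝓝 x₀, ∃ b : OrthonormalBasis ι ℂ (EuclideanSpace ℂ ι),
        ∀ i, M x (b i) = ζ i x • b i := by
  induction n using Nat.strong_induction_on with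
  | _ n ih =>
  intro ι _ hn M x₀ κ hM hMs hMκ
  classical
  rcases isEmpty_or_nonempty ι with hemp | ⟨⟨i₀⟩⟩
  · exact ⟨fun i => isEmptyElim i, fun i => isEmptyElim i, fun i => isEmptyElim i,
      Eventually.of_forall fun x => ⟨EuclideanSpace.basisFun ι ℂ, fun i => isEmptyElim i⟩⟩
  -- subtract a diagonal entry
  set e₁ : EuclideanSpace ℂ ι := EuclideanSpace.single i₀ 1 with he₁
  have he₁n : inner ℂ e₁ e₁ = 1 := by simp [he₁]
  set τ : ℝ → ℝ := fun x => (inner ℂ e₁ (M x e₁)).re with hτ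
  have hτω : ContDiffAt ℝ ω τ x₀ := by
    have hlin : IsBoundedLinearMap ℝ fun A : EuclideanSpace ℂ ι →L[ℂ] EuclideanSpace ℂ ι =>
        (inner ℂ e₁ (A e₁)).re := by
      refine IsLinearMap.with_bound ⟨fun A B => by simp, fun c A => by simp⟩ (‖e₁‖ * ‖e₁‖)
        fun A => ?_
      calc |(inner ℂ e₁ (A e₁)).re| ≤ ‖inner ℂ e₁ (A e₁)‖ := Complex.abs_re_le_norm _
        _ ≤ ‖e₁‖ * (‖A‖ * ‖e₁‖) :=
          (norm_inner_le_norm _ _).trans (by gcongr; exact A.le_opNorm _)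
        _ = ‖e₁‖ * ‖e₁‖ * ‖A‖ := by ring
    exact hlin.contDiff.contDiffAt.comp x₀ hM
  have hτκ : τ x₀ = κ := by simp [hτ, hMκ, he₁]
  have hKω : ContDiffAt ℝ ω (fun x => M x - τ x • (1 : EuclideanSpace ℂ ι →L[ℂ] _)) x₀ :=
    hM.sub (hτω.smul contDiffAt_const)
  have hdiag : ∀ x, IsSelfAdjoint (M x) →
      inner ℂ e₁ (M x e₁ - τ x • e₁) = 0 := by
    intro x hx
    have h1 : ((inner ℂ e₁ (M x e₁)).re : ℂ) = inner ℂ e₁ (M x e₁) := by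
      refine Complex.conj_eq_iff_re.1 ?_
      rw [inner_conj_symm]
      exact hx.isSymmetric e₁ e₁
    rw [inner_sub_right, ← Complex.coe_smul, inner_smul_right, he₁n, mul_one, hτ, h1, sub_self]
  by_cases hzero : ∀ᶠ x in 𝓝 x₀, M x - τ x • (1 : EuclideanSpace ℂ ι →L[ℂ] _) = 0
  · refine ⟨fun _ => τ, fun _ => hτω, fun _ => hτκ, ?_⟩
    filter_upwards [hzero] with x hx
    refine ⟨EuclideanSpace.basisFun ι ℂ, fun i => ?_⟩
    rw [sub_eq_zero.1 hx]
    simp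
  obtain ⟨p, K, hKa, hK0, hKeq⟩ :=
    (AnalyticAt.exists_eventuallyEq_pow_smul_nonzero_iff hKω.analyticAt).2 hzero
  have hp : p ≠ 0 := by
    rintro rfl
    have := hKeq.self_of_nhds
    rw [hτκ, hMκ, sub_self, pow_zero, one_smul] at this
    exact hK0 this.symm
  have hKne : ∀ᶠ x in 𝓝[≠] x₀, K x = ((x - x₀) ^ p)⁻¹ • (M x - τ x • 1) ∧
      IsSelfAdjoint (M x) := by
    filter_upwards [nhdsWithin_le_nhds hKeq, nhdsWithin_le_nhds hMs, self_mem_nhdsWithin]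
      with x hx hs hne
    rw [hx, inv_smul_smul₀ (pow_ne_zero _ (sub_ne_zero.2 hne))]
    exact ⟨rfl, hs⟩
  have hKs : ∀ᶠ x in 𝓝 x₀, IsSelfAdjoint (K x) := by
    refine eventually_isSelfAdjoint_of_punctured hKa.continuousAt ?_
    filter_upwards [hKne] with x hx
    rw [hx.1]
    refine IsSelfAdjoint.smul (IsSelfAdjoint.all _) (hx.2.sub ?_)
    exact IsSelfAdjoint.smul (IsSelfAdjoint.all _) (IsSelfAdjoint.one _)
  -- a vanishing diagonal entry prevents the nonzero matrix `K x₀` from being scalar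
  have hK11 : inner ℂ e₁ (K x₀ e₁) = 0 := by
    have h1 : Tendsto (fun x => inner ℂ e₁ (K x e₁)) (𝓝[≠] x₀) (𝓝 (inner ℂ e₁ (K x₀ e₁))) :=
      tendsto_const_nhds.inner ((hKa.continuousAt.clm_apply
        continuousAt_const).tendsto.mono_left nhdsWithin_le_nhds)
    refine tendsto_nhds_unique h1 (tendsto_const_nhds.congr' ?_)
    filter_upwards [hKne] with x hx
    rw [hx.1, smul_apply, inner_smul_right_eq_smul, sub_apply, smul_apply, one_apply_eq_self,
      hdiag x hx.2, smul_zero]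
  obtain ⟨b₀, f, hb₀⟩ := exists_eigenbasis (K x₀) hKs.self_of_nhds
  have hcard : ∀ c, Fintype.card {i // f i = c} < n := by
    intro c
    rw [← hn]
    by_contra hlt
    have hall : ∀ i, f i = c := by
      by_contra! hex
      obtain ⟨i, hi⟩ := hex
      exact hlt (Fintype.card_subtype_lt hi)
    have hKc : K x₀ = c • 1 := by
      refine ContinuousLinearMap.coe_injective (b₀.toBasis.ext fun i => ?_)
      simp [hb₀, hall]
    have hc : c = 0 := by
      rw [hKc, smul_apply, inner_smul_right_eq_smul, one_apply_eq_self, he₁n] at hK11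
      simpa using hK11
    exact hK0 (by rw [hKc, hc]; ext w i; simp)
  -- reduction to the eigenspaces at the base point
  have hred : ∀ c : ℝ, ∃ (e : ℝ → EuclideanSpace ℂ {i // f i = c} →L[ℂ] EuclideanSpace ℂ ι)
      (N : ℝ → EuclideanSpace ℂ {i // f i = c} →L[ℂ] EuclideanSpace ℂ {i // f i = c})
      (ζ : {i // f i = c} → ℝ → ℝ), (∀ i, ContDiffAt ℝ ω (ζ i) x₀) ∧ (∀ i, ζ i x₀ = c) ∧
      ∀ᶠ x in 𝓝 x₀, (∀ w, K x (e x w) = e x (N x w)) ∧ adjoint (e x) ∘L e x = 1 ∧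
        ∃ b : OrthonormalBasis {i // f i = c} ℂ (EuclideanSpace ℂ {i // f i = c}),
          ∀ i, N x (b i) = ζ i x • b i := by
    intro c
    set e₀ : EuclideanSpace ℂ {i // f i = c} →L[ℂ] EuclideanSpace ℂ ι :=
      frame fun i => b₀ i.1 with he₀
    have h1 : ∀ w, K x₀ (e₀ w) = c • (1 : EuclideanSpace ℂ ι →L[ℂ] _) (e₀ w) := by
      intro w
      simp only [he₀, frame_apply, map_sum, map_smul, hb₀, Finset.smul_sum, one_apply_eq_self]
      refine Finset.sum_congr rfl fun i _ => ?_
      rw [i.2, smul_comm]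
    have h2 : adjoint e₀ ∘L ((1 : EuclideanSpace ℂ ι →L[ℂ] _) ∘L e₀) = 1 := by
      refine adjoint_frame_comp_frame _ _ fun i j => ?_
      rw [one_apply_eq_self, orthonormal_iff_ite.1 b₀.orthonormal]
      simp [Subtype.ext_iff]
    have h3 : ∀ v, K x₀ v = c • (1 : EuclideanSpace ℂ ι →L[ℂ] _) v → ∃ w, v = e₀ w := by
      intro v hv
      refine ⟨WithLp.toLp 2 fun i => inner ℂ (b₀ i.1) v, ?_⟩
      rw [he₀, frame_apply]
      conv_lhs => rw [← b₀.sum_repr' v]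
      have hcoef : ∀ i, inner ℂ (b₀ i) v • b₀ i ≠ 0 → f i = c := by
        intro i hi
        have h4 := hKs.self_of_nhds.isSymmetric (b₀ i) v
        change inner ℂ (K x₀ (b₀ i)) v = inner ℂ (b₀ i) (K x₀ v) at h4
        rw [hb₀, hv, inner_smul_left_eq_smul, one_apply_eq_self, inner_smul_right_eq_smul] at h4
        exact smul_left_injective ℝ (left_ne_zero_of_smul hi) h4
      rw [← Finset.sum_filter_of_ne fun i _ => hcoef i]
      exact Finset.sum_subtype _ (by simp) _
    obtain ⟨e, N, -, hN, -, hNc, hgood, -⟩ := exists_reduction (κ := c) le_top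
      hKa.contDiffAt contDiffAt_const hKs (Eventually.of_forall fun _ => IsSelfAdjoint.one _) e₀ h1
      h2 (by
        rw [ContinuousLinearMap.isUnit_iff_bijective]
        have hinj := (injective_iff_map_eq_zero _).2 fun v hv => modified_pencil_injective
          hKs.self_of_nhds (IsSelfAdjoint.one _) h1 h2 h3 (v := v) hv
        exact ⟨hinj,
          LinearMap.surjective_of_injective (f := ContinuousLinearMap.toLinearMap _) hinj⟩)
    obtain ⟨ζ, hζ, hζ0, hb⟩ := ih _ (hcard c) {i // f i = c} rfl N x₀ c hN
      (hgood.mono fun x hx => hx.2.2.2) hNc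
    refine ⟨e, N, ζ, hζ, hζ0, ?_⟩
    filter_upwards [hgood, hb] with x hx hbx
    exact ⟨hx.1, hx.2.1, hbx⟩
  choose e N ζ hζ hζ0 hev using hred
  have hev' : ∀ᶠ x in 𝓝 x₀, ∀ c : Set.range f, (∀ w, K x (e c x w) = e c x (N c x w)) ∧
      adjoint (e c x) ∘L e c x = 1 ∧
        ∃ b : OrthonormalBasis {j // f j = c} ℂ (EuclideanSpace ℂ {j // f j = c}),
          ∀ j, N c x (b j) = ζ c j x • b j := eventually_all.2 fun c => hev c
  have hsep : ∀ᶠ x in 𝓝 x₀, ∀ i j, f i ≠ f j → ζ (f i) ⟨i, rfl⟩ x ≠ ζ (f j) ⟨j, rfl⟩ x := by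
    refine eventually_all.2 fun i => eventually_all.2 fun j => ?_
    by_cases hij : f i = f j
    · simp [hij]
    · filter_upwards [((hζ (f i) ⟨i, rfl⟩).continuousAt.ne_iff_eventually_ne
        (hζ (f j) ⟨j, rfl⟩).continuousAt).1 (by simpa [hζ0] using hij)] with x hx _ using hx
  refine ⟨fun i x => τ x + (x - x₀) ^ p * ζ (f i) ⟨i, rfl⟩ x, fun i => ?_, fun i => ?_, ?_⟩
  · exact hτω.add (((contDiffAt_id.sub contDiffAt_const).pow p).mul (hζ _ _))
  · simp [hτκ, hp]
  filter_upwards [hKeq, hKs, hev', hsep] with x hx hsx hex hsepx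
  choose hK1 hK2 b hb using hex
  -- the eigenbases of the reduced families together form an eigenbasis
  set v : ι → EuclideanSpace ℂ ι :=
    fun i => e (f i) x (b ⟨f i, Set.mem_range_self i⟩ ⟨i, rfl⟩) with hv
  have hKv : ∀ i, K x (v i) = ζ (f i) ⟨i, rfl⟩ x • v i := fun i => by
    have h1 := hK1 ⟨f i, Set.mem_range_self i⟩ (b ⟨f i, Set.mem_range_self i⟩ ⟨i, rfl⟩)
    rw [hb, map_smul_of_tower] at h1
    exact h1
  have hvc : ∀ (c : Set.range f) (i : ι) (h : f i = c), v i = e c x (b c ⟨i, h⟩) := by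
    intro c i h
    obtain rfl : c = ⟨f i, Set.mem_range_self i⟩ := Subtype.ext h.symm
    rfl
  have hon : Orthonormal ℂ v := by
    refine orthonormal_iff_ite.2 fun i j => ?_
    by_cases hij : f i = f j
    · rw [hvc ⟨f j, Set.mem_range_self j⟩ i hij, hvc ⟨f j, Set.mem_range_self j⟩ j rfl,
        ← adjoint_inner_right]
      have h1 := congrArg (fun B => B (b ⟨f j, Set.mem_range_self j⟩ ⟨j, rfl⟩))
        (hK2 ⟨f j, Set.mem_range_self j⟩)
      simp only [comp_apply, one_apply_eq_self] at h1
      rw [h1, orthonormal_iff_ite.1 (b _).orthonormal]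
      simp
    · rw [if_neg (by rintro rfl; exact hij rfl)]
      have h1 := hsx.isSymmetric (v i) (v j)
      change inner ℂ (K x (v i)) (v j) = inner ℂ (v i) (K x (v j)) at h1
      rw [hKv, hKv, inner_smul_left_eq_smul, inner_smul_right_eq_smul] at h1
      by_contra hne
      exact hsepx i j hij (smul_left_injective ℝ hne h1)
  obtain ⟨b', hb'⟩ := exists_orthonormalBasis_of_orthonormal hon
  refine ⟨b', fun i => ?_⟩
  rw [hb', ← sub_add_cancel (M x) (τ x • 1), hx, add_apply, smul_apply, smul_apply, hKv,
    one_apply_eq_self]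
  module

end Analytic

/-! ### Continuously differentiable families of self-adjoint matrices -/

section Differentiable

open ContinuousLinearMap

theorem tendsto_clm_apply {α E F : Type*} [NormedAddCommGroup E] [NormedSpace ℂ E]
    [NormedAddCommGroup F] [NormedSpace ℂ F] {l : Filter α} {A : α → E →L[ℂ] F} {A₀ : E →L[ℂ] F}
    {v : α → E} {v₀ : E} (hA : Tendsto A l (𝓝 A₀)) (hv : Tendsto v l (𝓝 v₀)) :
    Tendsto (fun y => A y (v y)) l (𝓝 (A₀ v₀)) :=
  ((isBoundedBilinearMap_apply (𝕜 := ℂ)).continuous.tendsto (A₀, v₀)).comp (hA.prodMk_nhds hv)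

variable {ι : Type} [Fintype ι]

/-- An orthonormal eigenbasis `v` of `A`, with eigenvalues `f`, which also diagonalizes, with
eigenvalues `s`, the compressions of `B` to the eigenspaces of `A`. If `A` is the value and `B` the
derivative of a family of self-adjoint matrices, the `s i` are the slopes of the eigenvalues. -/
structure IsJointEigenbasis (A B : EuclideanSpace ℂ ι →L[ℂ] EuclideanSpace ℂ ι)
    (v : ι → EuclideanSpace ℂ ι) (f s : ι → ℝ) : Prop where
  orthonormal : Orthonormal ℂ v
  apply_eq : ∀ i, A (v i) = f i • v i
  inner_eq : ∀ i w, A w = f i • w → inner ℂ w (B (v i)) = s i * inner ℂ w (v i)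

/-- Two orthonormal bases can be matched such that corresponding vectors are not orthogonal, since
the determinant of the transition matrix does not vanish. -/
theorem exists_perm_inner_ne_zero (b b' : OrthonormalBasis ι ℂ (EuclideanSpace ℂ ι)) :
    ∃ τ : Equiv.Perm ι, ∀ i, inner ℂ (b (τ i)) (b' i) ≠ 0 := by
  classical
  have h : b.toBasis.det b' ≠ 0 := by
    intro h0
    have := b.det_to_matrix_orthonormalBasis b'
    rw [h0] at this
    simp at this
  rw [Module.Basis.det_apply, Matrix.det_apply] at h
  obtain ⟨τ, -, hτ⟩ := Finset.exists_ne_zero_of_sum_ne_zero h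
  refine ⟨τ, fun i => ?_⟩
  have h1 := right_ne_zero_of_smul hτ
  have h2 := Finset.prod_ne_zero_iff.1 h1 i (Finset.mem_univ i)
  rwa [Module.Basis.toMatrix_apply, OrthonormalBasis.coe_toBasis_repr_apply,
    OrthonormalBasis.repr_apply_apply] at h2

/-- The eigenvalues and slopes of a joint eigenbasis are unique up to order. -/
theorem IsJointEigenbasis.exists_perm {A B : EuclideanSpace ℂ ι →L[ℂ] EuclideanSpace ℂ ι}
    (hA : IsSelfAdjoint A) (hB : IsSelfAdjoint B) {v v' : ι → EuclideanSpace ℂ ι}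
    {f s f' s' : ι → ℝ} (h : IsJointEigenbasis A B v f s) (h' : IsJointEigenbasis A B v' f' s') :
    ∃ τ : Equiv.Perm ι, ∀ i, f (τ i) = f' i ∧ s (τ i) = s' i := by
  obtain ⟨b, hb⟩ := exists_orthonormalBasis_of_orthonormal h.orthonormal
  obtain ⟨b', hb'⟩ := exists_orthonormalBasis_of_orthonormal h'.orthonormal
  obtain ⟨τ, hτ⟩ := exists_perm_inner_ne_zero b b'
  refine ⟨τ, fun i => ?_⟩
  have h0 := hτ i
  rw [hb, hb'] at h0
  have h1 : f (τ i) = f' i := by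
    have h2 := hA.isSymmetric (v (τ i)) (v' i)
    change inner ℂ (A (v (τ i))) (v' i) = inner ℂ (v (τ i)) (A (v' i)) at h2
    rw [h.apply_eq, h'.apply_eq, inner_smul_left_eq_smul, inner_smul_right_eq_smul] at h2
    exact smul_left_injective ℝ h0 h2
  refine ⟨h1, ?_⟩
  have h2 := hB.isSymmetric (v (τ i)) (v' i)
  change inner ℂ (B (v (τ i))) (v' i) = inner ℂ (v (τ i)) (B (v' i)) at h2
  rw [h'.inner_eq i _ (by rw [h.apply_eq, h1]), ← inner_conj_symm,
    h.inner_eq (τ i) _ (by rw [h'.apply_eq, h1]), map_mul, inner_conj_symm,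
    Complex.conj_ofReal] at h2
  exact_mod_cast mul_right_cancel₀ h0 h2

/-- Limits of eigenbases at parameters `y → x`, `y ≠ x`, are joint eigenbases at `x`, and the
difference quotients of the eigenvalues tend to the slopes. -/
theorem exists_tendsto_isJointEigenbasis {M : ℝ → EuclideanSpace ℂ ι →L[ℂ] EuclideanSpace ℂ ι}
    {M' : EuclideanSpace ℂ ι →L[ℂ] EuclideanSpace ℂ ι} {x : ℝ} (hM : HasDerivAt M M' x)
    (hMx : IsSelfAdjoint (M x)) (U : Ultrafilter ℝ) (hU : (U : Filter ℝ) ≤ 𝓝[≠] x)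
    {v : ℝ → ι → EuclideanSpace ℂ ι} {f : ℝ → ι → ℝ} (hv : ∀ᶠ y in U, Orthonormal ℂ (v y))
    (hf : ∀ᶠ y in U, ∀ i, M y (v y i) = f y i • v y i) :
    ∃ (w : ι → EuclideanSpace ℂ ι) (g q : ι → ℝ), IsJointEigenbasis (M x) M' w g q ∧
      ∀ i, Tendsto (fun y => v y i) U (𝓝 (w i)) ∧ Tendsto (fun y => f y i) U (𝓝 (g i)) ∧
        Tendsto (fun y => (y - x)⁻¹ * (f y i - g i)) U (𝓝 (q i)) := by
  have hlim : ∀ i, ∃ w, Tendsto (fun y => v y i) U (𝓝 w) := by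
    intro i
    have h1 : (U.map fun y => v y i : Filter (EuclideanSpace ℂ ι)) ≤
        𝓟 (Metric.closedBall 0 1) := by
      rw [le_principal_iff, Ultrafilter.mem_coe, Ultrafilter.mem_map]
      filter_upwards [hv] with y hy
      simp [hy.1 i]
    obtain ⟨w, -, hw⟩ := (isCompact_closedBall (0 : EuclideanSpace ℂ ι) 1).ultrafilter_le_nhds
      (U.map fun y => v y i) h1
    exact ⟨w, hw⟩
  choose w hw using hlim
  have hM0 : Tendsto M U (𝓝 (M x)) :=
    hM.continuousAt.tendsto.mono_left (hU.trans nhdsWithin_le_nhds)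
  have hwon : Orthonormal ℂ w := by
    classical
    refine orthonormal_iff_ite.2 fun i j => ?_
    refine tendsto_nhds_unique ((hw i).inner (hw j)) (tendsto_const_nhds.congr' ?_)
    filter_upwards [hv] with y hy using (orthonormal_iff_ite.1 hy i j).symm
  set g : ι → ℝ := fun i => (inner ℂ (w i) (M x (w i))).re with hg
  have hfg : ∀ i, Tendsto (fun y => f y i) U (𝓝 (g i)) := by
    intro i
    have h1 := (Complex.continuous_re.tendsto _).comp ((hw i).inner (tendsto_clm_apply hM0 (hw i)))
    refine h1.congr' ?_
    filter_upwards [hv, hf] with y hy hfy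
    simp only [Function.comp_apply]
    rw [hfy, inner_smul_right_eq_smul, inner_self_eq_norm_sq_to_K, hy.1 i]
    simp
  have hgw : ∀ i, M x (w i) = g i • w i := by
    intro i
    refine tendsto_nhds_unique (tendsto_clm_apply hM0 (hw i)) (((hfg i).smul (hw i)).congr' ?_)
    filter_upwards [hf] with y hfy using (hfy i).symm
  have hslope : Tendsto (slope M x) U (𝓝 M') := (hasDerivAt_iff_tendsto_slope.1 hM).mono_left hU
  -- the difference quotient of the eigenvalue equation, tested with an eigenvector at `x`
  have htest : ∀ i u, M x u = g i • u → ∀ᶠ y in U,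
      inner ℂ u (slope M x y (v y i)) =
        (((y - x)⁻¹ * (f y i - g i) : ℝ) : ℂ) * inner ℂ u (v y i) := by
    intro i u hu
    filter_upwards [hf] with y hfy
    have h1 : inner ℂ u (M x (v y i)) = g i • inner ℂ u (v y i) := by
      have h2 := hMx.isSymmetric u (v y i)
      change inner ℂ (M x u) (v y i) = inner ℂ u (M x (v y i)) at h2
      rw [← h2, hu, inner_smul_left_eq_smul]
    rw [slope_def_module, smul_apply, sub_apply, inner_smul_right_eq_smul, inner_sub_right, hfy, h1,
      inner_smul_right_eq_smul]
    simp only [Complex.real_smul]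
    push_cast
    ring
  have hww : ∀ i, inner ℂ (w i) (w i) = 1 := fun i => by
    rw [inner_self_eq_norm_sq_to_K, hwon.1 i]
    simp
  have hq : ∀ i, Tendsto (fun y => (((y - x)⁻¹ * (f y i - g i) : ℝ) : ℂ)) U
      (𝓝 (inner ℂ (w i) (M' (w i)))) := by
    intro i
    have h1 : Tendsto (fun y => inner ℂ (w i) (v y i)) U (𝓝 1) := by
      rw [← hww i]
      exact tendsto_const_nhds.inner (hw i)
    have h2 : Tendsto (fun y => inner ℂ (w i) (slope M x y (v y i))) U
        (𝓝 (inner ℂ (w i) (M' (w i)))) :=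
      tendsto_const_nhds.inner (tendsto_clm_apply hslope (hw i))
    have h3 := h2.div h1 one_ne_zero
    rw [div_one] at h3
    refine h3.congr' ?_
    filter_upwards [htest i (w i) (hgw i), h1.eventually_ne one_ne_zero] with y hy hne
    simp only [Pi.div_apply]
    rw [hy, mul_div_cancel_right₀ _ hne]
  have hq' : ∀ i, Tendsto (fun y => (y - x)⁻¹ * (f y i - g i)) U
      (𝓝 (inner ℂ (w i) (M' (w i))).re) := fun i =>
    (Complex.continuous_re.tendsto _).comp (hq i)
  refine ⟨w, g, fun i => (inner ℂ (w i) (M' (w i))).re, ⟨hwon, hgw, fun i u hu => ?_⟩,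
    fun i => ⟨hw i, hfg i, hq' i⟩⟩
  have h1 : Tendsto (fun y => inner ℂ u (slope M x y (v y i))) U (𝓝 (inner ℂ u (M' (w i)))) :=
    tendsto_const_nhds.inner (tendsto_clm_apply hslope (hw i))
  refine tendsto_nhds_unique (h1.congr' (htest i u hu)) ?_
  exact ((Complex.continuous_ofReal.tendsto _).comp (hq' i)).mul (tendsto_const_nhds.inner (hw i))

/-- **Rellich's theorem** for a continuously differentiable family of self-adjoint matrices, near a
parameter where the matrix is scalar. The unordered tuple of pairs (eigenvalue, slope) depends
continuously on the parameter; in a continuous numbering of these pairs the eigenvalues are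
differentiable and the slopes are their derivatives. -/
theorem exists_differentiable_eigenvalues
    (M : ℝ → EuclideanSpace ℂ ι →L[ℂ] EuclideanSpace ℂ ι) (x₀ κ : ℝ) (hM : ContDiffAt ℝ 1 M x₀)
    (hMs : ∀ᶠ x in 𝓝 x₀, IsSelfAdjoint (M x)) (hMκ : M x₀ = κ • 1) :
    ∃ ζ : ι → ℝ → ℝ, (∀ i, ContDiffAt ℝ 1 (ζ i) x₀) ∧ (∀ i, ζ i x₀ = κ) ∧
      ∀ᶠ x in 𝓝 x₀, ∃ b : OrthonormalBasis ι ℂ (EuclideanSpace ℂ ι),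
        ∀ i, M x (b i) = ζ i x • b i := by
  classical
  obtain ⟨I, hI, hIo, hx₀⟩ : ∃ I : Set ℝ, (∀ x ∈ I, ContDiffAt ℝ 1 M x ∧ IsSelfAdjoint (M x)) ∧
      IsOpen I ∧ x₀ ∈ I :=
    eventually_nhds_iff.1 ((hM.eventually (by simp)).and hMs)
  have hd : ∀ x ∈ I, HasDerivAt M (deriv M x) x := fun x hx =>
    ((hI x hx).1.differentiableAt one_ne_zero).hasDerivAt
  have hdc : ∀ x ∈ I, ContinuousAt (deriv M) x := by
    intro x hx
    have h1 : ContDiffOn ℝ 1 M I := fun y hy => (hI y hy).1.contDiffWithinAt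
    exact (h1.continuousOn_deriv_of_isOpen hIo le_rfl).continuousAt (hIo.mem_nhds hx)
  have hds : ∀ x ∈ I, IsSelfAdjoint (deriv M x) := by
    intro x hx
    refine isSelfAdjoint_of_tendsto (hasDerivAt_iff_tendsto_slope.1 (hd x hx)) ?_
    filter_upwards [nhdsWithin_le_nhds (hIo.mem_nhds hx)] with y hy
    rw [slope_def_module]
    exact IsSelfAdjoint.smul (IsSelfAdjoint.all _) ((hI y hy).2.sub (hI x hx).2)
  have hex : ∀ x ∈ I, ∃ (v : ι → EuclideanSpace ℂ ι) (f s : ι → ℝ),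
      IsJointEigenbasis (M x) (deriv M x) v f s := by
    intro x hx
    have h1 : ∀ y, ∃ (v : ι → EuclideanSpace ℂ ι) (f : ι → ℝ), y ∈ I → Orthonormal ℂ v ∧
        ∀ i, M y (v i) = f i • v i := by
      intro y
      by_cases hy : y ∈ I
      · obtain ⟨b, f, hb⟩ := exists_eigenbasis (M y) (hI y hy).2
        exact ⟨b, f, fun _ => ⟨b.orthonormal, hb⟩⟩
      · exact ⟨0, 0, fun h => absurd h hy⟩
    choose v f hvf using h1
    have hU : (Ultrafilter.of (𝓝[≠] x) : Filter ℝ) ≤ 𝓝[≠] x := Ultrafilter.of_le _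
    have hIU : ∀ᶠ y in (Ultrafilter.of (𝓝[≠] x) : Filter ℝ), y ∈ I :=
      hU.trans nhdsWithin_le_nhds (hIo.mem_nhds hx)
    obtain ⟨w, g, q, h, -⟩ := exists_tendsto_isJointEigenbasis (hd x hx) (hI x hx).2 _ hU
      (v := v) (f := f) (hIU.mono fun y hy => (hvf y hy).1) (hIU.mono fun y hy => (hvf y hy).2)
    exact ⟨w, g, q, h⟩
  choose! v f s hJ using hex
  -- continuity and differentiability of the unordered tuple of eigenvalues and slopes
  have hkey : ∀ x ∈ I, ∀ U : Ultrafilter ℝ, (U : Filter ℝ) ≤ 𝓝[≠] x → ∃ τ : Equiv.Perm ι, ∀ i,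
      Tendsto (fun y => f y (τ i)) U (𝓝 (f x i)) ∧ Tendsto (fun y => s y (τ i)) U (𝓝 (s x i)) ∧
        Tendsto (fun y => (y - x)⁻¹ * (f y (τ i) - f x i)) U (𝓝 (s x i)) := by
    intro x hx U hU
    have hIU : ∀ᶠ y in (U : Filter ℝ), y ∈ I := hU.trans nhdsWithin_le_nhds (hIo.mem_nhds hx)
    obtain ⟨w, g, q, h, hlim⟩ := exists_tendsto_isJointEigenbasis (hd x hx) (hI x hx).2 U hU
      (v := v) (f := f) (hIU.mono fun y hy => (hJ y hy).orthonormal)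
      (hIU.mono fun y hy => (hJ y hy).apply_eq)
    obtain ⟨τ, hτ⟩ := h.exists_perm (hI x hx).2 (hds x hx) (hJ x hx)
    refine ⟨τ, fun i => ?_⟩
    obtain ⟨h1, h2, h3⟩ := hlim (τ i)
    rw [(hτ i).1] at h2 h3
    rw [(hτ i).2] at h3
    refine ⟨h2, ?_, h3⟩
    have hself : ∀ (A B : EuclideanSpace ℂ ι →L[ℂ] EuclideanSpace ℂ ι)
        (v : ι → EuclideanSpace ℂ ι) (f s : ι → ℝ), IsJointEigenbasis A B v f s →
        ∀ j, (inner ℂ (v j) (B (v j))).re = s j := by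
      intro A B v f s hAB j
      rw [hAB.inner_eq j _ (hAB.apply_eq j), inner_self_eq_norm_sq_to_K, hAB.orthonormal.1 j]
      simp
    have h4 : Tendsto (fun y => (inner ℂ (v y (τ i)) (deriv M y (v y (τ i)))).re) U
        (𝓝 (inner ℂ (w (τ i)) (deriv M x (w (τ i)))).re) :=
      (Complex.continuous_re.tendsto _).comp (h1.inner
        (tendsto_clm_apply ((hdc x hx).tendsto.mono_left (hU.trans nhdsWithin_le_nhds)) h1))
    rw [hself _ _ _ _ _ h (τ i), (hτ i).2] at h4
    refine h4.congr' ?_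
    filter_upwards [hIU] with y hy using hself _ _ _ _ _ (hJ y hy) _
  obtain ⟨σ, hσ⟩ := exists_continuous_selection (fun i y => (f y i, s y i)) I (by
    intro x hx δ hδ
    by_contra hcon
    -- otherwise an ultrafilter avoids all good parameters, against `hkey`
    have hfreq : ∃ᶠ y in 𝓝[≠] x,
        ¬ ∃ τ : Equiv.Perm ι, ∀ i, dist (f y (τ i), s y (τ i)) (f x i, s x i) < δ := by
      intro h
      refine hcon ?_
      filter_upwards [eventually_nhdsWithin_iff.1 h] with y hy
      rcases eq_or_ne y x with rfl | hne
      · exact ⟨1, fun i => by simpa using hδ⟩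
      · exact not_not.1 (hy hne)
    have hne : NeBot (𝓝[≠] x ⊓ 𝓟 {y | ¬ ∃ τ : Equiv.Perm ι, ∀ i,
        dist (f y (τ i), s y (τ i)) (f x i, s x i) < δ}) := frequently_mem_iff_neBot.1 hfreq
    have hU := Ultrafilter.of_le (𝓝[≠] x ⊓ 𝓟 {y | ¬ ∃ τ : Equiv.Perm ι, ∀ i,
        dist (f y (τ i), s y (τ i)) (f x i, s x i) < δ})
    obtain ⟨τ, hτ⟩ := hkey x hx _ (hU.trans inf_le_left)
    have h1 : ∀ᶠ y in (Ultrafilter.of (𝓝[≠] x ⊓ 𝓟 {y | ¬ ∃ τ : Equiv.Perm ι, ∀ i,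
        dist (f y (τ i), s y (τ i)) (f x i, s x i) < δ}) : Filter ℝ),
        ∀ i, dist (f y (τ i), s y (τ i)) (f x i, s x i) < δ :=
      eventually_all.2 fun i => Metric.tendsto_nhds.1
        ((hτ i).1.prodMk_nhds (hτ i).2.1) δ hδ
    have h2 := (le_principal_iff.1 (hU.trans inf_le_right))
    obtain ⟨y, hy1, hy2⟩ := (h1.and h2).exists
    exact hy2 ⟨τ, hy1⟩)
  have hfc : ∀ x ∈ I, ∀ i, ContinuousAt (fun y => f y (σ y i)) x := fun x hx i =>
    continuousAt_fst.comp (hσ x hx i)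
  have hsc : ∀ x ∈ I, ∀ i, ContinuousAt (fun y => s y (σ y i)) x := fun x hx i =>
    continuousAt_snd.comp (hσ x hx i)
  have hder : ∀ x ∈ I, ∀ i, HasDerivAt (fun y => f y (σ y i)) (s x (σ x i)) x := by
    intro x hx i
    rw [hasDerivAt_iff_tendsto_slope, tendsto_iff_ultrafilter]
    intro U hU
    obtain ⟨τ, hτ⟩ := hkey x hx U hU
    have hU' : (U : Filter ℝ) ≤ 𝓝 x := hU.trans nhdsWithin_le_nhds
    obtain ⟨π, hπ⟩ := (Ultrafilter.eventually_exists_iff (f := U)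
      (P := fun (π : Equiv.Perm ι) y => σ y = π)).1 (Eventually.of_forall fun y => ⟨σ y, rfl⟩)
    obtain ⟨h1, h2, h3⟩ := hτ (τ.symm (π i))
    rw [Equiv.apply_symm_apply] at h1 h2 h3
    have h4 : f x (τ.symm (π i)) = f x (σ x i) := by
      refine tendsto_nhds_unique (h1.congr' ?_) ((hfc x hx i).tendsto.mono_left hU')
      filter_upwards [hπ] with y hy
      rw [hy]
    have h5 : s x (τ.symm (π i)) = s x (σ x i) := by
      refine tendsto_nhds_unique (h2.congr' ?_) ((hsc x hx i).tendsto.mono_left hU')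
      filter_upwards [hπ] with y hy
      rw [hy]
    rw [h4, h5] at h3
    refine h3.congr' ?_
    filter_upwards [hπ] with y hy
    rw [slope_def_module, hy, smul_eq_mul]
  refine ⟨fun i y => f y (σ y i), fun i => ?_, fun i => ?_, ?_⟩
  · refine contDiffAt_one_iff.2 ⟨fun x => toSpanSingleton ℝ (s x (σ x i)), I, hIo.mem_nhds hx₀, ?_,
      fun x hx => (hder x hx i).hasFDerivAt⟩
    intro x hx
    have hcts : Continuous fun c : ℝ => toSpanSingleton ℝ c :=
      (toSpanSingletonCLE (𝕜 := ℝ) (E := ℝ)).continuous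
    exact (hcts.continuousAt.comp (hsc x hx i)).continuousWithinAt
  · have h1 := (hJ x₀ hx₀).apply_eq (σ x₀ i)
    have hne : v x₀ (σ x₀ i) ≠ 0 := (hJ x₀ hx₀).orthonormal.ne_zero _
    rw [hMκ, smul_apply, one_apply_eq_self] at h1
    exact (smul_left_injective ℝ hne h1).symm
  · filter_upwards [hIo.mem_nhds hx₀] with x hx
    obtain ⟨b, hb⟩ := exists_orthonormalBasis_of_orthonormal (hJ x hx).orthonormal
    refine ⟨b.reindex (σ x).symm, fun i => ?_⟩
    simp only [OrthonormalBasis.reindex_apply, Equiv.symm_symm, hb]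
    exact (hJ x hx).apply_eq _

end Differentiable

/-! ### Eigenvalues of a pencil near an isolated eigenvalue -/

section Pencil

open ContinuousLinearMap

theorem hasDerivAt_comp_real {E F G : Type*} [NormedAddCommGroup E] [NormedSpace ℂ E]
    [NormedAddCommGroup F] [NormedSpace ℂ F] [NormedAddCommGroup G] [NormedSpace ℂ G]
    {A : ℝ → F →L[ℂ] G} {B : ℝ → E →L[ℂ] F} {A' : F →L[ℂ] G} {B' : E →L[ℂ] F} {x : ℝ}
    (hA : HasDerivAt A A' x) (hB : HasDerivAt B B' x) :
    HasDerivAt (fun y => A y ∘L B y) (A x ∘L B' + A' ∘L B x) x := by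
  have h := ((isBoundedBilinearMap_comp_real E F G).hasFDerivAt (A x, B x)).comp_hasDerivAt x
    (hA.prodMk hB)
  exact h

variable {ι : Type} [Fintype ι]

/-- If the eigenvalues of a family of matrices are differentiable at a parameter at which the
matrix is scalar, their derivatives are the eigenvalues of the derivative of the family. -/
theorem charpoly_deriv_eq_prod {M : ℝ → EuclideanSpace ℂ ι →L[ℂ] EuclideanSpace ℂ ι} {x₀ κ : ℝ}
    {M' : EuclideanSpace ℂ ι →L[ℂ] EuclideanSpace ℂ ι} (hM : HasDerivAt M M' x₀)
    (hM0 : M x₀ = κ • 1) {ζ : ι → ℝ → ℝ} {d : ι → ℝ} (hζ : ∀ i, HasDerivAt (ζ i) (d i) x₀)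
    (hζ0 : ∀ i, ζ i x₀ = κ)
    (hb : ∀ᶠ x in 𝓝 x₀, ∃ b : OrthonormalBasis ι ℂ (EuclideanSpace ℂ ι),
      ∀ i, M x (b i) = ζ i x • b i) :
    LinearMap.charpoly (M' : EuclideanSpace ℂ ι →ₗ[ℂ] EuclideanSpace ℂ ι) =
      ∏ i, (Polynomial.X - Polynomial.C (d i : ℂ)) := by
  classical
  refine Polynomial.funext fun z => ?_
  have hev : ∀ A : EuclideanSpace ℂ ι →L[ℂ] EuclideanSpace ℂ ι,
      (LinearMap.charpoly (A : EuclideanSpace ℂ ι →ₗ[ℂ] EuclideanSpace ℂ ι)).eval z =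
        (z • (1 : EuclideanSpace ℂ ι →L[ℂ] EuclideanSpace ℂ ι) - A).det := by
    intro A
    rw [LinearMap.eval_charpoly]
    rfl
  rw [hev, Polynomial.eval_prod]
  simp only [Polynomial.eval_sub, Polynomial.eval_X, Polynomial.eval_C]
  have h1 : Tendsto (fun x => (z • (1 : EuclideanSpace ℂ ι →L[ℂ] EuclideanSpace ℂ ι) -
      slope M x₀ x).det) (𝓝[≠] x₀)
      (𝓝 (z • (1 : EuclideanSpace ℂ ι →L[ℂ] EuclideanSpace ℂ ι) - M').det) :=
    (ContinuousLinearMap.continuous_det.tendsto _).comp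
      (tendsto_const_nhds.sub (hasDerivAt_iff_tendsto_slope.1 hM))
  have h2 : Tendsto (fun x => ∏ i, (z - ((slope (ζ i) x₀ x : ℝ) : ℂ))) (𝓝[≠] x₀)
      (𝓝 (∏ i, (z - (d i : ℂ)))) :=
    tendsto_finsetProd _ fun i _ => tendsto_const_nhds.sub
      ((Complex.continuous_ofReal.tendsto _).comp (hasDerivAt_iff_tendsto_slope.1 (hζ i)))
  refine tendsto_nhds_unique (h1.congr' ?_) h2
  filter_upwards [nhdsWithin_le_nhds hb] with x ⟨b, hbx⟩
  have h3 : LinearMap.toMatrix b.toBasis b.toBasis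
      ((z • (1 : EuclideanSpace ℂ ι →L[ℂ] EuclideanSpace ℂ ι) - slope M x₀ x :
        EuclideanSpace ℂ ι →L[ℂ] EuclideanSpace ℂ ι) :
        EuclideanSpace ℂ ι →ₗ[ℂ] EuclideanSpace ℂ ι) =
      Matrix.diagonal fun i => z - ((slope (ζ i) x₀ x : ℝ) : ℂ) := by
    have h4 : ∀ i, (z • (1 : EuclideanSpace ℂ ι →L[ℂ] EuclideanSpace ℂ ι) - slope M x₀ x) (b i) =
        (z - ((slope (ζ i) x₀ x : ℝ) : ℂ)) • b i := by
      intro i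
      rw [slope_def_module, slope_def_module, hζ0, hM0]
      simp only [sub_apply, smul_apply, one_apply_eq_self, hbx, smul_eq_mul]
      rw [← Complex.coe_smul, ← Complex.coe_smul, ← Complex.coe_smul]
      push_cast
      module
    ext i j
    rw [LinearMap.toMatrix_apply]
    simp only [OrthonormalBasis.coe_toBasis, ContinuousLinearMap.coe_coe, h4, map_smul,
      Finsupp.smul_apply]
    rw [← OrthonormalBasis.coe_toBasis, Module.Basis.repr_self, Matrix.diagonal_apply]
    by_cases hij : i = j
    · subst hij; simp
    · simp [hij]
  rw [ContinuousLinearMap.det, ← LinearMap.det_toMatrix b.toBasis, h3, Matrix.det_diagonal]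

variable {V : Type*} [NormedAddCommGroup V] [InnerProductSpace ℂ V] [CompleteSpace V]

/-- **Rellich's theorem** for a pencil `T - μ J` of self-adjoint operators with a Fredholm
eigenvalue `κ` at `x₀`. -/
theorem exists_pencil_eigenvalues {r : WithTop ℕ∞} (hr : r = 1 ∨ r = ω) {T J : ℝ → V →L[ℂ] V}
    {x₀ κ : ℝ} (hT : ContDiffAt ℝ r T x₀) (hJ : ContDiffAt ℝ r J x₀)
    (hTs : ∀ᶠ x in 𝓝 x₀, IsSelfAdjoint (T x)) (hJs : ∀ᶠ x in 𝓝 x₀, IsSelfAdjoint (J x))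
    (e₀ : EuclideanSpace ℂ ι →L[ℂ] V) (he₀ : ∀ w, T x₀ (e₀ w) = κ • J x₀ (e₀ w))
    (hortho : adjoint e₀ ∘L (J x₀ ∘L e₀) = 1)
    (hunit : IsUnit (T x₀ - κ • J x₀ + J x₀ ∘L (e₀ ∘L (adjoint e₀ ∘L J x₀)))) :
    ∃ ζ : ι → ℝ → ℝ, (∀ i, ContDiffAt ℝ r (ζ i) x₀) ∧ (∀ i, ζ i x₀ = κ) ∧
      (∃ ε > 0, ∀ᶠ x in 𝓝 x₀, ∃ w : ι → V,
        (∀ i j, i ≠ j → inner ℂ (w i) (J x (w j)) = 0) ∧ (∀ i, inner ℂ (w i) (J x (w i)) = 1) ∧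
        (∀ i, T x (w i) = ζ i x • J x (w i)) ∧
        ∀ μ : ℝ, |μ - κ| < ε → ∀ v, T x v = μ • J x v →
          v ∈ Submodule.span ℂ (w '' {i | ζ i x = μ})) ∧
      ∃ d : ι → ℝ, (∀ i, HasDerivAt (ζ i) (d i) x₀) ∧
        LinearMap.charpoly ((adjoint e₀ ∘L ((deriv T x₀ - κ • deriv J x₀) ∘L e₀) :
          EuclideanSpace ℂ ι →L[ℂ] EuclideanSpace ℂ ι) :
            EuclideanSpace ℂ ι →ₗ[ℂ] EuclideanSpace ℂ ι) =
          ∏ i, (Polynomial.X - Polynomial.C (d i : ℂ)) := by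
  have hr1 : 1 ≤ r := by rcases hr with rfl | rfl <;> simp
  obtain ⟨e, M, heC, hMC, hex, hMx, hgood, ε, hε, hcap⟩ :=
    exists_reduction hr1 hT hJ hTs hJs e₀ he₀ hortho hunit
  have hMs : ∀ᶠ x in 𝓝 x₀, IsSelfAdjoint (M x) := hgood.mono fun x hx => hx.2.2.2
  obtain ⟨ζ, hζ, hζ0, hb⟩ : ∃ ζ : ι → ℝ → ℝ, (∀ i, ContDiffAt ℝ r (ζ i) x₀) ∧ (∀ i, ζ i x₀ = κ) ∧
      ∀ᶠ x in 𝓝 x₀, ∃ b : OrthonormalBasis ι ℂ (EuclideanSpace ℂ ι),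
        ∀ i, M x (b i) = ζ i x • b i := by
    rcases hr with rfl | rfl
    · exact exists_differentiable_eigenvalues M x₀ κ hMC hMs hMx
    · exact exists_analytic_eigenvalues _ ι rfl M x₀ κ hMC hMs hMx
  refine ⟨ζ, hζ, hζ0, ⟨ε, hε, ?_⟩, fun i => deriv (ζ i) x₀, fun i =>
    (((hζ i).of_le hr1).differentiableAt one_ne_zero).hasDerivAt, ?_⟩
  · filter_upwards [hgood, hcap, hb] with x ⟨h1, h2, _, hMsx⟩ hc ⟨b, hbx⟩
    have hJe : ∀ a a', inner ℂ (e x a) (J x (e x a')) = inner ℂ a a' := by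
      intro a a'
      have h3 : adjoint (e x) (J x (e x a')) = a' := by
        simpa using DFunLike.congr_fun h2 a'
      rw [← adjoint_inner_right, h3]
    refine ⟨fun i => e x (b i), fun i j hij => ?_, fun i => ?_, fun i => ?_, fun μ hμ v hv => ?_⟩
    · rw [hJe, b.orthonormal.2 hij]
    · rw [hJe, inner_self_eq_norm_sq_to_K, b.orthonormal.1 i]
      simp
    · rw [h1, hbx, map_smul_of_tower, map_smul_of_tower]
    · obtain ⟨a, rfl, ha⟩ := hc μ hμ v hv
      have hspan : a ∈ Submodule.span ℂ (b '' {i | ζ i x = μ}) := by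
        rw [← b.sum_repr' a]
        refine Submodule.sum_mem _ fun i _ => ?_
        by_cases hi : ζ i x = μ
        · exact Submodule.smul_mem _ _ (Submodule.subset_span ⟨i, hi, rfl⟩)
        · have h3 : inner ℂ (M x (b i)) a = inner ℂ (b i) (M x a) :=
            hMsx.isSymmetric (b i) a
          rw [hbx, ha, inner_smul_left_eq_smul, inner_smul_right_eq_smul] at h3
          have h4 : inner ℂ (b i) a = 0 := by
            by_contra hne
            exact hi (smul_left_injective ℝ hne h3)
          rw [h4, zero_smul]
          exact Submodule.zero_mem _
      have := Submodule.mem_map_of_mem (f := (e x : EuclideanSpace ℂ ι →ₗ[ℂ] V)) hspan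
      rwa [Submodule.map_span, ← Set.image_comp] at this
  · have hT1 := ((hT.of_le hr1).differentiableAt one_ne_zero).hasDerivAt
    have hJ1 := ((hJ.of_le hr1).differentiableAt one_ne_zero).hasDerivAt
    have he1 := ((heC.of_le hr1).differentiableAt one_ne_zero).hasDerivAt
    have ha1 : HasDerivAt (fun x => adjoint (e x)) (adjoint (deriv e x₀)) x₀ :=
      (adjointReal (EuclideanSpace ℂ ι) V).hasFDerivAt.comp_hasDerivAt x₀ he1
    have hL1 := hT1.sub (hJ1.const_smul κ)
    have h1 := hasDerivAt_comp_real ha1 (hasDerivAt_comp_real hL1 he1)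
    have h2 : HasDerivAt M (adjoint e₀ ∘L ((deriv T x₀ - κ • deriv J x₀) ∘L e₀)) x₀ := by
      have h3 : HasDerivAt M _ x₀ := (h1.add_const
          (κ • (1 : EuclideanSpace ℂ ι →L[ℂ] EuclideanSpace ℂ ι))).congr_of_eventuallyEq (by
        filter_upwards [hgood] with x ⟨_, h2, h3, _⟩
        simp only [Pi.sub_apply, Pi.smul_apply]
        have h4 : adjoint (e x) ∘L (κ • J x ∘L e x) = κ • 1 := by
          rw [← h2]
          refine ContinuousLinearMap.ext fun a => ?_
          simp only [comp_apply, smul_apply, map_smul_of_tower]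
        rw [sub_comp, comp_sub, ← h3, smul_comp, h4, sub_add_cancel])
      -- the terms with the derivative of the frame vanish, as `T - κ J` vanishes on the frame
      have hT0 : ∀ v v', inner ℂ (T x₀ v) v' = inner ℂ v (T x₀ v') := hTs.self_of_nhds.isSymmetric
      have hJ0 : ∀ v v', inner ℂ (J x₀ v) v' = inner ℂ v (J x₀ v') := hJs.self_of_nhds.isSymmetric
      refine h3.congr_deriv ?_
      refine ContinuousLinearMap.ext fun a => ext_inner_left ℂ fun a' => ?_
      simp only [comp_apply, add_apply, sub_apply, smul_apply, Pi.sub_apply, Pi.smul_apply, hex,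
        inner_add_right, adjoint_inner_right, he₀, sub_self, inner_zero_right, add_zero]
      rw [inner_sub_right (𝕜 := ℂ) _ (T x₀ _), ← hT0, he₀, inner_smul_right_eq_smul, ← hJ0,
        inner_smul_left_eq_smul, sub_self, zero_add]
    exact charpoly_deriv_eq_prod h2 hMx (fun i =>
      (((hζ i).of_le hr1).differentiableAt one_ne_zero).hasDerivAt) hζ0 hb

end Pencil

/-! ### The Fredholm property -/

section Fredholm

open ContinuousLinearMap

variable {V : Type*} [NormedAddCommGroup V] [InnerProductSpace ℂ V] [CompleteSpace V]

/-- Fredholm alternative for a compact perturbation of an invertible operator. -/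
theorem isUnit_sub_of_isCompactOperator {S C : V →L[ℂ] V} (hS : IsUnit S)
    (hC : IsCompactOperator C) (hinj : ∀ v, (S - C) v = 0 → v = 0) : IsUnit (S - C) := by
  obtain ⟨Q, rfl⟩ := hS
  have hK : IsCompactOperator ((↑Q⁻¹ : V →L[ℂ] V) * C) := hC.clm_comp (↑Q⁻¹ : V →L[ℂ] V)
  have hfac : (Q : V →L[ℂ] V) - C = Q * (1 - ↑Q⁻¹ * C) := by
    rw [mul_sub, mul_one, ← mul_assoc, Q.mul_inv, one_mul]
  rw [hfac]
  refine Q.isUnit.mul ?_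
  rcases hK.hasEigenvalue_or_mem_resolventSet (one_ne_zero (α := ℂ)) with h | h
  · obtain ⟨v, hv, hv0⟩ := h.exists_hasEigenvector
    rw [Module.End.mem_eigenspace_iff, one_smul] at hv
    refine absurd (hinj v ?_) hv0
    rw [hfac]
    change (Q : V →L[ℂ] V) (v - (↑Q⁻¹ * C : V →L[ℂ] V) v) = 0
    rw [ContinuousLinearMap.coe_coe] at hv
    rw [hv, sub_self, map_zero]
  · simpa [spectrum.mem_resolventSet_iff] using h

theorem finiteDimensional_ker_sub_of_isCompactOperator {S C : V →L[ℂ] V} (hS : IsUnit S)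
    (hC : IsCompactOperator C) :
    FiniteDimensional ℂ (LinearMap.ker ((S - C : V →L[ℂ] V) : V →ₗ[ℂ] V)) := by
  obtain ⟨Q, rfl⟩ := hS
  have hK : IsCompactOperator ((↑Q⁻¹ : V →L[ℂ] V) * C) := hC.clm_comp (↑Q⁻¹ : V →L[ℂ] V)
  have := ContinuousLinearMap.finite_dimensional_eigenspace hK 1 one_ne_zero
  refine Submodule.finiteDimensional_of_le
    (S₂ := Module.End.eigenspace ((↑Q⁻¹ * C : V →L[ℂ] V) : V →ₗ[ℂ] V) 1) fun v hv => ?_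
  rw [Module.End.mem_eigenspace_iff, one_smul]
  rw [LinearMap.mem_ker, ContinuousLinearMap.coe_coe, sub_apply, sub_eq_zero] at hv
  change (↑Q⁻¹ : V →L[ℂ] V) (C v) = v
  rw [← hv]
  exact DFunLike.congr_fun Q.inv_mul v

/-- The projection onto the kernel of `T` which is orthogonal with respect to the form of `J`. -/
theorem exists_kernel_projection {T J : V →L[ℂ] V} (hJ : IsSelfAdjoint J) {c : ℝ} (hc : 0 < c)
    (hcoer : ∀ v, T v = 0 → c * ‖v‖ ^ 2 ≤ (inner ℂ v (J v)).re) :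
    ∃ P : V →L[ℂ] V, (∀ v, T (P v) = 0) ∧ (∀ v, T v = 0 → P v = v) ∧
      ∀ v w, inner ℂ (J (P v)) w = inner ℂ v (J (P w)) := by
  set N : Submodule ℂ V := LinearMap.ker (T : V →ₗ[ℂ] V) with hN
  have hNc : IsClosed (N : Set V) := T.isClosed_ker
  have : CompleteSpace N := hNc.completeSpace_coe
  set n : N →L[ℂ] V := N.subtypeL with hn
  have hTn : ∀ x : N, T x = 0 := fun x => x.2
  set G : N →L[ℂ] N := adjoint n ∘L (J ∘L n) with hG
  have hGin : ∀ x y : N, inner ℂ x (G y) = inner ℂ (x : V) (J y) := fun x y => by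
    rw [hG, comp_apply, adjoint_inner_right]
    rfl
  have hGu : IsUnit G := by
    refine isUnit_of_forall_le_norm_inner_map (c := ⟨c, hc.le⟩) G hc fun x => ?_
    have h1 := hcoer x (hTn x)
    rw [← hGin] at h1
    calc ‖x‖ ^ 2 * c = c * ‖(x : V)‖ ^ 2 := by rw [mul_comm]; rfl
      _ ≤ (inner ℂ x (G x)).re := h1
      _ ≤ ‖inner ℂ x (G x)‖ := Complex.re_le_norm _
      _ = ‖inner ℂ (G x) x‖ := norm_inner_symm _ _
  have hGs : ∀ x y : N, inner ℂ (G x) y = inner ℂ x (G y) := fun x y => by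
    rw [← inner_conj_symm, hGin, hGin, inner_conj_symm]
    exact hJ.isSymmetric (x : V) y
  obtain ⟨Q, hQ⟩ := hGu
  have hQ1 : ∀ x, G ((↑Q⁻¹ : N →L[ℂ] N) x) = x := fun x => by
    rw [← hQ]
    exact DFunLike.congr_fun Q.mul_inv x
  have hQ2 : ∀ x, (↑Q⁻¹ : N →L[ℂ] N) (G x) = x := fun x => by
    rw [← hQ]
    exact DFunLike.congr_fun Q.inv_mul x
  refine ⟨n ∘L ((↑Q⁻¹ : N →L[ℂ] N) ∘L (adjoint n ∘L J)), fun v => hTn _, fun v hv => ?_,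
    fun v w => ?_⟩
  · have h1 : adjoint n (J v) = G ⟨v, hv⟩ := rfl
    simp only [comp_apply]
    rw [h1, hQ2]
    rfl
  · simp only [comp_apply]
    have hJ0 : ∀ v v', inner ℂ (J v) v' = inner ℂ v (J v') := hJ.isSymmetric
    rw [hJ0, ← hJ0 v, ← adjoint_inner_right, ← adjoint_inner_left n]
    generalize adjoint n (J v) = a
    generalize adjoint n (J w) = b
    conv_lhs => rw [← hQ1 b]
    rw [← hGs, hQ1]

variable {T J P : V →L[ℂ] V}

/-- Let `T, J` be self-adjoint with `T + J` coercive and `P` the `J`-orthogonal projection onto the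
kernel of `T`. If the embedding of the `J`-orthogonal complement of the kernel is compact, `T - κ J`
is a compact perturbation of an invertible operator, for every `κ > 0`. -/
structure IsReducedCompact (T J P : V →L[ℂ] V) : Prop where
  symm_T : IsSelfAdjoint T
  symm_J : IsSelfAdjoint J
  nonneg_T : ∀ v, 0 ≤ (inner ℂ v (T v)).re
  pos_J : ∀ v, v ≠ 0 → 0 < (inner ℂ v (J v)).re
  coercive : ∃ c > 0, ∀ v, c * ‖v‖ ^ 2 ≤ (inner ℂ v (T v)).re + (inner ℂ v (J v)).re
  T_P : ∀ v, T (P v) = 0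
  P_eq : ∀ v, T v = 0 → P v = v
  J_P : ∀ v w, inner ℂ (J (P v)) w = inner ℂ v (J (P w))
  compact : IsCompactOperator (J ∘L (1 - P))

namespace IsReducedCompact

theorem nonneg_J (h : IsReducedCompact T J P) (v : V) : 0 ≤ (inner ℂ v (J v)).re := by
  rcases eq_or_ne v 0 with rfl | hv
  · simp
  · exact (h.pos_J v hv).le

theorem P_P (h : IsReducedCompact T J P) (v : V) : P (P v) = P v := h.P_eq _ (h.T_P v)

theorem inner_T (h : IsReducedCompact T J P) (v w : V) :
    inner ℂ (T v) w = inner ℂ v (T w) := h.symm_T.isSymmetric v w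

theorem inner_J (h : IsReducedCompact T J P) (v w : V) :
    inner ℂ (J v) w = inner ℂ v (J w) := h.symm_J.isSymmetric v w

/-- Pythagoras for the form of `J`. -/
theorem inner_J_eq (h : IsReducedCompact T J P) (v : V) :
    inner ℂ v (J v) = inner ℂ (v - P v) (J (v - P v)) + inner ℂ (P v) (J (P v)) := by
  have h1 : inner ℂ v (J (P v)) = inner ℂ (P v) (J (P v)) := by
    rw [← h.inner_J (P v), h.J_P, h.P_P]
  have h2 : inner ℂ (P v) (J v) = inner ℂ (P v) (J (P v)) := by
    rw [← h.inner_J (P v) v, h.J_P, h1]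
  rw [map_sub, inner_sub_left, inner_sub_right, inner_sub_right, h1, h2]
  ring

/-- The positive definite form from which `T - κ J` arises by a change of sign on the kernel of `T`
and a compact perturbation. -/
theorem isUnit_form (h : IsReducedCompact T J P) {κ : ℝ} (hκ : 0 < κ) :
    IsUnit (T + J ∘L (1 - P) + κ • (J ∘L P)) := by
  obtain ⟨c, hc, hcoer⟩ := h.coercive
  have hm : 0 < min 1 κ * c := mul_pos (lt_min one_pos hκ) hc
  refine isUnit_of_forall_le_norm_inner_map (c := ⟨min 1 κ * c, hm.le⟩) _ hm fun v => ?_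
  have h1 : (inner ℂ v ((T + J ∘L (1 - P) + κ • (J ∘L P) : V →L[ℂ] V) v)).re =
      (inner ℂ v (T v)).re + (inner ℂ (v - P v) (J (v - P v))).re +
        κ * (inner ℂ (P v) (J (P v))).re := by
    have h2 : inner ℂ v (J (P v)) = inner ℂ (P v) (J (P v)) := by
      rw [← h.inner_J (P v), h.J_P, h.P_P]
    have h3 : inner ℂ v (J (v - P v)) = inner ℂ (v - P v) (J (v - P v)) := by
      have := h.inner_J_eq v
      rw [← h2] at this
      rw [map_sub, inner_sub_right, this, map_sub]
      ring
    simp only [add_apply, smul_apply, comp_apply, sub_apply, one_apply_eq_self, inner_add_right,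
      inner_smul_right_eq_smul]
    rw [h2, h3]
    simp
  have h4 := congrArg Complex.re (h.inner_J_eq v)
  rw [Complex.add_re] at h4
  have h5 := h.nonneg_J (v - P v)
  have h6 := h.nonneg_J (P v)
  have h7 := h.nonneg_T v
  have h8 := hcoer v
  have hm1 : min 1 κ ≤ 1 := min_le_left _ _
  have hm2 : min 1 κ ≤ κ := min_le_right _ _
  have hm0 : 0 ≤ min 1 κ := (lt_min one_pos hκ).le
  calc ‖v‖ ^ 2 * (min 1 κ * c) = min 1 κ * (c * ‖v‖ ^ 2) := by ring
    _ ≤ min 1 κ * ((inner ℂ v (T v)).re + (inner ℂ v (J v)).re) := by gcongr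
    _ = min 1 κ * (inner ℂ v (T v)).re + min 1 κ * (inner ℂ (v - P v) (J (v - P v))).re +
        min 1 κ * (inner ℂ (P v) (J (P v))).re := by rw [h4]; ring
    _ ≤ 1 * (inner ℂ v (T v)).re + 1 * (inner ℂ (v - P v) (J (v - P v))).re +
        κ * (inner ℂ (P v) (J (P v))).re := by gcongr
    _ = (inner ℂ v ((T + J ∘L (1 - P) + κ • (J ∘L P) : V →L[ℂ] V) v)).re := by rw [h1]; ring
    _ ≤ ‖inner ℂ v ((T + J ∘L (1 - P) + κ • (J ∘L P) : V →L[ℂ] V) v)‖ := Complex.re_le_norm _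
    _ = _ := norm_inner_symm _ _

/-- The form of `isUnit_form` with the opposite sign on the kernel of `T`; the change of sign is the
action of the reflection `1 - 2 P†`. -/
theorem isUnit_signed_form (h : IsReducedCompact T J P) {κ : ℝ} (hκ : 0 < κ) :
    IsUnit (T + J ∘L (1 - P) - κ • (J ∘L P)) := by
  set R : V →L[ℂ] V := 1 - (2 : ℝ) • adjoint P with hR
  have hPP : adjoint P * adjoint P = adjoint P := by
    refine ContinuousLinearMap.ext fun v => ext_inner_left ℂ fun w => ?_
    change inner ℂ w (adjoint P (adjoint P v)) = _
    rw [adjoint_inner_right, adjoint_inner_right, adjoint_inner_right, h.P_P]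
  -- `R` is the reflection that changes the sign on the range of `P†`
  have hRR : R * R = 1 := by
    refine ContinuousLinearMap.ext fun v => ?_
    have h1 : adjoint P (adjoint P v) = adjoint P v := DFunLike.congr_fun hPP v
    change R (R v) = v
    simp only [hR, sub_apply, smul_apply, one_apply_eq_self, map_sub, map_smul_of_tower, h1]
    module
  have hRu : IsUnit R := ⟨⟨R, R, hRR, hRR⟩, rfl⟩
  have hfac : T + J ∘L (1 - P) - κ • (J ∘L P) = R * (T + J ∘L (1 - P) + κ • (J ∘L P)) := by
    refine ContinuousLinearMap.ext fun v => ?_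
    have h1 : adjoint P (T v) = 0 := ext_inner_left ℂ fun w => by
      rw [adjoint_inner_right, ← h.inner_T, h.T_P, inner_zero_left, inner_zero_right]
    have h2 : ∀ v, adjoint P (J v) = J (P v) := fun v => ext_inner_left ℂ fun w => by
      rw [adjoint_inner_right, ← h.inner_J, h.J_P]
    change _ = R ((T + J ∘L (1 - P) + κ • (J ∘L P) : V →L[ℂ] V) v)
    simp only [hR, add_apply, sub_apply, smul_apply, comp_apply, one_apply_eq_self,
      map_add, map_sub, map_smul_of_tower, h1, h2, h.P_P]
    module
  rw [hfac]
  exact hRu.mul (h.isUnit_form hκ)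

theorem finiteDimensional_ker (h : IsReducedCompact T J P) {κ : ℝ} (hκ : 0 < κ) :
    FiniteDimensional ℂ (LinearMap.ker ((T - κ • J : V →L[ℂ] V) : V →ₗ[ℂ] V)) := by
  have h1 : T - κ • J = (T + J ∘L (1 - P) - κ • (J ∘L P)) -
      (((1 + κ : ℝ) : ℂ) • (J ∘L (1 - P))) := by
    refine ContinuousLinearMap.ext fun v => ?_
    simp only [add_apply, sub_apply, smul_apply, comp_apply, one_apply_eq_self, map_sub,
      Complex.coe_smul]
    module
  rw [h1]
  exact finiteDimensional_ker_sub_of_isCompactOperator (h.isUnit_signed_form hκ)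
    (h.compact.smul _)

/-- If the frame `e₀` spans the eigenspace, the finite rank modification of `T - κ J` used in the
reduction is invertible. -/
theorem isUnit_modified (h : IsReducedCompact T J P) {ι : Type*} [Fintype ι] {κ : ℝ} (hκ : 0 < κ)
    {e₀ : EuclideanSpace ℂ ι →L[ℂ] V} (he₀ : ∀ w, T (e₀ w) = κ • J (e₀ w))
    (hortho : adjoint e₀ ∘L (J ∘L e₀) = 1) (hker : ∀ v, T v = κ • J v → ∃ w, v = e₀ w) :
    IsUnit (T - κ • J + J ∘L (e₀ ∘L (adjoint e₀ ∘L J))) := by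
  have h1 : T - κ • J + J ∘L (e₀ ∘L (adjoint e₀ ∘L J)) =
      (T + J ∘L (1 - P) - κ • (J ∘L P)) - (((1 + κ : ℝ) : ℂ) • (J ∘L (1 - P)) -
        (J ∘L e₀) ∘L (adjoint e₀ ∘L J)) := by
    refine ContinuousLinearMap.ext fun v => ?_
    simp only [add_apply, sub_apply, smul_apply, comp_apply, one_apply_eq_self, map_sub,
      Complex.coe_smul]
    module
  have hinj := fun v hv => modified_pencil_injective h.symm_T h.symm_J he₀ hortho hker (v := v) hv
  rw [h1] at hinj ⊢
  refine isUnit_sub_of_isCompactOperator (h.isUnit_signed_form hκ) ?_ hinj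
  refine IsCompactOperator.sub (h.compact.smul _) ?_
  exact (isCompactOperator_of_locallyCompactSpace_rng (J ∘L e₀)).comp_clm (adjoint e₀ ∘L J)

/-- On the `J`-orthogonal complement of its kernel, `T` is bounded from below. -/
theorem isUnit_add_kernel_form (h : IsReducedCompact T J P) : IsUnit (T + J ∘L P) := by
  have h1 : T + J ∘L P = (T + J ∘L (1 - P) + (1 : ℝ) • (J ∘L P)) - J ∘L (1 - P) := by
    refine ContinuousLinearMap.ext fun v => ?_
    simp only [add_apply, sub_apply, smul_apply, comp_apply, one_apply_eq_self, map_sub]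
    module
  have hinj : ∀ v, (T + J ∘L P) v = 0 → v = 0 := by
    intro v hv
    rw [add_apply, comp_apply] at hv
    have h2 : P v = 0 := by
      by_contra hne
      have h3 : inner ℂ (P v) (J (P v)) = 0 := by
        have := congrArg (inner ℂ (P v)) hv
        rwa [inner_add_right, ← h.inner_T, h.T_P, inner_zero_left, zero_add,
          inner_zero_right] at this
      have h4 := h.pos_J _ hne
      rw [h3] at h4
      simp at h4
    rw [h2, map_zero, add_zero] at hv
    rw [← h.P_eq v hv, h2]
  rw [h1] at hinj ⊢
  exact isUnit_sub_of_isCompactOperator (h.isUnit_form one_pos) h.compact hinj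

end IsReducedCompact

end Fredholm

/-! ### Eigenvalue branches of a pencil with a compact reduced part -/

section Local

open ContinuousLinearMap

variable {V : Type*} [NormedAddCommGroup V] [InnerProductSpace ℂ V] [CompleteSpace V]

/-- A finite-dimensional subspace has a basis orthonormal with respect to a positive form. -/
theorem exists_orthonormal_of_form {J : V →L[ℂ] V} (hJ : IsSelfAdjoint J)
    (hpos : ∀ v, v ≠ 0 → 0 < (inner ℂ v (J v)).re) (N : Submodule ℂ V) [FiniteDimensional ℂ N]
    {n : ℕ} (hn : Module.finrank ℂ N = n) : ∃ v : Fin n → V,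
      (∀ i, v i ∈ N) ∧ (∀ i j, inner ℂ (v i) (J (v j)) = if i = j then 1 else 0) ∧
      N ≤ Submodule.span ℂ (range v) := by
  have hJ0 : ∀ v v', inner ℂ (J v) v' = inner ℂ v (J v') := hJ.isSymmetric
  set e : N →L[ℂ] V := N.subtypeL
  set G : N →L[ℂ] N := adjoint e ∘L (J ∘L e) with hG
  have hGin : ∀ x y : N, inner ℂ x (G y) = inner ℂ (x : V) (J y) := fun x y => by
    rw [hG, comp_apply, adjoint_inner_right]
    rfl
  have hGs : (G : N →ₗ[ℂ] N).IsSymmetric := fun x y => by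
    change inner ℂ (G x) y = inner ℂ x (G y)
    rw [← inner_conj_symm, hGin, hGin, inner_conj_symm, hJ0]
  set b := hGs.eigenvectorBasis hn with hb
  set g := hGs.eigenvalues hn with hg
  have hGb : ∀ i, G (b i) = (g i : ℂ) • b i := fun i =>
    hGs.apply_eigenvectorBasis hn i
  have hin : ∀ i j, inner ℂ (b i : V) (J (b j)) = if i = j then (g j : ℂ) else 0 := by
    intro i j
    rw [← hGin, hGb, inner_smul_right, orthonormal_iff_ite.1 b.orthonormal]
    simp
  have hgpos : ∀ i, 0 < g i := fun i => by
    have h1 := hpos (b i) fun h0 => b.orthonormal.ne_zero i (Subtype.ext h0)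
    rw [hin, if_pos rfl] at h1
    exact h1
  have hsq : ∀ i, (Real.sqrt (g i))⁻¹ * ((Real.sqrt (g i))⁻¹ * g i) = 1 := fun i => by
    have h0 := Real.sqrt_pos.2 (hgpos i)
    have h1 := Real.mul_self_sqrt (hgpos i).le
    nth_rewrite 3 [← h1]
    field_simp
  refine ⟨fun i => (((Real.sqrt (g i))⁻¹ : ℝ) : ℂ) • (b i : V), fun i => N.smul_mem _ (b i).2,
    fun i j => ?_, fun x hx => ?_⟩
  · rw [map_smul, inner_smul_left, inner_smul_right, hin, Complex.conj_ofReal]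
    split_ifs with hij
    · subst hij
      exact_mod_cast hsq i
    · simp
  · have h1 := congrArg (Subtype.val) (b.sum_repr ⟨x, hx⟩)
    rw [Submodule.coe_sum] at h1
    change _ = x at h1
    rw [← h1]
    refine Submodule.sum_mem _ fun i _ => ?_
    have h2 : (b i : V) =
        (Real.sqrt (g i) : ℂ) • ((((Real.sqrt (g i))⁻¹ : ℝ) : ℂ) • (b i : V)) := by
      rw [smul_smul, ← Complex.ofReal_mul, mul_inv_cancel₀ (Real.sqrt_pos.2 (hgpos i)).ne',
        Complex.ofReal_one, one_smul]
    rw [Submodule.coe_smul, h2]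
    exact Submodule.smul_mem _ _ (Submodule.smul_mem _ _ (Submodule.subset_span ⟨i, rfl⟩))

/-- Near a positive eigenvalue `κ` of multiplicity `n`, the spectrum of the pencil `T x - μ J x` is
given by `n` eigenvalue branches of class `C^r`; each choice of an orthonormal basis `v` of the
eigenspace determines the derivatives of these branches. -/
theorem IsReducedCompact.exists_branches {ι : Type} [Fintype ι] [DecidableEq ι]
    {r : WithTop ℕ∞} (hr : r = 1 ∨ r = ω)
    {T J : ℝ → V →L[ℂ] V} {P : V →L[ℂ] V} {x₀ κ : ℝ} (h : IsReducedCompact (T x₀) (J x₀) P)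
    (hκ : 0 < κ) (hT : ContDiffAt ℝ r T x₀) (hJ : ContDiffAt ℝ r J x₀)
    (hTs : ∀ᶠ x in 𝓝 x₀, IsSelfAdjoint (T x)) (hJs : ∀ᶠ x in 𝓝 x₀, IsSelfAdjoint (J x))
    (v : ι → V) (hv : ∀ i, T x₀ (v i) = κ • J x₀ (v i))
    (hortho : ∀ i j, inner ℂ (v i) (J x₀ (v j)) = if i = j then 1 else 0)
    (hspan : ∀ u, T x₀ u = κ • J x₀ u → u ∈ Submodule.span ℂ (range v)) :
    ∃ ζ : ι → ℝ → ℝ, (∀ i, ContDiffAt ℝ r (ζ i) x₀) ∧ (∀ i, ζ i x₀ = κ) ∧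
      (∃ ε > 0, ∀ᶠ x in 𝓝 x₀, ∃ w : ι → V,
        (∀ i j, i ≠ j → inner ℂ (w i) (J x (w j)) = 0) ∧ (∀ i, inner ℂ (w i) (J x (w i)) = 1) ∧
        (∀ i, T x (w i) = ζ i x • J x (w i)) ∧
        ∀ μ : ℝ, |μ - κ| < ε → ∀ v, T x v = μ • J x v →
          v ∈ Submodule.span ℂ (w '' {i | ζ i x = μ})) ∧
      ∃ d : ι → ℝ, (∀ i, HasDerivAt (ζ i) (d i) x₀) ∧
        (Matrix.of fun i j => inner ℂ (v i) ((deriv T x₀ - κ • deriv J x₀) (v j))).charpoly =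
          ∏ i, (Polynomial.X - Polynomial.C (d i : ℂ)) := by
  have he₀ : ∀ w, T x₀ (frame v w) = κ • J x₀ (frame v w) := fun w => by
    simp only [frame_apply, map_sum, map_smul, hv, Finset.smul_sum]
    exact Finset.sum_congr rfl fun i _ => smul_comm _ _ _
  have ho := adjoint_frame_comp_frame v (J x₀) hortho
  obtain ⟨ζ, h1, h2, h3, d, h4, h5⟩ := exists_pencil_eigenvalues hr hT hJ hTs hJs (frame v) he₀ ho
    (h.isUnit_modified hκ he₀ ho fun u hu => by
      obtain ⟨c, hc⟩ := (Submodule.mem_span_range_iff_exists_fun ℂ).1 (hspan u hu)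
      exact ⟨WithLp.toLp 2 c, by rw [frame_apply, ← hc]⟩)
  refine ⟨ζ, h1, h2, h3, d, h4, ?_⟩
  rw [← h5, ← LinearMap.charpoly_toMatrix _ (EuclideanSpace.basisFun ι ℂ).toBasis]
  congr 1
  ext i j
  rw [LinearMap.toMatrix_apply, Matrix.of_apply]
  simp only [OrthonormalBasis.coe_toBasis, OrthonormalBasis.coe_toBasis_repr_apply,
    EuclideanSpace.basisFun_repr, EuclideanSpace.basisFun_apply, ContinuousLinearMap.coe_coe]
  rw [comp_apply, comp_apply, adjoint_frame_apply]
  congr 2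
  rw [frame_apply, Finset.sum_eq_single j] <;> simp +contextual

end Local

/-! ### The graph space as a Hilbert space -/

section GraphHilbert

variable {H₀ H₁ : Type*} [NormedAddCommGroup H₀] [InnerProductSpace ℂ H₀]
  [NormedAddCommGroup H₁] [InnerProductSpace ℂ H₁] {V : Submodule ℂ H₀} {B : V →ₗ[ℂ] H₁}

theorem GraphSpace.norm_eq (x : GraphSpace V B) : ‖x‖ = ‖GraphSpace.toGraph V B x‖ := rfl

/-- The scalar product `⟪x, y⟫ + ⟪B x, B y⟫` of the graph norm. -/
noncomputable instance : InnerProductSpace ℂ (GraphSpace V B) where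
  inner x y := inner ℂ (GraphSpace.toGraph V B x) (GraphSpace.toGraph V B y)
  norm_sq_eq_re_inner x := by
    rw [GraphSpace.norm_eq]
    exact norm_sq_eq_re_inner _
  conj_inner_symm x y := inner_conj_symm _ _
  add_left x y z := by rw [map_add, inner_add_left]
  smul_left x y c := by rw [map_smul, inner_smul_left]

theorem GraphSpace.norm_sq_eq (x : GraphSpace V B) :
    ‖x‖ ^ 2 = ‖(GraphSpace.toDomain V B x : H₀)‖ ^ 2 + ‖B (GraphSpace.toDomain V B x)‖ ^ 2 := by
  rw [GraphSpace.norm_eq, WithLp.prod_norm_sq_eq_of_L2]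
  rfl

theorem GraphSpace.norm_le_add (x : GraphSpace V B) :
    ‖x‖ ≤ ‖(GraphSpace.toDomain V B x : H₀)‖ + ‖B (GraphSpace.toDomain V B x)‖ := by
  refine abs_le_of_sq_le_sq' ?_ (by positivity) |>.2
  rw [GraphSpace.norm_sq_eq]
  nlinarith [norm_nonneg (GraphSpace.toDomain V B x : H₀),
    norm_nonneg (B (GraphSpace.toDomain V B x))]

theorem GraphSpace.norm_toDomain_le (x : GraphSpace V B) :
    ‖(GraphSpace.toDomain V B x : H₀)‖ ≤ ‖x‖ := by
  refine abs_le_of_sq_le_sq' ?_ (by positivity) |>.2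
  rw [GraphSpace.norm_sq_eq]
  nlinarith [sq_nonneg ‖B (GraphSpace.toDomain V B x)‖]

theorem GraphSpace.norm_apply_le (x : GraphSpace V B) :
    ‖B (GraphSpace.toDomain V B x)‖ ≤ ‖x‖ := by
  refine abs_le_of_sq_le_sq' ?_ (by positivity) |>.2
  rw [GraphSpace.norm_sq_eq]
  nlinarith [sq_nonneg ‖(GraphSpace.toDomain V B x : H₀)‖]

theorem GraphSpace.completeSpace [CompleteSpace H₀] [CompleteSpace H₁]
    (hB : LinearPMap.IsClosed (LinearPMap.mk V B)) : CompleteSpace (GraphSpace V B) := by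
  have hiso : Isometry (GraphSpace.toGraph V B) :=
    AddMonoidHomClass.isometry_of_norm _ fun x => rfl
  refine hiso.isUniformInducing.completeSpace (IsClosed.isComplete ?_)
  have hrange : range (GraphSpace.toGraph V B) =
      WithLp.prodContinuousLinearEquiv 2 ℂ H₀ H₁ ⁻¹'
        ((LinearPMap.mk V B).graph : Set (H₀ × H₁)) := by
    ext p
    constructor
    · rintro ⟨x, rfl⟩
      rw [mem_preimage, SetLike.mem_coe, LinearPMap.mem_graph_iff]
      exact ⟨GraphSpace.toDomain V B x, rfl, rfl⟩
    · intro hp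
      rw [mem_preimage, SetLike.mem_coe, LinearPMap.mem_graph_iff] at hp
      obtain ⟨y, h1, h2⟩ := hp
      refine ⟨(GraphSpace.toDomain V B).symm y, ?_⟩
      apply (WithLp.prodContinuousLinearEquiv 2 ℂ H₀ H₁).injective
      exact Prod.ext h1 h2
  rw [hrange]
  exact hB.preimage (WithLp.prodContinuousLinearEquiv 2 ℂ H₀ H₁).continuous

end GraphHilbert

/-- A Hilbert space is isomorphic to the space of its continuous antilinear functionals. -/
theorem exists_antidual_equiv (V : Type*) [NormedAddCommGroup V] [InnerProductSpace ℂ V]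
    [CompleteSpace V] : ∃ R : V ≃L[ℂ] (V →L⋆[ℂ] ℂ), ∀ u v, R u v = inner ℂ v u := by
  refine ⟨ContinuousLinearEquiv.ofBijective (innerSLFlip ℂ) ?_ ?_, fun u v => ?_⟩
  · rw [LinearMap.ker_eq_bot']
    intro u hu
    exact ext_inner_left ℂ fun v => by
      simpa using DFunLike.congr_fun hu v
  · rw [LinearMap.range_eq_top]
    intro φ
    let ψ : V →L[ℂ] ℂ := (starL ℂ : ℂ ≃L⋆[ℂ] ℂ).toContinuousLinearMap.comp φ
    refine ⟨(InnerProductSpace.toDual ℂ V).symm ψ, ContinuousLinearMap.ext fun v => ?_⟩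
    change inner ℂ v ((InnerProductSpace.toDual ℂ V).symm ψ) = φ v
    rw [← inner_conj_symm, InnerProductSpace.toDual_symm_apply]
    exact Complex.conj_conj _
  · rfl

namespace OperatorFamily

variable {H₀ H₁ : Type*} [NormedAddCommGroup H₀] [InnerProductSpace ℂ H₀]
  [NormedAddCommGroup H₁] [InnerProductSpace ℂ H₁] (F : OperatorFamily ℝ H₀ H₁)

/-! ### The pencil of a family -/

/-- The embedding `V → H₀`. -/
noncomputable def inclL : F.VSpace →L[ℂ] H₀ :=
  LinearMap.mkContinuous (F.V.subtype ∘ₗ (GraphSpace.toDomain F.V (F.A F.ref)).toLinearMap) 1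
    fun x => by
      rw [one_mul]
      exact GraphSpace.norm_toDomain_le x

theorem incl_injective : Function.Injective F.incl := fun _ _ h =>
  (GraphSpace.toDomain F.V (F.A F.ref)).injective (Subtype.ext h)

/-- Operators on the Hilbert space `V` representing the forms `⟨A_χ u, A_χ v⟩_{1,χ}` and
`⟨u, v⟩_{0,χ}`; the eigenvalue problem for `T_χ` becomes that of the pencil `T χ - μ J χ` with
`J χ = J' χ ∘ inclL`. -/
structure IsPencil (T : ℝ → F.VSpace →L[ℂ] F.VSpace) (J' : ℝ → H₀ →L[ℂ] F.VSpace) : Prop where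
  inner_T : ∀ χ ∈ F.params, ∀ u v, inner ℂ v (T χ u) = F.sp₁ χ (F.app χ u) (F.app χ v)
  inner_J : ∀ χ ∈ F.params, ∀ u v, inner ℂ v (J' χ u) = F.sp₀ χ u (F.incl v)

theorem completeSpace_VSpace [CompleteSpace H₀] [CompleteSpace H₁] : CompleteSpace F.VSpace :=
  GraphSpace.completeSpace (F.closed_A F.ref F.ref_mem)

theorem exists_isPencil [CompleteSpace H₀] [CompleteSpace H₁] {r : WithTop ℕ∞}
    (hF : F.IsOfClass r) : ∃ T J', F.IsPencil T J' ∧ ContDiffOn ℝ r T F.params ∧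
      ContDiffOn ℝ r J' F.params := by
  have := F.completeSpace_VSpace
  obtain ⟨⟨𝒯, h𝒯, h𝒯C⟩, 𝒥, h𝒥, h𝒥C⟩ := hF
  obtain ⟨R, hR⟩ := exists_antidual_equiv F.VSpace
  set S : F.VAntidual →L[ℂ] F.VSpace := R.symm.toContinuousLinearMap with hS
  have hSR : ∀ φ v, inner ℂ v (S φ) = φ v := fun φ v => by
    rw [← hR]
    exact DFunLike.congr_fun (R.apply_symm_apply φ) v
  refine ⟨fun χ => S ∘L 𝒯 χ, fun χ => S ∘L 𝒥 χ, ⟨fun χ hχ u v => ?_, fun χ hχ u v => ?_⟩, ?_, ?_⟩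
  · rw [ContinuousLinearMap.comp_apply, hSR, h𝒯 χ hχ]
  · rw [ContinuousLinearMap.comp_apply, hSR, h𝒥 χ hχ]
  · exact ((isBoundedBilinearMap_comp_real F.VSpace F.VAntidual F.VSpace).contDiff.comp_contDiffOn
      (contDiffOn_const (c := S) |>.prodMk h𝒯C))
  · exact ((isBoundedBilinearMap_comp_real H₀ F.VAntidual F.VSpace).contDiff.comp_contDiffOn
      (contDiffOn_const (c := S) |>.prodMk h𝒥C))

namespace IsPencil

variable {F} {T : ℝ → F.VSpace →L[ℂ] F.VSpace} {J' : ℝ → H₀ →L[ℂ] F.VSpace}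

theorem inner_J_incl (h : F.IsPencil T J') {χ : ℝ} (hχ : χ ∈ F.params) (u v : F.VSpace) :
    inner ℂ v ((J' χ ∘L F.inclL) u) = F.sp₀ χ (F.incl u) (F.incl v) := h.inner_J χ hχ _ v

theorem symm_T [CompleteSpace F.VSpace] (h : F.IsPencil T J') {χ : ℝ} (hχ : χ ∈ F.params) :
    IsSelfAdjoint (T χ) := by
  rw [ContinuousLinearMap.isSelfAdjoint_iff_isSymmetric]
  intro u v
  change inner ℂ (T χ u) v = inner ℂ u (T χ v)
  rw [← inner_conj_symm, h.inner_T χ hχ, h.inner_T χ hχ, F.sp₁_conj]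

theorem symm_J [CompleteSpace F.VSpace] (h : F.IsPencil T J') {χ : ℝ} (hχ : χ ∈ F.params) :
    IsSelfAdjoint (J' χ ∘L F.inclL) := by
  rw [ContinuousLinearMap.isSelfAdjoint_iff_isSymmetric]
  intro u v
  change inner ℂ ((J' χ ∘L F.inclL) u) v = inner ℂ u ((J' χ ∘L F.inclL) v)
  rw [← inner_conj_symm, h.inner_J_incl hχ, h.inner_J_incl hχ, F.sp₀_conj]

/-- The eigenvalue problem for `A_χ^* A_χ` in its weak form. -/
theorem mem_eigenspace (h : F.IsPencil T J') {χ : ℝ} (hχ : χ ∈ F.params) (μ : ℝ) (u : H₀) :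
    u ∈ F.eigenspace χ μ ↔ ∃ x, F.incl x = u ∧ T χ x = μ • (J' χ ∘L F.inclL) x := by
  have key : ∀ x : F.VSpace, T χ x = μ • (J' χ ∘L F.inclL) x ↔
      ∀ y : F.VSpace,
        F.sp₁ χ (F.app χ y) (F.app χ x) = F.sp₀ χ (F.incl y) ((μ : ℂ) • F.incl x) := by
    intro x
    constructor
    · intro hx y
      have h1 := congrArg (inner ℂ y) hx
      rw [h.inner_T χ hχ, inner_smul_right_eq_smul, h.inner_J_incl hχ] at h1
      rw [← F.sp₁_conj, h1, F.sp₀_smul_right, ← F.sp₀_conj χ (F.incl x)]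
      simp
    · intro hx
      refine ext_inner_left ℂ fun y => ?_
      rw [h.inner_T χ hχ, inner_smul_right_eq_smul, h.inner_J_incl hχ, ← F.sp₁_conj, hx y,
        F.sp₀_smul_right, map_mul, F.sp₀_conj]
      simp
  constructor
  · rintro ⟨x, hx, hx2⟩
    exact ⟨(GraphSpace.toDomain F.V (F.A F.ref)).symm x, hx, (key _).2 fun y => by
      have := hx2 (GraphSpace.toDomain F.V (F.A F.ref) y)
      change _ = F.sp₀ χ _ ((μ : ℂ) • u) at this
      rw [← show (x : H₀) = u from hx] at this
      exact this⟩
  · rintro ⟨x, rfl, hx⟩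
    exact ⟨GraphSpace.toDomain F.V (F.A F.ref) x, rfl, fun y =>
      (key _).1 hx ((GraphSpace.toDomain F.V (F.A F.ref)).symm y)⟩

theorem T_eq_zero_iff (h : F.IsPencil T J') {χ : ℝ} (hχ : χ ∈ F.params) (x : F.VSpace) :
    T χ x = 0 ↔ F.app χ x = 0 := by
  constructor
  · intro hx
    have h1 := h.inner_T χ hχ x x
    rw [hx, inner_zero_right] at h1
    exact (F.ip₁ χ).definite _ h1.symm
  · intro hx
    refine ext_inner_left ℂ fun y => ?_
    rw [h.inner_T χ hχ, hx, inner_zero_right, ← F.sp₁_conj, F.sp₁_zero_right, map_zero]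

theorem mem_kerA (h : F.IsPencil T J') {χ : ℝ} (hχ : χ ∈ F.params) (u : H₀) :
    u ∈ F.kerA χ ↔ ∃ x, F.incl x = u ∧ T χ x = 0 := by
  simp only [h.T_eq_zero_iff hχ]
  constructor
  · rintro ⟨x, hx, rfl⟩
    exact ⟨(GraphSpace.toDomain F.V (F.A F.ref)).symm x, rfl, hx⟩
  · rintro ⟨x, rfl, hx⟩
    exact ⟨GraphSpace.toDomain F.V (F.A F.ref) x, hx, rfl⟩

theorem nonneg_T (h : F.IsPencil T J') {χ : ℝ} (hχ : χ ∈ F.params) (v : F.VSpace) :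
    0 ≤ (inner ℂ v (T χ v)).re := by
  rw [h.inner_T χ hχ]
  exact (F.ip₁ χ).re_inner_nonneg _

theorem pos_J (h : F.IsPencil T J') {χ : ℝ} (hχ : χ ∈ F.params) (v : F.VSpace) (hv : v ≠ 0) :
    0 < (inner ℂ v ((J' χ ∘L F.inclL) v)).re := by
  obtain ⟨c, hc, C, _, hcC⟩ := F.ip₀_equiv χ hχ
  rw [h.inner_J_incl hχ]
  refine lt_of_lt_of_le ?_ (hcC _).1
  have : F.incl v ≠ 0 := fun h0 => hv (F.incl_injective (h0.trans F.inclL.map_zero.symm))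
  positivity

theorem coercive (h : F.IsPencil T J') {χ : ℝ} (hχ : χ ∈ F.params) :
    ∃ c > 0, ∀ v, c * ‖v‖ ^ 2 ≤
      (inner ℂ v (T χ v)).re + (inner ℂ v ((J' χ ∘L F.inclL) v)).re := by
  obtain ⟨a, ha, _, _, hab⟩ := F.ip₀_equiv χ hχ
  obtain ⟨b, hb, _, _, hbb⟩ := F.ip₁_equiv χ hχ
  obtain ⟨g, hg, _, _, hgg⟩ := F.graph_equiv χ hχ
  refine ⟨min a b * g ^ 2 / 2, by positivity, fun v => ?_⟩
  rw [h.inner_T χ hχ, h.inner_J_incl hχ]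
  have h1 : b * ‖F.app χ v‖ ^ 2 ≤ (F.sp₁ χ (F.app χ v) (F.app χ v)).re := (hbb _).1
  have h2 : a * ‖F.incl v‖ ^ 2 ≤ (F.sp₀ χ (F.incl v) (F.incl v)).re := (hab _).1
  have h3 : g * (‖F.incl v‖ + ‖F.app F.ref v‖) ≤ ‖F.incl v‖ + ‖F.app χ v‖ :=
    (hgg (GraphSpace.toDomain F.V (F.A F.ref) v)).1
  have h4 : ‖v‖ ≤ ‖F.incl v‖ + ‖F.app F.ref v‖ := GraphSpace.norm_le_add v
  have h5 : g * ‖v‖ ≤ ‖F.incl v‖ + ‖F.app χ v‖ := (mul_le_mul_of_nonneg_left h4 hg.le).trans h3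
  have h6 : (g * ‖v‖) ^ 2 ≤ (‖F.incl v‖ + ‖F.app χ v‖) ^ 2 :=
    pow_le_pow_left₀ (by positivity) h5 2
  have h7 : (‖F.incl v‖ + ‖F.app χ v‖) ^ 2 ≤ 2 * (‖F.incl v‖ ^ 2 + ‖F.app χ v‖ ^ 2) := by
    nlinarith [sq_nonneg (‖F.incl v‖ - ‖F.app χ v‖)]
  have hm : 0 < min a b := lt_min ha hb
  calc min a b * g ^ 2 / 2 * ‖v‖ ^ 2 = min a b / 2 * (g * ‖v‖) ^ 2 := by ring
    _ ≤ min a b / 2 * (2 * (‖F.incl v‖ ^ 2 + ‖F.app χ v‖ ^ 2)) := by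
      gcongr
      exact h6.trans h7
    _ = min a b * ‖F.app χ v‖ ^ 2 + min a b * ‖F.incl v‖ ^ 2 := by ring
    _ ≤ b * ‖F.app χ v‖ ^ 2 + a * ‖F.incl v‖ ^ 2 := by
      gcongr
      · exact min_le_right _ _
      · exact min_le_left _ _
    _ ≤ _ := add_le_add h1 h2

/-- The compactness hypothesis on the reduced operator, in terms of the pencil. -/
theorem exists_isReducedCompact [CompleteSpace F.VSpace] (h : F.IsPencil T J') {χ : ℝ}
    (hχ : χ ∈ F.params) : ∃ P, IsReducedCompact (T χ) (J' χ ∘L F.inclL) P := by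
  obtain ⟨c, hc, hcoer⟩ := h.coercive hχ
  obtain ⟨P, hTP, hPeq, hJP⟩ := exists_kernel_projection (h.symm_J hχ) hc (T := T χ)
    fun v hv => by simpa [hv] using hcoer v
  refine ⟨P, h.symm_T hχ, h.symm_J hχ, h.nonneg_T hχ, h.pos_J hχ, ⟨c, hc, hcoer⟩, hTP, hPeq, hJP,
    ?_⟩
  obtain ⟨_, _, C, hC, hgC⟩ := F.graph_equiv χ hχ
  -- the identity of `V`, continuous from the reference graph norm to that of `A χ`
  let L : F.VSpace →L[ℂ] GraphSpace F.V (F.A χ) :=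
    LinearMap.mkContinuous ((GraphSpace.toDomain F.V (F.A F.ref)).trans
      (GraphSpace.toDomain F.V (F.A χ)).symm).toLinearMap (C * 2) fun x => by
        refine (GraphSpace.norm_le_add _).trans (((hgC _).2).trans ?_)
        rw [mul_assoc]
        refine mul_le_mul_of_nonneg_left ?_ hC.le
        have h1 := GraphSpace.norm_toDomain_le x
        have h2 := GraphSpace.norm_apply_le x
        change ‖F.incl x‖ + ‖F.app F.ref x‖ ≤ 2 * ‖x‖
        change ‖F.incl x‖ ≤ _ at h1
        change ‖F.app F.ref x‖ ≤ _ at h2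
        linarith
  have hmem : ∀ x, (L ∘L (1 - P)) x ∈ reducedDomain (F.ip₀ χ) F.V (F.A χ) := by
    intro x y hy
    set y' : F.VSpace := (GraphSpace.toDomain F.V (F.A F.ref)).symm y
    have hy' : T χ y' = 0 := (h.T_eq_zero_iff hχ y').2 hy
    change F.sp₀ χ (F.incl (x - P x)) (F.incl y') = 0
    rw [← h.inner_J_incl hχ, map_sub, inner_sub_right, ← hJP, hPeq y' hy', sub_eq_zero]
    exact (h.symm_J hχ).isSymmetric y' x |>.symm
  have hcomp := (F.compact_embedding χ hχ).comp_clm ((L ∘L (1 - P)).codRestrict _ hmem)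
  exact hcomp.clm_comp (J' χ)

end IsPencil

end OperatorFamily

namespace OperatorFamily

variable {H₀ H₁ : Type*} [NormedAddCommGroup H₀] [InnerProductSpace ℂ H₀]
  [NormedAddCommGroup H₁] [InnerProductSpace ℂ H₁] (F : OperatorFamily ℝ H₀ H₁)

/-! ### Eigenvalue branches of a family -/

/-- The vectors `w i` are orthonormal eigenvectors of `T_χ` for the eigenvalues `z i`, and they span
all eigenspaces for eigenvalues at distance less than `ε` from `κ`. -/
structure IsEigenbasisNear {ι : Type} [DecidableEq ι] (χ : ℝ) (z : ι → ℝ) (w : ι → F.VSpace)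
    (κ ε : ℝ) : Prop where
  ortho : ∀ i j, F.sp₀ χ (F.incl (w i)) (F.incl (w j)) = if i = j then 1 else 0
  mem : ∀ i, F.incl (w i) ∈ F.eigenspace χ (z i)
  le_span : ∀ μ, |μ - κ| < ε →
    F.eigenspace χ μ ≤ Submodule.span ℂ ((fun i => F.incl (w i)) '' {i | z i = μ})

variable {F} {T : ℝ → F.VSpace →L[ℂ] F.VSpace} {J' : ℝ → H₀ →L[ℂ] F.VSpace}

theorem IsPencil.eigenspace_eq_map (h : F.IsPencil T J') {χ : ℝ} (hχ : χ ∈ F.params) (μ : ℝ) :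
    F.eigenspace χ μ = (LinearMap.ker ((T χ - μ • (J' χ ∘L F.inclL) : F.VSpace →L[ℂ] F.VSpace) :
      F.VSpace →ₗ[ℂ] F.VSpace)).map (F.inclL : F.VSpace →ₗ[ℂ] H₀) := by
  ext u
  rw [h.mem_eigenspace hχ, Submodule.mem_map]
  refine exists_congr fun x => ?_
  rw [LinearMap.mem_ker, ContinuousLinearMap.coe_coe, sub_apply, sub_eq_zero]
  exact and_comm

theorem IsPencil.finrank_eigenspace (h : F.IsPencil T J') {χ : ℝ} (hχ : χ ∈ F.params) (μ : ℝ) :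
    Module.finrank ℂ (LinearMap.ker ((T χ - μ • (J' χ ∘L F.inclL) : F.VSpace →L[ℂ] F.VSpace) :
      F.VSpace →ₗ[ℂ] F.VSpace)) = Module.finrank ℂ (F.eigenspace χ μ) := by
  rw [h.eigenspace_eq_map hχ]
  exact (Submodule.equivMapOfInjective _ F.incl_injective _).finrank_eq

/-- Near an eigenvalue `κ > 0` of multiplicity `n`, the eigenvalues form `n` branches of class
`C^r`, whose derivatives can be computed in any orthonormal basis of the eigenspace. -/
theorem IsPencil.exists_branches [CompleteSpace F.VSpace] (h : F.IsPencil T J') {r : WithTop ℕ∞}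
    (hr : r = 1 ∨ r = ω) (hT : ContDiffOn ℝ r T F.params) (hJ : ContDiffOn ℝ r J' F.params)
    {x₀ κ : ℝ} (hx₀ : x₀ ∈ F.params) (hκ : 0 < κ) {n : ℕ}
    (hn : Module.finrank ℂ (F.eigenspace x₀ κ) = n) :
    ∃ ζ : Fin n → ℝ → ℝ, (∀ i, ContDiffAt ℝ r (ζ i) x₀) ∧ (∀ i, ζ i x₀ = κ) ∧
      (∃ ε > 0, ∀ᶠ χ in 𝓝 x₀, ∃ w, F.IsEigenbasisNear χ (fun i => ζ i χ) w κ ε) ∧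
      ∃ d : Fin n → ℝ, (∀ i, HasDerivAt (ζ i) (d i) x₀) ∧
        ∀ u : Fin n → F.VSpace, (∀ i, F.incl (u i) ∈ F.eigenspace x₀ κ) →
          (∀ i j, F.sp₀ x₀ (F.incl (u i)) (F.incl (u j)) = if i = j then 1 else 0) →
          (Matrix.of fun i j => inner ℂ (u i)
            ((deriv T x₀ - κ • deriv (fun χ => J' χ ∘L F.inclL) x₀) (u j))).charpoly =
              ∏ i, (Polynomial.X - Polynomial.C (d i : ℂ)) := by
  obtain ⟨P, hP⟩ := h.exists_isReducedCompact hx₀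
  have hnear : F.params ∈ 𝓝 x₀ := F.isOpen_params.mem_nhds hx₀
  have hnear' : ∀ᶠ χ in 𝓝 x₀, χ ∈ F.params := hnear
  have hJc : ContDiffAt ℝ r (fun χ => J' χ ∘L F.inclL) x₀ :=
    (isBoundedBilinearMap_comp_real F.VSpace H₀ F.VSpace).contDiff.contDiffAt.comp x₀
      ((hJ.contDiffAt hnear).prodMk contDiffAt_const)
  have := hP.finiteDimensional_ker hκ
  obtain ⟨v, hvN, hvo, hvs⟩ := exists_orthonormal_of_form hP.symm_J hP.pos_J
    (LinearMap.ker ((T x₀ - κ • (J' x₀ ∘L F.inclL) : F.VSpace →L[ℂ] F.VSpace) :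
      F.VSpace →ₗ[ℂ] F.VSpace)) ((h.finrank_eigenspace hx₀ κ).trans hn)
  have hker : ∀ x, T x₀ x = κ • (J' x₀ ∘L F.inclL) x →
      x ∈ Submodule.span ℂ (range v) := fun x hx => hvs (sub_eq_zero.2 hx)
  obtain ⟨ζ, h1, h2, ⟨ε, hε, h3⟩, d, h4, h5⟩ := hP.exists_branches hr hκ (hT.contDiffAt hnear)
    (J := fun χ => J' χ ∘L F.inclL) hJc (hnear'.mono fun χ hχ => h.symm_T hχ)
    (hnear'.mono fun χ hχ => h.symm_J hχ) v (fun i => sub_eq_zero.1 (hvN i)) hvo hker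
  refine ⟨ζ, h1, h2, ⟨ε, hε, ?_⟩, d, h4, fun u hu huo => ?_⟩
  · filter_upwards [h3, hnear'] with χ ⟨w, hw1, hw2, hw3, hw4⟩ hχ
    refine ⟨w, fun i j => ?_, fun i => ?_, fun μ hμ => ?_⟩
    · rw [← h.inner_J_incl hχ]
      split_ifs with hij
      · rw [hij]
        exact hw2 j
      · exact hw1 j i (Ne.symm hij)
    · exact (h.mem_eigenspace hχ _ _).2 ⟨w i, rfl, hw3 i⟩
    · intro y hy
      obtain ⟨x, rfl, hx⟩ := (h.mem_eigenspace hχ _ _).1 hy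
      have h6 := Submodule.mem_map_of_mem (f := (F.inclL : F.VSpace →ₗ[ℂ] H₀)) (hw4 μ hμ x hx)
      rwa [Submodule.map_span, image_image] at h6
  · -- `u` and `v` differ by a unitary matrix
    have huv : ∀ j, ∃ c : Fin n → ℂ, ∑ k, c k • v k = u j := fun j => by
      obtain ⟨x, hx, hx2⟩ := (h.mem_eigenspace hx₀ _ _).1 (hu j)
      rw [← F.incl_injective hx]
      exact (Submodule.mem_span_range_iff_exists_fun ℂ).1 (hker x hx2)
    choose c hc using huv
    set C : Matrix (Fin n) (Fin n) ℂ := Matrix.of fun k j => c j k with hC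
    have hform : ∀ D : F.VSpace →L[ℂ] F.VSpace, (Matrix.of fun i j => inner ℂ (u i) (D (u j))) =
        C.conjTranspose * (Matrix.of fun i j => inner ℂ (v i) (D (v j))) * C := fun D => by
      ext i j
      rw [Matrix.mul_assoc, Matrix.of_apply, ← hc i, ← hc j, sum_inner, Matrix.mul_apply]
      refine Finset.sum_congr rfl fun k _ => ?_
      rw [inner_smul_left, map_sum, inner_sum, Matrix.mul_apply]
      congr 1
      refine Finset.sum_congr rfl fun l _ => ?_
      rw [map_smul, inner_smul_right, mul_comm]
      rfl
    have hunit : C.conjTranspose * C = 1 := by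
      have h6 := hform (J' x₀ ∘L F.inclL)
      have h7 : (Matrix.of fun i j => inner ℂ (v i) ((J' x₀ ∘L F.inclL) (v j))) = 1 := by
        ext i j
        rw [Matrix.of_apply, hvo, Matrix.one_apply]
      rw [h7, Matrix.mul_one] at h6
      rw [← h6]
      ext i j
      rw [Matrix.of_apply, h.inner_J_incl hx₀, huo, Matrix.one_apply]
      simp only [eq_comm]
    rw [hform, ← h5, Matrix.mul_assoc, Matrix.charpoly_mul_comm, Matrix.mul_assoc,
      mul_eq_one_comm.1 hunit, Matrix.mul_one]

end OperatorFamily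

namespace OperatorFamily

variable {H₀ H₁ : Type*} [NormedAddCommGroup H₀] [InnerProductSpace ℂ H₀]
  [NormedAddCommGroup H₁] [InnerProductSpace ℂ H₁] (F : OperatorFamily ℝ H₀ H₁)

/-! ### Counting eigenvalues -/

/-- The span of the eigenspaces of `T_χ` for eigenvalues in `S`. -/
noncomputable def spectralSum (χ : ℝ) (S : Set ℝ) : Submodule ℂ H₀ := ⨆ μ ∈ S, F.eigenspace χ μ

/-- The number of eigenvalues of `T_χ` in `S`, counted with multiplicity; it is `⊤` for all infinite
cardinalities. -/
noncomputable def count (χ : ℝ) (S : Set ℝ) : ℕ∞ :=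
  Cardinal.toENat (Module.rank ℂ (F.spectralSum χ S))

theorem spectralSum_mono (χ : ℝ) {S S' : Set ℝ} (h : S ⊆ S') :
    F.spectralSum χ S ≤ F.spectralSum χ S' := biSup_mono h

theorem count_mono (χ : ℝ) {S S' : Set ℝ} (h : S ⊆ S') : F.count χ S ≤ F.count χ S' :=
  OrderHomClass.mono Cardinal.toENat (Submodule.rank_mono (F.spectralSum_mono χ h))

theorem count_eq_zero {χ : ℝ} {S : Set ℝ} (h : ∀ μ ∈ S, F.eigenspace χ μ = ⊥) :
    F.count χ S = 0 := by
  have h1 : F.spectralSum χ S = ⊥ := by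
    simp only [spectralSum, iSup_eq_bot]
    exact h
  rw [count, h1]
  simp

theorem eigenvalue_eq (χ : ℝ) (n : ℕ) :
    F.eigenvalue χ n = sInf {t : ℝ | 0 < t ∧ (n : ℕ∞) ≤ F.count χ (Ioc 0 t)} := by
  simp only [count, Cardinal.natCast_le_toENat]
  rfl

theorem sp₀_add_left (χ : ℝ) (u v w : H₀) :
    F.sp₀ χ (u + v) w = F.sp₀ χ u w + F.sp₀ χ v w := by
  rw [← F.sp₀_conj, F.sp₀_add_right, map_add, F.sp₀_conj, F.sp₀_conj]

theorem sp₀_smul_left (χ : ℝ) (c : ℂ) (u v : H₀) :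
    F.sp₀ χ (c • u) v = c * F.sp₀ χ u v := by
  rw [← F.sp₀_conj, F.sp₀_smul_right, map_mul, F.sp₀_conj, Complex.conj_conj]

theorem sp₀_zero_left (χ : ℝ) (u : H₀) : F.sp₀ χ 0 u = 0 := by
  rw [← F.sp₀_conj, F.sp₀_zero_right, map_zero]

theorem sp₀_sum_left (χ : ℝ) {ι : Type*} (s : Finset ι) (f : ι → H₀) (v : H₀) :
    F.sp₀ χ (∑ i ∈ s, f i) v = ∑ i ∈ s, F.sp₀ χ (f i) v := by
  classical
  induction s using Finset.induction_on with
  | empty => simp [F.sp₀_zero_left]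
  | insert a s ha ih => rw [Finset.sum_insert ha, Finset.sum_insert ha, F.sp₀_add_left, ih]

theorem linearIndependent_of_sp₀ {ι : Type*} [DecidableEq ι] {χ : ℝ} {w : ι → H₀}
    (hw : ∀ i j, F.sp₀ χ (w i) (w j) = if i = j then 1 else 0) : LinearIndependent ℂ w := by
  rw [linearIndependent_iff']
  intro s g hg i hi
  have h1 : F.sp₀ χ (∑ j ∈ s, g j • w j) (w i) = 0 := by rw [hg, F.sp₀_zero_left]
  rw [F.sp₀_sum_left] at h1
  simpa [F.sp₀_smul_left, hw, hi] using h1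

variable {F} {T : ℝ → F.VSpace →L[ℂ] F.VSpace} {J' : ℝ → H₀ →L[ℂ] F.VSpace}

/-- Eigenvectors for different eigenvalues are orthogonal. -/
theorem IsPencil.sp₀_eq_zero [CompleteSpace F.VSpace] (h : F.IsPencil T J') {χ : ℝ}
    (hχ : χ ∈ F.params) {μ ν : ℝ} (hμν : μ ≠ ν) {x y : H₀} (hx : x ∈ F.eigenspace χ μ)
    (hy : y ∈ F.eigenspace χ ν) : F.sp₀ χ x y = 0 := by
  obtain ⟨x, rfl, hTx⟩ := (h.mem_eigenspace hχ _ _).1 hx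
  obtain ⟨y, rfl, hTy⟩ := (h.mem_eigenspace hχ _ _).1 hy
  have h1 : inner ℂ (T χ y) x = inner ℂ y (T χ x) := (h.symm_T hχ).isSymmetric y x
  have h2 : inner ℂ ((J' χ ∘L F.inclL) y) x = inner ℂ y ((J' χ ∘L F.inclL) x) :=
    (h.symm_J hχ).isSymmetric y x
  rw [hTx, hTy, inner_smul_left_eq_smul, inner_smul_right_eq_smul, h2, h.inner_J_incl hχ,
    ← sub_eq_zero, ← sub_smul, smul_eq_zero, sub_eq_zero] at h1
  exact h1.resolve_left (Ne.symm hμν)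

theorem IsPencil.disjoint_spectralSum [CompleteSpace F.VSpace] (h : F.IsPencil T J') {χ : ℝ}
    (hχ : χ ∈ F.params) {S S' : Set ℝ} (hS : Disjoint S S') :
    Disjoint (F.spectralSum χ S) (F.spectralSum χ S') := by
  rw [Submodule.disjoint_def]
  intro x hx hx'
  -- the subspace orthogonal to a given vector
  let N : H₀ → Submodule ℂ H₀ := fun y =>
    { carrier := {x | F.sp₀ χ x y = 0}
      add_mem' := fun {a b} ha hb => by
        rw [mem_ofPred_eq] at ha hb ⊢
        rw [F.sp₀_add_left, ha, hb, add_zero]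
      zero_mem' := F.sp₀_zero_left χ y
      smul_mem' := fun c a ha => by
        rw [mem_ofPred_eq] at ha ⊢
        rw [F.sp₀_smul_left, ha, mul_zero] }
  have hN : ∀ x y, x ∈ N y ↔ y ∈ N x := fun x y => by
    change F.sp₀ χ x y = 0 ↔ F.sp₀ χ y x = 0
    rw [← F.sp₀_conj, map_eq_zero]
  have h1 : ∀ ν ∈ S', ∀ y ∈ F.eigenspace χ ν, F.spectralSum χ S ≤ N y := fun ν hν y hy =>
    iSup₂_le fun μ hμ z hz => h.sp₀_eq_zero hχ (hS.ne_of_mem hμ hν) hz hy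
  have h2 : F.spectralSum χ S' ≤ N x := iSup₂_le fun ν hν y hy => (hN _ _).1 (h1 ν hν y hy hx)
  have h3 : F.sp₀ χ x x = 0 := h2 hx'
  exact (F.ip₀ χ).definite _ h3

theorem IsPencil.count_union [CompleteSpace F.VSpace] (h : F.IsPencil T J') {χ : ℝ}
    (hχ : χ ∈ F.params) {S S' : Set ℝ} (hS : Disjoint S S') :
    F.count χ (S ∪ S') = F.count χ S + F.count χ S' := by
  have h1 : F.spectralSum χ (S ∪ S') = F.spectralSum χ S ⊔ F.spectralSum χ S' := by
    simp only [spectralSum, iSup_union]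
  have h2 := Submodule.rank_sup_add_rank_inf_eq (F.spectralSum χ S) (F.spectralSum χ S')
  rw [(h.disjoint_spectralSum hχ hS).eq_bot, rank_bot, add_zero] at h2
  rw [count, h1, h2, map_add]
  rfl

theorem IsEigenbasisNear.spectralSum_eq {ι : Type} [DecidableEq ι] {χ : ℝ} {z : ι → ℝ}
    {w : ι → F.VSpace} {κ ε : ℝ} (h : F.IsEigenbasisNear χ z w κ ε) {S : Set ℝ}
    (hS : ∀ μ ∈ S, |μ - κ| < ε) :
    F.spectralSum χ S = Submodule.span ℂ ((fun i => F.incl (w i)) '' {i | z i ∈ S}) := by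
  refine le_antisymm (iSup₂_le fun μ hμ => (h.le_span μ (hS μ hμ)).trans ?_)
    (Submodule.span_le.2 ?_)
  · refine Submodule.span_mono (image_mono fun i hi => ?_)
    rw [mem_ofPred_eq] at hi ⊢
    rwa [hi]
  · rintro _ ⟨i, hi, rfl⟩
    exact Submodule.mem_iSup_of_mem (z i) (Submodule.mem_iSup_of_mem hi (h.mem i))

theorem IsEigenbasisNear.rank_spectralSum {ι : Type} [Fintype ι] [DecidableEq ι] {χ : ℝ}
    {z : ι → ℝ} {w : ι → F.VSpace} {κ ε : ℝ} (h : F.IsEigenbasisNear χ z w κ ε) {S : Set ℝ}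
    (hS : ∀ μ ∈ S, |μ - κ| < ε) :
    Module.rank ℂ (F.spectralSum χ S) = ((ncard {i | z i ∈ S} : ℕ) : Cardinal) := by
  have hli := F.linearIndependent_of_sp₀ h.ortho
  rw [h.spectralSum_eq hS, rank_span_set (hli.linearIndepOn _).id_image,
    ← cast_ncard (toFinite _), ncard_image_of_injective _ hli.injective]

theorem IsEigenbasisNear.rank_eigenspace {ι : Type} [Fintype ι] [DecidableEq ι] {χ : ℝ}
    {z : ι → ℝ} {w : ι → F.VSpace} {κ ε : ℝ} (h : F.IsEigenbasisNear χ z w κ ε) {μ : ℝ}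
    (hμ : |μ - κ| < ε) :
    Module.rank ℂ (F.eigenspace χ μ) = ((ncard {i | z i = μ} : ℕ) : Cardinal) := by
  have h1 := h.rank_spectralSum (S := {μ}) (by simpa using hμ)
  have h2 : F.spectralSum χ {μ} = F.eigenspace χ μ := by simp [spectralSum]
  rw [h2] at h1
  exact h1

theorem IsEigenbasisNear.count_eq {ι : Type} [Fintype ι] [DecidableEq ι] {χ : ℝ}
    {z : ι → ℝ} {w : ι → F.VSpace} {κ ε : ℝ} (h : F.IsEigenbasisNear χ z w κ ε) {S : Set ℝ}
    (hS : ∀ μ ∈ S, |μ - κ| < ε) : F.count χ S = (ncard {i | z i ∈ S} : ℕ) := by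
  rw [count, h.rank_spectralSum hS, map_natCast]

end OperatorFamily

/-! ### The gap between kernels -/

/-- The gap controls the distance of all vectors, the set in its definition being bounded by `1`. -/
theorem infDist_le_gapDelta {Z : Type*} [NormedAddCommGroup Z] [NormedSpace ℂ Z]
    {M N : Submodule ℂ Z} {u : Z} (hu : u ∈ M) :
    Metric.infDist u (N : Set Z) ≤ gapDelta M N * ‖u‖ := by
  rcases eq_or_ne u 0 with rfl | hu0
  · simp [Metric.infDist_zero_of_mem N.zero_mem]
  have hn : 0 < ‖u‖ := norm_pos_iff.2 hu0
  set a : ℂ := ((‖u‖⁻¹ : ℝ) : ℂ) with ha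
  have han : ‖a‖ = ‖u‖⁻¹ := by
    rw [ha, Complex.norm_real, Real.norm_of_nonneg (by positivity)]
  have hbdd : BddAbove {d : ℝ | ∃ u ∈ M, ‖u‖ = 1 ∧ d = Metric.infDist u (N : Set Z)} := by
    refine ⟨1, ?_⟩
    rintro _ ⟨x, -, hx, rfl⟩
    have := Metric.infDist_le_dist_of_mem (x := x) N.zero_mem
    rwa [dist_zero_right, hx] at this
  have h1 : Metric.infDist (a • u) (N : Set Z) ≤ gapDelta M N :=
    le_csSup hbdd ⟨a • u, M.smul_mem a hu, by
      rw [norm_smul, han, inv_mul_cancel₀ hn.ne'], rfl⟩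
  refine le_of_forall_pos_lt_add fun e he => ?_
  obtain ⟨y, hy, hy2⟩ := (Metric.infDist_lt_iff (s := (N : Set Z)) ⟨0, N.zero_mem⟩).1
    (h1.trans_lt (lt_add_of_pos_right _ (div_pos he hn)))
  have hu1 : u = (‖u‖ : ℂ) • (a • u) := by
    rw [smul_smul, ha, ← Complex.ofReal_mul, mul_inv_cancel₀ hn.ne', Complex.ofReal_one, one_smul]
  calc Metric.infDist u (N : Set Z) ≤ dist u ((‖u‖ : ℂ) • y) :=
        Metric.infDist_le_dist_of_mem (N.smul_mem _ hy)
    _ = ‖u‖ * dist (a • u) y := by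
        have h2 := dist_smul₀ (‖u‖ : ℂ) (a • u) y
        rwa [← hu1, Complex.norm_real, norm_norm] at h2
    _ < ‖u‖ * (gapDelta M N + e / ‖u‖) := by gcongr
    _ = gapDelta M N * ‖u‖ + e := by field_simp

namespace OperatorFamily

variable {H₀ H₁ : Type*} [NormedAddCommGroup H₀] [InnerProductSpace ℂ H₀]
  [NormedAddCommGroup H₁] [InnerProductSpace ℂ H₁] {F : OperatorFamily ℝ H₀ H₁}
  {T : ℝ → F.VSpace →L[ℂ] F.VSpace} {J' : ℝ → H₀ →L[ℂ] F.VSpace}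

/-- An eigenvector of `T_χ` for an eigenvalue `μ ≠ 0` is orthogonal to the kernel of `A_χ`. If that
kernel is close to the one at `x₀`, the component of the eigenvector in the latter is small. -/
theorem IsPencil.norm_kernel_component_le [CompleteSpace F.VSpace] (h : F.IsPencil T J')
    {x₀ χ : ℝ} (hx₀ : x₀ ∈ F.params) (hχ : χ ∈ F.params) {P : F.VSpace →L[ℂ] F.VSpace}
    (hP : IsReducedCompact (T x₀) (J' x₀ ∘L F.inclL) P) {a : ℝ}
    (ha : ∀ u : H₀, a * ‖u‖ ^ 2 ≤ ((F.ip₀ x₀).inner u u).re) {μ : ℝ} (hμ : μ ≠ 0)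
    {w : F.VSpace} (hw : T χ w = μ • (J' χ ∘L F.inclL) w) :
    a * ‖F.inclL (P w)‖ ≤
      (‖J' x₀ - J' χ‖ + ‖J' χ‖ * gapDelta (F.kerA x₀) (F.kerA χ)) * ‖w‖ := by
  set u := F.inclL (P w) with hu
  rcases eq_or_ne u 0 with hu0 | hu0
  · rw [hu0, norm_zero, mul_zero]
    have : 0 ≤ gapDelta (F.kerA x₀) (F.kerA χ) := by
      refine Real.sSup_nonneg ?_
      rintro _ ⟨x, -, -, rfl⟩
      exact Metric.infDist_nonneg
    positivity
  have hun : 0 < ‖u‖ := norm_pos_iff.2 hu0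
  have huM : u ∈ F.kerA x₀ := (h.mem_kerA hx₀ u).2 ⟨P w, rfl, hP.T_P w⟩
  have horth : ∀ y ∈ F.kerA χ, inner ℂ w (J' χ y) = 0 := by
    intro y hy
    obtain ⟨y, rfl, hTy⟩ := (h.mem_kerA hχ y).1 hy
    have h1 : inner ℂ (T χ w) y = inner ℂ w (T χ y) := (h.symm_T hχ).isSymmetric w y
    have h2 : inner ℂ ((J' χ ∘L F.inclL) w) y = inner ℂ w ((J' χ ∘L F.inclL) y) :=
      (h.symm_J hχ).isSymmetric w y
    rw [hw, hTy, inner_zero_right, inner_smul_left_eq_smul, h2, smul_eq_zero] at h1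
    exact h1.resolve_left hμ
  have h1 : a * ‖u‖ ^ 2 ≤ ‖inner ℂ w (J' x₀ u)‖ := by
    refine (ha u).trans (le_trans (le_of_eq ?_) (Complex.re_le_norm _))
    have h2 : inner ℂ w ((J' x₀ ∘L F.inclL) (P w)) = inner ℂ (P w) ((J' x₀ ∘L F.inclL) (P w)) := by
      rw [← hP.inner_J (P w), hP.J_P, hP.P_P]
    change _ = (inner ℂ w ((J' x₀ ∘L F.inclL) (P w))).re
    rw [h2, h.inner_J_incl hx₀]
    rfl
  have h2 : ∀ y ∈ F.kerA χ, ‖inner ℂ w (J' x₀ u)‖ ≤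
      ‖w‖ * (‖J' x₀ - J' χ‖ * ‖u‖ + ‖J' χ‖ * ‖u - y‖) := by
    intro y hy
    have h3 : inner ℂ w (J' x₀ u) = inner ℂ w ((J' x₀ - J' χ) u + J' χ (u - y)) := by
      rw [sub_apply, map_sub, inner_add_right, inner_sub_right, inner_sub_right,
        horth y hy]
      ring
    rw [h3]
    refine (norm_inner_le_norm _ _).trans ?_
    gcongr
    exact (norm_add_le _ _).trans (add_le_add (ContinuousLinearMap.le_opNorm _ _)
      (ContinuousLinearMap.le_opNorm _ _))
  have h3 : a * ‖u‖ ^ 2 ≤ ‖w‖ * (‖J' x₀ - J' χ‖ * ‖u‖ +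
      ‖J' χ‖ * (gapDelta (F.kerA x₀) (F.kerA χ) * ‖u‖)) := by
    refine le_of_forall_pos_le_add fun e he => ?_
    set b := ‖w‖ * ‖J' χ‖ + 1 with hb
    have hb0 : 0 < b := by positivity
    obtain ⟨y, hy, hy2⟩ := (Metric.infDist_lt_iff (s := (F.kerA χ : Set H₀))
      ⟨0, (F.kerA χ).zero_mem⟩).1
      ((infDist_le_gapDelta huM).trans_lt (lt_add_of_pos_right _ (div_pos he hb0)))
    refine h1.trans ((h2 y hy).trans ?_)
    rw [← dist_eq_norm u y]
    calc ‖w‖ * (‖J' x₀ - J' χ‖ * ‖u‖ + ‖J' χ‖ * dist u y)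
        ≤ ‖w‖ * (‖J' x₀ - J' χ‖ * ‖u‖ +
          ‖J' χ‖ * (gapDelta (F.kerA x₀) (F.kerA χ) * ‖u‖ + e / b)) := by gcongr
      _ = ‖w‖ * (‖J' x₀ - J' χ‖ * ‖u‖ +
          ‖J' χ‖ * (gapDelta (F.kerA x₀) (F.kerA χ) * ‖u‖)) + (‖w‖ * ‖J' χ‖) * (e / b) := by ring
      _ ≤ ‖w‖ * (‖J' x₀ - J' χ‖ * ‖u‖ +
          ‖J' χ‖ * (gapDelta (F.kerA x₀) (F.kerA χ) * ‖u‖)) + b * (e / b) := by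
        gcongr
        rw [hb]
        linarith
      _ = _ := by rw [mul_div_cancel₀ _ hb0.ne']
  refine le_of_mul_le_mul_right ?_ hun
  calc a * ‖u‖ * ‖u‖ = a * ‖u‖ ^ 2 := by ring
    _ ≤ _ := h3
    _ = _ := by ring

/-- If the kernels do not shrink, no small positive eigenvalues appear. -/
theorem IsPencil.exists_forall_eigenspace_eq_bot [CompleteSpace F.VSpace] (h : F.IsPencil T J')
    {x₀ : ℝ} (hx₀ : x₀ ∈ F.params) (hT : ContinuousAt T x₀) (hJ : ContinuousAt J' x₀)
    (hgap : Tendsto (fun χ => gapDelta (F.kerA x₀) (F.kerA χ)) (𝓝 x₀) (𝓝 0)) :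
    ∃ η > 0, ∀ᶠ χ in 𝓝 x₀, ∀ μ ∈ Ioc 0 η, F.eigenspace χ μ = ⊥ := by
  obtain ⟨P, hP⟩ := h.exists_isReducedCompact hx₀
  obtain ⟨a, ha, _, _, hab⟩ := F.ip₀_equiv x₀ hx₀
  obtain ⟨Q, hQ⟩ := hP.isUnit_add_kernel_form
  obtain ⟨c, hc, hcw⟩ : ∃ c > 0, ∀ w, c * ‖w‖ ≤ ‖(T x₀ + (J' x₀ ∘L F.inclL) ∘L P) w‖ := by
    set R : F.VSpace →L[ℂ] F.VSpace := ↑Q⁻¹ with hR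
    refine ⟨(‖R‖ + 1)⁻¹, by positivity, fun w => ?_⟩
    rw [inv_mul_le_iff₀ (by positivity), ← hQ]
    have h1 : R ((Q : F.VSpace →L[ℂ] F.VSpace) w) = w := DFunLike.congr_fun Q.inv_mul w
    calc ‖w‖ = ‖R ((Q : F.VSpace →L[ℂ] F.VSpace) w)‖ := by rw [h1]
      _ ≤ ‖R‖ * ‖(Q : F.VSpace →L[ℂ] F.VSpace) w‖ := R.le_opNorm _
      _ ≤ _ := by gcongr; linarith
  -- for `μ ≤ η`, the term `μ J χ` is smaller than the lower bound `c`
  set η : ℝ := c / (2 * (‖J' x₀‖ * ‖F.inclL‖ + 1)) with hη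
  have hη0 : 0 < η := by positivity
  have hlim : Tendsto (fun χ => ‖T x₀ - T χ‖ + η * (‖J' χ‖ * ‖F.inclL‖) +
      ‖J' x₀‖ * ((‖J' x₀ - J' χ‖ + ‖J' χ‖ * gapDelta (F.kerA x₀) (F.kerA χ)) / a)) (𝓝 x₀)
      (𝓝 (‖T x₀ - T x₀‖ + η * (‖J' x₀‖ * ‖F.inclL‖) +
      ‖J' x₀‖ * ((‖J' x₀ - J' x₀‖ + ‖J' x₀‖ * 0) / a))) := by
    have hT' : Tendsto T (𝓝 x₀) (𝓝 (T x₀)) := hT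
    have hJ2 : Tendsto J' (𝓝 x₀) (𝓝 (J' x₀)) := hJ
    exact (((tendsto_const_nhds.sub hT').norm.add ((hJ2.norm.mul_const _).const_mul _)).add
      ((((tendsto_const_nhds.sub hJ2).norm.add (hJ2.norm.mul hgap)).div_const _).const_mul _))
  have hlt : ‖T x₀ - T x₀‖ + η * (‖J' x₀‖ * ‖F.inclL‖) +
      ‖J' x₀‖ * ((‖J' x₀ - J' x₀‖ + ‖J' x₀‖ * 0) / a) < c := by
    simp only [sub_self, norm_zero, mul_zero, add_zero, zero_div, zero_add]
    rw [hη, div_mul_eq_mul_div, div_lt_iff₀ (by positivity)]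
    have : 0 ≤ c * (‖J' x₀‖ * ‖F.inclL‖) := by positivity
    linarith
  refine ⟨η, hη0, ?_⟩
  filter_upwards [hlim.eventually_lt_const hlt, F.isOpen_params.mem_nhds hx₀] with χ hχlt hχ μ hμ
  rw [Submodule.eq_bot_iff]
  intro y hy
  obtain ⟨w, rfl, hw⟩ := (h.mem_eigenspace hχ _ _).1 hy
  suffices hw0 : w = 0 by
    rw [hw0]
    exact F.inclL.map_zero
  by_contra hne
  have hwn : 0 < ‖w‖ := norm_pos_iff.2 hne
  have h1 := h.norm_kernel_component_le hx₀ hχ hP (fun u => (hab u).1) hμ.1.ne' hw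
  have h2 : (T x₀ + (J' x₀ ∘L F.inclL) ∘L P) w =
      (T x₀ - T χ) w + μ • J' χ (F.inclL w) + J' x₀ (F.inclL (P w)) := by
    change _ = _ + μ • (J' χ ∘L F.inclL) w + _
    rw [← hw]
    simp
  have h3 : ‖F.inclL (P w)‖ ≤
      (‖J' x₀ - J' χ‖ + ‖J' χ‖ * gapDelta (F.kerA x₀) (F.kerA χ)) / a * ‖w‖ := by
    rw [div_mul_eq_mul_div, le_div_iff₀ ha]
    linarith
  have h4 : c * ‖w‖ ≤ (‖T x₀ - T χ‖ + η * (‖J' χ‖ * ‖F.inclL‖) +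
      ‖J' x₀‖ * ((‖J' x₀ - J' χ‖ + ‖J' χ‖ * gapDelta (F.kerA x₀) (F.kerA χ)) / a)) * ‖w‖ := by
    refine (hcw w).trans ?_
    rw [h2]
    refine (norm_add₃_le).trans ?_
    rw [add_mul, add_mul]
    refine add_le_add_three (ContinuousLinearMap.le_opNorm _ _) ?_ ?_
    · rw [norm_smul, Real.norm_of_nonneg hμ.1.le, mul_assoc, mul_assoc]
      have h5 := (J' χ).le_opNorm (F.inclL w)
      have h6 := F.inclL.le_opNorm w
      have h7 := hμ.2
      gcongr
      exact h5.trans (by gcongr)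
    · rw [mul_assoc]
      refine ((J' x₀).le_opNorm _).trans ?_
      gcongr
  exact absurd (lt_of_mul_lt_mul_right (h4.trans_lt (by gcongr)) hwn.le) (lt_irrefl c)

end OperatorFamily

namespace OperatorFamily

variable {H₀ H₁ : Type*} [NormedAddCommGroup H₀] [InnerProductSpace ℂ H₀]
  [NormedAddCommGroup H₁] [InnerProductSpace ℂ H₁] {F : OperatorFamily ℝ H₀ H₁}
  {T : ℝ → F.VSpace →L[ℂ] F.VSpace} {J' : ℝ → H₀ →L[ℂ] F.VSpace}

/-! ### The numbering of the eigenvalues -/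

theorem IsEigenbasisNear.eigenspace_eq_bot {ι : Type} [DecidableEq ι] {χ : ℝ} {z : ι → ℝ}
    {w : ι → F.VSpace} {κ ε : ℝ} (h : F.IsEigenbasisNear χ z w κ ε) {μ : ℝ} (hμ : |μ - κ| < ε)
    (hz : ∀ i, z i ≠ μ) : F.eigenspace χ μ = ⊥ := by
  refine le_bot_iff.1 ((h.le_span μ hμ).trans (le_of_eq ?_))
  simp [hz]

theorem IsEigenbasisNear.eigenspace_ne_bot {ι : Type} [DecidableEq ι] {χ : ℝ} {z : ι → ℝ}
    {w : ι → F.VSpace} {κ ε : ℝ} (h : F.IsEigenbasisNear χ z w κ ε) (i : ι) :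
    F.eigenspace χ (z i) ≠ ⊥ := by
  intro h0
  have h1 := h.mem i
  rw [h0, Submodule.mem_bot] at h1
  have h2 := h.ortho i i
  rw [h1, F.sp₀_zero_left, if_pos rfl] at h2
  exact zero_ne_one h2

/-- Near each `κ > 0`, the number of eigenvalues in an interval whose end points are not eigenvalues
at `x₀` is locally constant in the parameter. -/
theorem IsPencil.exists_count_Ioc_eventually_eq [CompleteSpace F.VSpace] (h : F.IsPencil T J')
    {r : WithTop ℕ∞} (hr : r = 1 ∨ r = ω) (hT : ContDiffOn ℝ r T F.params)
    (hJ : ContDiffOn ℝ r J' F.params) {x₀ κ : ℝ} (hx₀ : x₀ ∈ F.params) (hκ : 0 < κ) :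
    ∃ ε > 0, (∀ μ, μ ≠ κ → |μ - κ| < ε → F.eigenspace x₀ μ = ⊥) ∧
      ∀ a b, |a - κ| < ε → |b - κ| < ε → F.eigenspace x₀ a = ⊥ → F.eigenspace x₀ b = ⊥ →
        ∃ n : ℕ, ∀ᶠ χ in 𝓝 x₀, F.count χ (Ioc a b) = n := by
  obtain ⟨ζ, hζ, hζ0, ⟨ε, hε, hb⟩, -⟩ := h.exists_branches hr hT hJ hx₀ hκ rfl
  obtain ⟨w₀, hw₀⟩ := hb.self_of_nhds
  refine ⟨ε, hε, fun μ hμ hμε => hw₀.eigenspace_eq_bot hμε fun i => by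
    rw [hζ0]
    exact hμ.symm, fun a b ha hb' ha0 hb0 => ?_⟩
  refine ⟨ncard {i | ζ i x₀ ∈ Ioc a b}, ?_⟩
  have hev : ∀ᶠ χ in 𝓝 x₀, ∀ i, ζ i χ ∈ Ioc a b ↔ ζ i x₀ ∈ Ioc a b := by
    refine eventually_all.2 fun i => ?_
    have hne := hw₀.eigenspace_ne_bot i
    have hc : Tendsto (ζ i) (𝓝 x₀) (𝓝 (ζ i x₀)) := (hζ i).continuousAt
    have hna : ζ i x₀ ≠ a := fun h0 => hne (by simpa only [h0] using ha0)
    have hnb : ζ i x₀ ≠ b := fun h0 => hne (by simpa only [h0] using hb0)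
    have h1 : ∀ᶠ χ in 𝓝 x₀, a < ζ i χ ↔ a < ζ i x₀ := by
      rcases lt_or_gt_of_ne hna with h2 | h2
      · filter_upwards [hc.eventually_lt_const h2] with χ h3
        exact iff_of_false h3.not_gt h2.not_gt
      · filter_upwards [hc.eventually_const_lt h2] with χ h3
        exact iff_of_true h3 h2
    have h4 : ∀ᶠ χ in 𝓝 x₀, ζ i χ ≤ b ↔ ζ i x₀ ≤ b := by
      rcases lt_or_gt_of_ne hnb with h2 | h2
      · filter_upwards [hc.eventually_lt_const h2] with χ h3
        exact iff_of_true h3.le h2.le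
      · filter_upwards [hc.eventually_const_lt h2] with χ h3
        exact iff_of_false h3.not_ge h2.not_ge
    filter_upwards [h1, h4] with χ h5 h6
    exact and_congr h5 h6
  filter_upwards [hb, hev] with χ ⟨w, hw⟩ hχ
  rw [hw.count_eq]
  · simp only [hχ]
  · intro μ hμ
    rw [abs_lt] at ha hb' ⊢
    constructor <;> linarith [hμ.1, hμ.2]

/-- If the kernels do not shrink, the number of positive eigenvalues up to `b` is locally constant,
for every `b > 0` which is not an eigenvalue at `x₀`. -/
theorem IsPencil.exists_count_Ioc_zero_eventually_eq [CompleteSpace F.VSpace]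
    (h : F.IsPencil T J') {r : WithTop ℕ∞} (hr : r = 1 ∨ r = ω)
    (hT : ContDiffOn ℝ r T F.params) (hJ : ContDiffOn ℝ r J' F.params) {x₀ : ℝ}
    (hx₀ : x₀ ∈ F.params)
    (hgap : Tendsto (fun χ => gapDelta (F.kerA x₀) (F.kerA χ)) (𝓝 x₀) (𝓝 0))
    {b : ℝ} (hb0 : 0 < b) (hb : F.eigenspace x₀ b = ⊥) :
    ∃ n : ℕ, ∀ᶠ χ in 𝓝 x₀, F.count χ (Ioc 0 b) = n := by
  have hnear : F.params ∈ 𝓝 x₀ := F.isOpen_params.mem_nhds hx₀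
  obtain ⟨η, hη, hev⟩ := h.exists_forall_eigenspace_eq_bot hx₀
    (hT.contDiffAt hnear).continuousAt (hJ.contDiffAt hnear).continuousAt hgap
  by_contra hcon
  -- the infimum of the exceptional end points is positive, and contradicts local constancy there
  set B : Set ℝ := {c | 0 < c ∧ F.eigenspace x₀ c = ⊥ ∧
    ¬ ∃ n : ℕ, ∀ᶠ χ in 𝓝 x₀, F.count χ (Ioc 0 c) = n} with hB
  have hBη : ∀ c ∈ B, η ≤ c := by
    intro c hc
    by_contra! hlt
    refine hc.2.2 ⟨0, hev.mono fun χ hχ => ?_⟩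
    rw [F.count_eq_zero fun μ hμ => hχ μ ⟨hμ.1, hμ.2.trans hlt.le⟩, Nat.cast_zero]
  have hbB : b ∈ B := ⟨hb0, hb, hcon⟩
  have hbdd : BddBelow B := ⟨η, hBη⟩
  set s := sInf B with hs
  have hsη : η ≤ s := le_csInf ⟨b, hbB⟩ hBη
  have hs0 : 0 < s := hη.trans_le hsη
  obtain ⟨ε, hε, h1, h2⟩ := h.exists_count_Ioc_eventually_eq hr hT hJ hx₀ hs0
  obtain ⟨c, hcB, hcs⟩ := exists_lt_of_csInf_lt ⟨b, hbB⟩ (lt_add_of_pos_right s hε)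
  have hsc : s ≤ c := csInf_le hbdd hcB
  set a := s - min ε s / 2 with ha
  have hmin : 0 < min ε s := lt_min hε hs0
  have hmin1 := min_le_left ε s
  have hmin2 := min_le_right ε s
  have ha0 : 0 < a := by rw [ha]; linarith
  have has : a < s := by rw [ha]; linarith
  have haε : |a - s| < ε := by rw [abs_lt, ha]; constructor <;> linarith
  have haE := h1 a has.ne haε
  obtain ⟨n₁, hn₁⟩ : ∃ n : ℕ, ∀ᶠ χ in 𝓝 x₀, F.count χ (Ioc 0 a) = n := by
    by_contra hna
    exact absurd (csInf_le hbdd (show a ∈ B from ⟨ha0, haE, hna⟩)) has.not_ge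
  obtain ⟨n₂, hn₂⟩ := h2 a c haε (by rw [abs_lt]; constructor <;> linarith) haE hcB.2.1
  refine hcB.2.2 ⟨n₁ + n₂, ?_⟩
  filter_upwards [hn₁, hn₂, hnear] with χ h3 h4 hχ
  rw [← Ioc_union_Ioc_eq_Ioc ha0.le (has.le.trans hsc), h.count_union hχ, h3, h4, Nat.cast_add]
  exact Ioc_disjoint_Ioc_of_le le_rfl

/-- If the kernels do not shrink, the branches through `κ` carry the same numbers in the list of
positive eigenvalues as the eigenvalue `κ` at `x₀`. -/
theorem IsPencil.eventually_exists_perm [CompleteSpace F.VSpace] (h : F.IsPencil T J')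
    {r : WithTop ℕ∞} (hr : r = 1 ∨ r = ω) (hT : ContDiffOn ℝ r T F.params)
    (hJ : ContDiffOn ℝ r J' F.params) {x₀ κ : ℝ} (hx₀ : x₀ ∈ F.params) (hκ : 0 < κ)
    (hgap : Tendsto (fun χ => gapDelta (F.kerA x₀) (F.kerA χ)) (𝓝 x₀) (𝓝 0))
    {m : ℕ} (hm : 1 ≤ m) {ζ : Fin m → ℝ → ℝ} (hζ : ∀ i, ContinuousAt (ζ i) x₀)
    (hζ0 : ∀ i, ζ i x₀ = κ) {ε : ℝ} (hε : 0 < ε)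
    (hb : ∀ᶠ χ in 𝓝 x₀, ∃ w, F.IsEigenbasisNear χ (fun i => ζ i χ) w κ ε)
    {k : ℕ} (hkm : ∀ j < m, F.eigenvalue x₀ (k + j) = κ) :
    ∀ᶠ χ in 𝓝 x₀, ∃ σ : Equiv.Perm (Fin m), ∀ i, ζ i χ = F.eigenvalue χ (k + (σ i : ℕ)) := by
  have hnear : F.params ∈ 𝓝 x₀ := F.isOpen_params.mem_nhds hx₀
  have hmin : 0 < min ε κ := lt_min hε hκ
  have hmin1 := min_le_left ε κ
  have hmin2 := min_le_right ε κ
  set a := κ - min ε κ / 2 with ha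
  have ha0 : 0 < a := by rw [ha]; linarith
  have haκ : a < κ := by rw [ha]; linarith
  obtain ⟨w₀, hw₀⟩ := hb.self_of_nhds
  have haE : F.eigenspace x₀ a = ⊥ := hw₀.eigenspace_eq_bot
    (by rw [abs_lt, ha]; constructor <;> linarith) fun i => by
      rw [hζ0]
      exact haκ.ne'
  obtain ⟨n, hn⟩ := h.exists_count_Ioc_zero_eventually_eq hr hT hJ hx₀ hgap ha0 haE
  have hcount : ∀ᶠ χ in 𝓝 x₀, ∀ t, a ≤ t → t < κ + ε →
      F.count χ (Ioc 0 t) = ((n + ncard {i | ζ i χ ∈ Ioc a t} : ℕ) : ℕ∞) := by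
    filter_upwards [hn, hb, hnear] with χ h1 ⟨w, hw⟩ hχ t hat ht
    rw [← Ioc_union_Ioc_eq_Ioc ha0.le hat, h.count_union hχ (Ioc_disjoint_Ioc_of_le le_rfl), h1,
      hw.count_eq, Nat.cast_add]
    intro μ hμ
    rw [abs_lt]
    constructor <;> linarith [hμ.1, hμ.2]
  have hbdd : ∀ χ (p : ℕ), BddBelow {t : ℝ | 0 < t ∧ (p : ℕ∞) ≤ F.count χ (Ioc 0 t)} :=
    fun χ p => ⟨0, fun t ht => ht.1.le⟩
  -- at `x₀`, the eigenvalues up to `a` are exactly those with the numbers below `k`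
  have hkn : k = n + 1 := by
    have hc₀ := hcount.self_of_nhds
    refine le_antisymm ?_ ?_
    · have h1 := hkm (m - 1) (by omega)
      rw [F.eigenvalue_eq] at h1
      -- the infimum of the empty set is `0`, which differs from `κ`
      have hne : {t : ℝ | 0 < t ∧ ((k + (m - 1) : ℕ) : ℕ∞) ≤ F.count x₀ (Ioc 0 t)}.Nonempty := by
        by_contra hemp
        rw [not_nonempty_iff_eq_empty.1 hemp, Real.sInf_empty] at h1
        exact hκ.ne h1
      obtain ⟨t, ht, htκ⟩ := exists_lt_of_csInf_lt hne (h1.trans_lt (lt_add_of_pos_right κ hε))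
      have h2 := ht.2.trans (F.count_mono x₀ (Ioc_subset_Ioc_right (le_max_right a t)))
      rw [hc₀ _ (le_max_left _ _) (max_lt (by linarith) htκ), Nat.cast_le] at h2
      have h3 : ncard {i | ζ i x₀ ∈ Ioc a (max a t)} ≤ m := by
        simpa using ncard_le_card {i | ζ i x₀ ∈ Ioc a (max a t)}
      omega
    · have h1 := hkm 0 (by omega)
      rw [F.eigenvalue_eq, add_zero] at h1
      by_contra! hlt
      have h2 : a ∈ {t : ℝ | 0 < t ∧ (k : ℕ∞) ≤ F.count x₀ (Ioc 0 t)} := by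
        refine ⟨ha0, ?_⟩
        rw [hn.self_of_nhds, Nat.cast_le]
        omega
      exact absurd (h1 ▸ csInf_le (hbdd x₀ k) h2) haκ.not_ge
  have hloc : ∀ᶠ χ in 𝓝 x₀, ∀ i, a < ζ i χ ∧ ζ i χ < κ + ε := by
    refine eventually_all.2 fun i => ?_
    have hc : Tendsto (ζ i) (𝓝 x₀) (𝓝 κ) := hζ0 i ▸ hζ i
    exact (hc.eventually_const_lt haκ).and (hc.eventually_lt_const (by linarith))
  filter_upwards [hcount, hloc] with χ hc hl
  -- sorting the branches at `χ` yields the eigenvalues with the numbers `k, k + 1, …`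
  set f : Fin m → ℝ := fun i => ζ i χ with hf
  have hmono : Monotone (f ∘ Tuple.sort f) := Tuple.monotone_sort f
  have key : ∀ j : Fin m, F.eigenvalue χ (k + (j : ℕ)) = f (Tuple.sort f j) := by
    intro j
    rw [F.eigenvalue_eq]
    refine IsLeast.csInf_eq ⟨⟨ha0.trans (hl _).1, ?_⟩, fun t ht => ?_⟩
    · rw [hc _ (hl _).1.le (hl _).2, Nat.cast_le]
      have h1 : Tuple.sort f '' (Iic j) ⊆
          {i | ζ i χ ∈ Ioc a (ζ (Tuple.sort f j) χ)} := by
        rintro _ ⟨l, hlj, rfl⟩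
        exact ⟨(hl _).1, hmono hlj⟩
      have h2 := ncard_le_ncard h1 (toFinite _)
      rw [ncard_image_of_injective _ (Equiv.injective _), ncard_eq_toFinset_card' (Iic j),
        toFinset_Iic, Fin.card_Iic] at h2
      omega
    · by_contra! hlt
      have h1 := ht.2.trans (F.count_mono χ (Ioc_subset_Ioc_right (le_max_right a t)))
      rw [hc _ (le_max_left _ _) (max_lt (by linarith) (hlt.trans (hl _).2)), Nat.cast_le] at h1
      have h2 : {i | ζ i χ ∈ Ioc a (max a t)} ⊆ Tuple.sort f '' (Iio j) := by
        intro i hi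
        refine ⟨(Tuple.sort f).symm i, ?_, Equiv.apply_symm_apply _ _⟩
        rw [mem_Iio]
        by_contra! hji
        have h3 := hmono hji
        simp only [Function.comp_apply, Equiv.apply_symm_apply] at h3
        exact absurd (hi.2.trans_lt (max_lt (hl _).1 hlt)) h3.not_gt
      have h3 := ncard_le_ncard h2 (toFinite _)
      rw [ncard_image_of_injective _ (Equiv.injective _), ncard_eq_toFinset_card' (Iio j),
        toFinset_Iio, Fin.card_Iio] at h3
      omega
  refine ⟨(Tuple.sort f).symm, fun i => ?_⟩
  rw [key, Equiv.apply_symm_apply]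

end OperatorFamily

/-! ### Derivatives of the forms and conclusion -/

theorem hasDerivAt_inner_apply {V : Type*} [NormedAddCommGroup V] [InnerProductSpace ℂ V]
    {A : ℝ → V →L[ℂ] V} {A' : V →L[ℂ] V} {x₀ : ℝ} (hA : HasDerivAt A A' x₀) (u v : V) :
    HasDerivAt (fun x => inner ℂ v (A x u)) (inner ℂ v (A' u)) x₀ := by
  have h := (((innerSL ℂ v).comp (ContinuousLinearMap.apply ℂ V u)).restrictScalars
    ℝ).hasFDerivAt.comp_hasDerivAt x₀ hA
  exact h

end HilbertPerturbation

theorem mainTheorem2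
    {H₀ H₁ : Type*} [NormedAddCommGroup H₀] [InnerProductSpace ℂ H₀] [CompleteSpace H₀]
    [NormedAddCommGroup H₁] [InnerProductSpace ℂ H₁] [CompleteSpace H₁]
    (F : HilbertPerturbation.OperatorFamily ℝ H₀ H₁)
    (r : WithTop ℕ∞) (hr : r = 1 ∨ r = ω) (hF : F.IsOfClass r)
    (χbar : ℝ) (hχ : χbar ∈ F.params)
    (lam : ℝ) (hlam : 0 < lam) (m : ℕ) (hm : 1 ≤ m)
    (hmult : Module.finrank ℂ (F.eigenspace χbar lam) = m)
    (k : ℕ) (hk : 1 ≤ k) (hkm : ∀ j < m, F.eigenvalue χbar (k + j) = lam) :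
    ∃ (U : Set ℝ) (ε : ℝ) (ζ : Fin m → ℝ → ℝ),
      IsOpen U ∧ χbar ∈ U ∧ U ⊆ F.params ∧ 0 < ε ∧
      -- the functions are of class `C^r`
      (∀ i, ContDiffOn ℝ r (ζ i) U) ∧
      (∀ i, ζ i χbar = lam) ∧
      -- they represent, with multiplicities, the eigenvalues of `T_χ` close to `lam`
      (∀ χ ∈ U, ∀ i, ζ i χ ∈ Set.Ioo (lam - ε) (lam + ε)) ∧
      (∀ χ ∈ U, ∀ μ ∈ Set.Ioo (lam - ε) (lam + ε),
        Module.rank ℂ (F.eigenspace χ μ) = ((Set.ncard {i | ζ i χ = μ} : ℕ) : Cardinal)) ∧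
      -- which are those with indices `k, …, k + m - 1` if the kernel of `A_χ` does not shrink
      (Filter.Tendsto (fun χ => HilbertPerturbation.gapDelta (F.kerA χbar) (F.kerA χ))
          (nhds χbar) (nhds 0) →
        ∀ᶠ χ in nhds χbar, ∃ σ : Equiv.Perm (Fin m),
          ∀ i, ζ i χ = F.eigenvalue χ (k + (σ i : ℕ))) ∧
      -- the derivatives at `χbar` are the eigenvalues of the matrix `D₁ - lam D₀`
      (∀ u : Fin m → F.VSpace,
        (∀ h, F.incl (u h) ∈ F.eigenspace χbar lam) →
        (∀ h l, F.sp₀ χbar (F.incl (u h)) (F.incl (u l)) = if h = l then 1 else 0) →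
        ∃ (D₁ D₀ : Matrix (Fin m) (Fin m) ℂ) (d : Fin m → ℝ),
          (∀ h l, HasDerivAt
            (fun χ : ℝ => F.sp₁ χ (F.app χ (u h)) (F.app χ (u l))) (D₁ h l) χbar) ∧
          (∀ h l, HasDerivAt
            (fun χ : ℝ => F.sp₀ χ (F.incl (u h)) (F.incl (u l))) (D₀ h l) χbar) ∧
          (∀ i, HasDerivAt (ζ i) (d i) χbar) ∧
          (D₁ - (lam : ℂ) • D₀).charpoly.roots =
            Multiset.map (fun i => (d i : ℂ)) Finset.univ.val) := by
  have := F.completeSpace_VSpace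
  have hr0 : r ≠ 0 := by rcases hr with rfl | rfl <;> simp
  have hri : r ≠ ∞ := by rcases hr with rfl | rfl <;> decide
  have hnear : F.params ∈ 𝓝 χbar := F.isOpen_params.mem_nhds hχ
  obtain ⟨T, J', h, hT, hJ⟩ := F.exists_isPencil hF
  obtain ⟨ζ, hζ, hζ0, ⟨ε, hε, hb⟩, d, hd, hchar⟩ := h.exists_branches hr hT hJ hχ hlam hmult
  have hζc : ∀ i, ContinuousAt (ζ i) χbar := fun i => (hζ i).continuousAt
  have hmem : ∀ᶠ χ in 𝓝 χbar, ∀ i, ζ i χ ∈ Ioo (lam - ε) (lam + ε) :=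
    eventually_all.2 fun i => (hζc i).eventually_mem <| by
      rw [hζ0]
      exact Ioo_mem_nhds (by linarith) (by linarith)
  have hCr : ∀ᶠ χ in 𝓝 χbar, ∀ i, ContDiffAt ℝ r (ζ i) χ :=
    eventually_all.2 fun i => (hζ i).eventually hri
  obtain ⟨U, hU, hUo, hUχ⟩ := eventually_nhds_iff.1
    ((eventually_mem_set.2 hnear).and (hCr.and (hmem.and hb)))
  refine ⟨U, ε, ζ, hUo, hUχ, fun χ hχU => (hU χ hχU).1, hε,
    fun i χ hχU => ((hU χ hχU).2.1 i).contDiffWithinAt, hζ0, fun χ hχU => (hU χ hχU).2.2.1,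
    fun χ hχU μ hμ => ?_, fun hgap => h.eventually_exists_perm hr hT hJ hχ hlam hgap hm hζc hζ0 hε
      hb hkm, fun u hu huo => ?_⟩
  · obtain ⟨w, hw⟩ := (hU χ hχU).2.2.2
    exact hw.rank_eigenspace (abs_lt.2 ⟨by linarith [hμ.1], by linarith [hμ.2]⟩)
  · have hTd : HasDerivAt T (deriv T χbar) χbar :=
      ((hT.contDiffAt hnear).differentiableAt hr0).hasDerivAt
    have hJc : ContDiffAt ℝ r (fun χ => J' χ ∘L F.inclL) χbar :=
      (HilbertPerturbation.isBoundedBilinearMap_comp_real F.VSpace H₀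
        F.VSpace).contDiff.contDiffAt.comp χbar ((hJ.contDiffAt hnear).prodMk contDiffAt_const)
    have hJd := (hJc.differentiableAt hr0).hasDerivAt
    refine ⟨Matrix.of fun i j => inner ℂ (u j) (deriv T χbar (u i)),
      Matrix.of fun i j => inner ℂ (u j) (deriv (fun χ => J' χ ∘L F.inclL) χbar (u i)), d,
      fun i j => ?_, fun i j => ?_, hd, ?_⟩
    · refine (HilbertPerturbation.hasDerivAt_inner_apply hTd (u i) (u j)).congr_of_eventuallyEq ?_
      filter_upwards [hnear] with χ hχ'
      exact (h.inner_T χ hχ' _ _).symm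
    · refine (HilbertPerturbation.hasDerivAt_inner_apply hJd (u i) (u j)).congr_of_eventuallyEq ?_
      filter_upwards [hnear] with χ hχ'
      exact (h.inner_J_incl hχ' _ _).symm
    · -- the matrix is the transpose of that of the derived pencil
      rw [← Matrix.charpoly_transpose]
      have hmat := hchar u hu huo
      convert congrArg Polynomial.roots hmat using 2
      · congr 1
        ext i j
        simp [inner_smul_right_eq_smul]
      · have hroots := Polynomial.roots_multiset_prod_X_sub_C
          (Multiset.map (fun i => (d i : ℂ)) Finset.univ.val)
        rw [Multiset.map_map] at hroots
        exact hroots.symm
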